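/- Let $k$ be an algebraically closed field, and let $\mathbf Q=(\mathbf I,\Omega)$ be a quiver without oriented cycles whose underlying graph is of type $\tilde A_n$, $n\ge 1$ (a cycle with $n+1$ vertices; for $n=1$, two vertices joined by two edges). All representations are finite-dimensional over $k$; a representation of a quiver is written $(\mathbf V,x)$, with spaces $\mathbf V_{\mathbf i}$ at the vertices and linear maps $x_h$ for the arrows $h$. Let $\Phi^+=\tau$ and $\Phi^-=\tau^{-}$ be the Auslander–Reiten translates of $\mathbf Q$: for the path algebra $A$ and $D=\mathrm{Hom}_k(-,k)$, $\tau M=D\,\mathrm{Ext}^1(M,A)$ and $\tau^{-}M=\mathrm{Ext}^1(DM,A)$. An indecomposable representation $M$ is regular if $(\Phi^+)^mM\ne0$ and $(\Phi^-)^mM\neq 0$ for all $m>0$; a representation is regular if all its indecomposable direct summands are. A regular simple is a nonzero regular representation without proper nonzero regular subrepresentations. Its period is the least $p>0$ with $(\Phi^+)^pR\simeq R$. The tube $T$ of $R$ is the set of all indecomposable regular representations whose regular composition factors all lie in the orbit $\{(\Phi^+)^mR\}$, and $Rep(T)$ is the full subcategory of the representations of $\mathbf Q$ all of whose indecomposable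 direct summands are in $T$. Let $R$ be a regular simple of period $p\ne1$, and $T$ its tube. For $r\in\mathbb Z/p\mathbb Z$ put $R_r=(\Phi^+)^{m}R$ with $m\equiv -r\pmod p$, let $S(r)\subseteq\mathbf I$ be the support of $R_r$, and let $\mathbf Q(r)$ be the full subquiver of $\mathbf Q$ on $S(r)$. Let $\mathbf Q_T$ be the cyclic quiver with vertex set $\mathbb Z/p\mathbb Z$ and one arrow $r\to r-1$ for each $r\in\mathbb Z/p\mathbb Z$. Let $Nil(\mathbf Q_T)$ be the category of nilpotent representations of $\mathbf Q_T$, that is, of those for which there is an $N\ge2$ such that the composite along every path of length $N$ is $0$. Then every vertex lies in exactly one of the sets $S(r)$; each $\mathbf Q(r)$ has a unique source $\mathbf s(r)$ and a unique sink $\mathbf t(r)$ and contains a unique path $\rho(r)$ from $\mathbf s(r)$ to $\mathbf t(r)$; there is a unique arrow $h(r)$ in $\Omega$ from $\mathbf s(r)$ to $\mathbf t(r-1)$; and for each $(\mathbf V,x)$ in $Rep(T)$ and each $r$ the composite $x_{\rho(r)}$ of $x$ along $\rho(r)$ is invertible. Moreover the following define functors $$F: Rep(T)\to Nil(\mathbf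 Q_T),\qquad G: Nil(\mathbf Q_T)\to Rep(T)$$ that are mutually quasi-inverse equivalences of categories; in particular $Rep(T)\simeq Nil(\mathbf Q_T)$. - $F(\mathbf V,x)$ has the space $\mathbf V_{\mathbf s(r)}$ at $r$, and its map for the arrow $r\to r-1$ is $x_{\rho(r-1)}^{-1}\circ x_{h(r)}$; for a morphism $\phi$, $F(\phi)_r=\phi_{\mathbf s(r)}$. - $G(W,y)$ has the space $W_r$ at each $\mathbf i\in S(r)$; its map for an arrow $h$ is the identity of $W_r$ if both ends of $h$ lie in $S(r)$, and $y_{r\to r-1}$ if $h$ goes from $S(r)$ to $S(r-1)$; for a morphism $\psi$, $G(\psi)_{\mathbf i}=\psi_r$ for $\mathbf i\in S(r)$. -/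

import Mathlib

open CategoryTheory CategoryTheory.Limits

universe u

namespace AffineTube

/-! ### Representations of quivers

All quivers here are finite: both the vertices and the arrows form types in `Type`, and finiteness
is an assumption of the theorem (finiteness of the arrows out of and into a vertex is needed for the
sums below). -/

/-- Representations of the quiver `I` over `k`: functors from the path category of `I` to
`k`-vector spaces, that is, a space at each vertex and a linear map for each arrow, with the usual
morphisms.  Finite-dimensionality is the separate predicate `QRep.IsFinDim`. -/
abbrev QRep (k : Type u) [Field k] (I : Type) [Quiver.{0} I] : Type (u + 1) :=
  Paths I ⥤ ModuleCat.{u} k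

theorem square_comp {C : Type*} [Category* C] {A A' A'' B B' B'' : C} {m : A ⟶ A'}
    {m' : A' ⟶ A''} {n : B ⟶ B'} {n' : B' ⟶ B''} {a : A ⟶ B} {a' : A' ⟶ B'} {a'' : A'' ⟶ B''}
    (h : m ≫ a' = a ≫ n) (h' : m' ≫ a'' = a' ≫ n') : (m ≫ m') ≫ a'' = a ≫ n ≫ n' := by
  rw [Category.assoc, h', ← Category.assoc, h, Category.assoc]

theorem square_inv {C : Type*} [Category* C] {A A' B B' : C} {m : A ⟶ A'} {n : B ⟶ B'}
    {a : A ⟶ B} {a' : A' ⟶ B'} (hm : IsIso m) (hn : IsIso n) (h : m ≫ a' = a ≫ n) :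
    inv m ≫ a = a' ≫ inv n := by
  rw [IsIso.inv_comp_eq, ← Category.assoc, IsIso.eq_comp_inv]
  exact h.symm

namespace QRep

variable {k : Type u} [Field k] {I : Type} [Quiver.{0} I]

/-- The space at the vertex `i`. -/
abbrev vec (M : QRep k I) (i : I) : ModuleCat.{u} k := Prefunctor.obj M.toPrefunctor i

/-- The linear map of an arrow. -/
abbrev arrow (M : QRep k I) {i j : I} (h : i ⟶ j) : M.vec i ⟶ M.vec j := M.map h.toPath

/-- The linear map of a path (the composite of the maps of its arrows). -/
abbrev path (M : QRep k I) {i j : I} (q : Quiver.Path i j) : M.vec i ⟶ M.vec j := M.map q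

/-- `M` is finite-dimensional. -/
def IsFinDim (M : QRep k I) : Prop := ∀ i : I, Module.Finite k (M.vec i)

/-- The support of `M`. -/
def supp (M : QRep k I) : Set I := {i | Nontrivial (M.vec i)}

/-- `N` is a direct summand of `M`. -/
def IsSummand (N M : QRep k I) : Prop := ∃ N' : QRep k I, Nonempty (M ≅ N ⊞ N')

/-- A morphism of representations from maps at the vertices that commute with the arrows. -/
def homOfArrows {M N : QRep k I} (φ : ∀ i : I, M.vec i ⟶ N.vec i)
    (hφ : ∀ {i j : I} (h : i ⟶ j), M.arrow h ≫ φ j = φ i ≫ N.arrow h) : M ⟶ N where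
  app i := φ i
  naturality i j q := by
    refine Paths.induction (fun {a b} q => M.map q ≫ φ b = φ a ≫ N.map q) ?_ ?_ q
    · intro a
      rw [M.map_id, N.map_id]
      exact (Category.id_comp _).trans (Category.comp_id _).symm
    · intro a b c q h ih
      rw [M.map_comp, N.map_comp]
      exact square_comp ih (hφ h)

theorem eqToHom_app_comm {M N : QRep k I} (φ : M ⟶ N) {i j : I} (e : i = j) :
    eqToHom (congrArg M.vec e) ≫ NatTrans.app φ j =
      NatTrans.app φ i ≫ eqToHom (congrArg N.vec e) := by
  subst e
  exact (Category.id_comp _).trans (Category.comp_id _).symm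

end QRep

/-- A quiver has no oriented cycles. -/
def NoOrientedCycle (I : Type) [Quiver.{0} I] : Prop :=
  ∀ (i : I) (q : Quiver.Path i i), q.length = 0

/-- The underlying graph of the quiver `I` is the cycle with `n + 1` vertices (for `n = 1`: two
vertices joined by two edges).  The vertices are the `v e`, and the arrows the `a e`, one each for
`e ∈ ℤ/(n+1)`; the arrow `a e` joins `v e` and `v (e + 1)`, in one direction or the other. -/
def IsTypeAffineA (n : ℕ) (I : Type) [Quiver.{0} I] : Prop :=
  1 ≤ n ∧ ∃ (v : ZMod (n + 1) ≃ I) (a : ZMod (n + 1) ≃ (Σ i j : I, (i ⟶ j))),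
    ∀ e, ((a e).1 = v e ∧ (a e).2.1 = v (e + 1)) ∨ ((a e).1 = v (e + 1) ∧ (a e).2.1 = v e)

section Translate

/-! ### The Auslander–Reiten translates

Let `A` be the path algebra of a finite quiver without oriented cycles.  A representation `M` has
the standard projective resolution
`0 → ⨁_{h : a → b} P(b) ⊗ M_a → ⨁_i P(i) ⊗ M_i → M → 0`.  The Nakayama functor sends `P(i)` to `I(i)`,
whose space at `j` consists of the functions on the paths `j → i`, and
`τ M = D Ext¹(M, A)` is the kernel of the resulting map
`⨁_{h : a → b} I(b) ⊗ M_a → ⨁_i I(i) ⊗ M_i`.  Dually, `τ⁻ M = Ext¹(D M, A)` is the cokernel of the map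
`⨁_i P(i) ⊗ M_i → ⨁_{h : a → b} P(a) ⊗ M_b` that comes from the standard injective resolution
`0 → M → ⨁_i I(i) ⊗ M_i → ⨁_{h : a → b} I(a) ⊗ M_b → 0`. -/

variable {k : Type u} [Field k] {I : Type} [Quiver.{0} I]

/-- Indices of the summands of `(⨁_{h : a → b} P(a) ⊗ M_b)_j`: an arrow `h : a → b` and a path
`q : a → j`. -/
abbrev ArIndex (I : Type) [Quiver.{0} I] (j : I) : Type :=
  Σ a b : I, (a ⟶ b) × Quiver.Path a j

/-- The space `(⨁_{h : a → b} P(a) ⊗ M_b)_j`. -/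
abbrev ArSum (M : QRep k I) (j : I) : Type u :=
  DirectSum (ArIndex I j) (fun t => M.vec t.2.1)

open Classical in
/-- The vector `v ∈ M_b` in the summand of `h : a → b` and `q : a → j`. -/
noncomputable def arIncl (M : QRep k I) {a b j : I} (h : a ⟶ b) (q : Quiver.Path a j) :
    M.vec b →ₗ[k] ArSum M j :=
  DirectSum.lof k (ArIndex I j) (fun t => M.vec t.2.1) ⟨a, b, h, q⟩

open Classical in
/-- Composition with a path `g : j → j'`. -/
noncomputable def arSumMap (M : QRep k I) {j j' : I} (g : Quiver.Path j j') :
    ArSum M j →ₗ[k] ArSum M j' :=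
  DirectSum.toModule k (ArIndex I j) (ArSum M j')
    (fun t => arIncl M t.2.2.1 (t.2.2.2.comp g))

theorem arSumMap_incl (M : QRep k I) {a b j j' : I} (g : Quiver.Path j j') (h : a ⟶ b)
    (q : Quiver.Path a j) (v : M.vec b) :
    arSumMap M g (arIncl M h q v) = arIncl M h (q.comp g) v := by
  classical
  unfold arSumMap
  rw [arIncl]
  convert DirectSum.toModule_lof (R := k) (ι := ArIndex I j) (M := fun t => M.vec t.2.1)
    (φ := fun t => arIncl M t.2.2.1 (t.2.2.2.comp g)) ⟨a, b, h, q⟩ v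

theorem arSum_ext (M : QRep k I) {j : I} {W : Type u} [AddCommGroup W] [Module k W]
    {f g : ArSum M j →ₗ[k] W}
    (H : ∀ (a b : I) (h : a ⟶ b) (q : Quiver.Path a j) (v : M.vec b),
      f (arIncl M h q v) = g (arIncl M h q v)) : f = g := by
  classical
  refine DirectSum.linearMap_ext k ?_
  rintro ⟨a, b, h, q⟩
  refine LinearMap.ext fun v => ?_
  have := H a b h q v
  simp only [arIncl] at this
  simp only [LinearMap.comp_apply]
  convert this

theorem arSumMap_nil (M : QRep k I) (j : I) :
    arSumMap M (Quiver.Path.nil (a := j)) = LinearMap.id := by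
  refine arSum_ext M fun a b h q v => ?_
  rw [arSumMap_incl, Quiver.Path.comp_nil, LinearMap.id_apply]

theorem arSumMap_comp (M : QRep k I) {j j' j'' : I} (f : Quiver.Path j j')
    (g : Quiver.Path j' j'') :
    arSumMap M (f.comp g) = arSumMap M g ∘ₗ arSumMap M f := by
  refine arSum_ext M fun a b h q v => ?_
  rw [LinearMap.comp_apply, arSumMap_incl, arSumMap_incl, arSumMap_incl, Quiver.Path.comp_assoc]

variable [Fintype I] [∀ i j : I, Fintype (i ⟶ j)]

/-- The space of `τ M` at the vertex `j`: families `φ` that give, for each arrow `h : a → b` and each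
path `q : j → b`, a vector `φ_{h,q}` of `M_a`, such that for each path `w : j → i`
`∑_{h : i → b} φ_{h, w h} = ∑_{h : a → i} x_h (φ_{h, w})`. -/
def arTranslateSpace (M : QRep k I) (j : I) :
    Submodule k (∀ (a b : I) (_ : a ⟶ b) (_ : Quiver.Path j b), M.vec a) where
  carrier := {φ | ∀ (i : I) (w : Quiver.Path j i),
    ∑ b : I, ∑ h : i ⟶ b, φ i b h (w.cons h) =
      ∑ a : I, ∑ h : a ⟶ i, (M.arrow h).hom (φ a i h w)}
  add_mem' := by
    intro φ ψ hφ hψ i w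
    simp only [Pi.add_apply, map_add, Finset.sum_add_distrib]
    rw [hφ i w, hψ i w]
  zero_mem' := by
    intro i w
    simp
  smul_mem' := by
    intro c φ hφ i w
    simp only [Pi.smul_apply, map_smul, ← Finset.smul_sum]
    rw [hφ i w]

/-- The map `(τ M)_j → (τ M)_{j'}` of a path `g : j → j'`. -/
def arTranslateMap (M : QRep k I) {j j' : I} (g : Quiver.Path j j') :
    arTranslateSpace M j →ₗ[k] arTranslateSpace M j' where
  toFun φ := ⟨fun a b h q => φ.1 a b h (g.comp q), fun i w => φ.2 i (g.comp w)⟩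
  map_add' _ _ := rfl
  map_smul' _ _ := rfl

/-- The Auslander–Reiten translate `τ M` (denoted `Φ⁺ M` as a Coxeter functor). -/
def arTranslate (M : QRep k I) : QRep k I where
  obj j := ModuleCat.of k (arTranslateSpace M j)
  map g := ModuleCat.ofHom (arTranslateMap M g)
  map_id j := by
    refine ModuleCat.hom_ext (LinearMap.ext fun φ => Subtype.ext ?_)
    funext a b h q
    exact congrArg (φ.1 a b h) (Quiver.Path.nil_comp q)
  map_comp f g := by
    refine ModuleCat.hom_ext (LinearMap.ext fun φ => Subtype.ext ?_)
    funext a b h q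
    exact congrArg (φ.1 a b h) (Quiver.Path.comp_assoc f g q)

/-- The image of `v ∈ M_i` at the path `q : i → j` under
`(⨁_i P(i) ⊗ M_i)_j → (⨁_{h : a → b} P(a) ⊗ M_b)_j`. -/
noncomputable def arRel (M : QRep k I) {i j : I} (q : Quiver.Path i j) (v : M.vec i) : ArSum M j :=
  (∑ b : I, ∑ h : i ⟶ b, arIncl M h q ((M.arrow h).hom v)) -
    ∑ a : I, ∑ h : a ⟶ i, arIncl M h (h.toPath.comp q) v

/-- The image of `(⨁_i P(i) ⊗ M_i)_j` in `(⨁_{h : a → b} P(a) ⊗ M_b)_j`. -/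
noncomputable def arRelSpace (M : QRep k I) (j : I) : Submodule k (ArSum M j) :=
  Submodule.span k {z | ∃ (i : I) (q : Quiver.Path i j) (v : M.vec i), z = arRel M q v}

theorem arSumMap_rel (M : QRep k I) {i j j' : I} (g : Quiver.Path j j') (q : Quiver.Path i j)
    (v : M.vec i) : arSumMap M g (arRel M q v) = arRel M (q.comp g) v := by
  simp only [arRel, map_sub, map_sum, arSumMap_incl, Quiver.Path.comp_assoc]

theorem arRelSpace_le (M : QRep k I) {j j' : I} (g : Quiver.Path j j') :
    arRelSpace M j ≤ (arRelSpace M j').comap (arSumMap M g) := by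
  refine Submodule.span_le.2 ?_
  rintro _ ⟨i, q, v, rfl⟩
  exact Submodule.subset_span ⟨i, q.comp g, v, arSumMap_rel M g q v⟩

/-- The map `(τ⁻ M)_j → (τ⁻ M)_{j'}` of a path `g : j → j'`. -/
noncomputable def arTranslateInvMap (M : QRep k I) {j j' : I} (g : Quiver.Path j j') :
    (ArSum M j ⧸ arRelSpace M j) →ₗ[k] (ArSum M j' ⧸ arRelSpace M j') :=
  Submodule.mapQ _ _ (arSumMap M g) (arRelSpace_le M g)

theorem arTranslateInvMap_nil (M : QRep k I) (j : I) :
    arTranslateInvMap M (Quiver.Path.nil (a := j)) = LinearMap.id := by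
  refine Submodule.linearMap_qext _ (LinearMap.ext fun z => ?_)
  simp [arTranslateInvMap, arSumMap_nil]

theorem arTranslateInvMap_comp (M : QRep k I) {j j' j'' : I} (f : Quiver.Path j j')
    (g : Quiver.Path j' j'') :
    arTranslateInvMap M (f.comp g) = arTranslateInvMap M g ∘ₗ arTranslateInvMap M f := by
  refine Submodule.linearMap_qext _ (LinearMap.ext fun z => ?_)
  simp [arTranslateInvMap, arSumMap_comp]

/-- The inverse Auslander–Reiten translate `τ⁻ M` (denoted `Φ⁻ M` as a Coxeter functor). -/
noncomputable def arTranslateInv (M : QRep k I) : QRep k I where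
  obj j := ModuleCat.of k (ArSum M j ⧸ arRelSpace M j)
  map g := ModuleCat.ofHom (arTranslateInvMap M g)
  map_id j := ModuleCat.hom_ext (arTranslateInvMap_nil M j)
  map_comp f g := ModuleCat.hom_ext (arTranslateInvMap_comp M f g)

end Translate

/-! ### The cyclic quiver and its nilpotent representations -/

/-- The vertices `ℤ/p` of the cyclic quiver. -/
def CyclicVertex (p : ℕ) : Type := ZMod p

instance (p : ℕ) : CommRing (CyclicVertex p) := inferInstanceAs (CommRing (ZMod p))

/-- The cyclic quiver with vertices `ℤ/p` and one arrow `r → r - 1` for each `r`. -/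
instance cyclicQuiver (p : ℕ) : Quiver.{0} (CyclicVertex p) where
  Hom r r' := PLift (r' = r - 1)

/-- The nilpotent (finite-dimensional) representations of the cyclic quiver. -/
def nilpotentRep (k : Type u) [Field k] (p : ℕ) : ObjectProperty (QRep k (CyclicVertex p)) :=
  fun W => W.IsFinDim ∧ ∃ N : ℕ, 2 ≤ N ∧
    ∀ (r r' : CyclicVertex p) (q : Quiver.Path r r'), q.length = N → W.path q = 0

section Tubes

/-! ### Regular representations and tubes -/

variable {k : Type u} [Field k] {I : Type} [Quiver.{0} I] [Fintype I]
  [∀ i j : I, Fintype (i ⟶ j)]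

/-- An indecomposable finite-dimensional representation is regular if no power of `τ` or of `τ⁻`
kills it. -/
def IsRegularIndecomposable (M : QRep k I) : Prop :=
  M.IsFinDim ∧ Indecomposable M ∧
    ∀ r : ℕ, ¬ IsZero (arTranslate^[r] M) ∧ ¬ IsZero (arTranslateInv^[r] M)

/-- A finite-dimensional representation is regular if all its indecomposable summands are. -/
def IsRegularRep (M : QRep k I) : Prop :=
  M.IsFinDim ∧ ∀ N : QRep k I, Indecomposable N → N.IsSummand M → IsRegularIndecomposable N

/-- The simple objects of the category of regular representations: nonzero regular representations
without proper nonzero regular subrepresentations. -/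
def IsRegularSimple (S : QRep k I) : Prop :=
  IsRegularRep S ∧ ¬ IsZero S ∧
    ∀ (Y : QRep k I) (f : Y ⟶ S), Mono f → IsRegularRep Y → IsZero Y ∨ IsIso f

/-- `p` is the period of `R` under `τ`. -/
def HasPeriod (R : QRep k I) (p : ℕ) : Prop :=
  IsLeast {m : ℕ | 0 < m ∧ Nonempty (arTranslate^[m] R ≅ R)} p

/-- `M` has a finite filtration with all factors isomorphic to representations in the `τ`-orbit of
`R`. -/
inductive HasFactorsInOrbit (R : QRep k I) : QRep k I → Prop
  | zero (M : QRep k I) (hM : IsZero M) : HasFactorsInOrbit R M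
  | extension (E : ShortComplex (QRep k I)) (hE : E.ShortExact) (h₁ : HasFactorsInOrbit R E.X₁)
      (r : ℕ) (h₃ : Nonempty (E.X₃ ≅ arTranslate^[r] R)) : HasFactorsInOrbit R E.X₂

/-- The tube of the regular simple `R`: the indecomposable regular representations all of whose
regular composition factors lie in the `τ`-orbit of `R`. -/
def InTube (R M : QRep k I) : Prop := IsRegularIndecomposable M ∧ HasFactorsInOrbit R M

/-- `Rep(T)` for the tube `T` of `R`: the finite-dimensional representations all of whose
indecomposable direct summands are in `T`. -/
def repTube (R : QRep k I) : ObjectProperty (QRep k I) := fun M =>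
  M.IsFinDim ∧ ∀ N : QRep k I, Indecomposable N → N.IsSummand M → InTube R N

/-- The regular simple `R_r` of the tube of `R` (of period `p`), for `r ∈ ℤ/p`: it is
`τ^m R` for the representative `m ∈ {0, …, p-1}` of `-r`, so that `R_0 = R` and
`τ R_r ≅ R_{r-1}`. -/
def orbitSimple (R : QRep k I) (p : ℕ) (r : CyclicVertex p) : QRep k I := arTranslate^[ZMod.val (n := p) (-r)] R

end Tubes

/-! ### The functors `F` and `G` -/

section Functors

variable {k : Type u} [Field k] {I : Type} [Quiver.{0} I]

/-- The source of the full subquiver with vertex set `S`. -/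
def IsSourceOf (S : Set I) (i : I) : Prop := i ∈ S ∧ ∀ j ∈ S, IsEmpty (j ⟶ i)

/-- The sink of the full subquiver with vertex set `S`. -/
def IsSinkOf (S : Set I) (i : I) : Prop := i ∈ S ∧ ∀ j ∈ S, IsEmpty (i ⟶ j)

/-- For a family of sets `S r` of vertices, `r ∈ ℤ/p`, the data used to build `F` and `G`: the sets
partition the vertices, with `i ∈ S (c i)`; each full subquiver on `S r` has a unique source `s r`, a
unique sink `t r` and a unique path `ρ r` in it from `s r` to `t r`; and for each arrow `r → r' = r - 1`
of the cyclic quiver there is a unique arrow `h` from `s r` to `t r'`.  So the data are determined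
by `S`. -/
structure TubeData (p : ℕ) (S : CyclicVertex p → Set I) where
  /-- the index of the set that contains a vertex -/
  c : I → CyclicVertex p
  mem_iff : ∀ i r, i ∈ S r ↔ c i = r
  /-- the unique source -/
  s : CyclicVertex p → I
  source_iff : ∀ r i, IsSourceOf (S r) i ↔ i = s r
  /-- the unique sink -/
  t : CyclicVertex p → I
  sink_iff : ∀ r i, IsSinkOf (S r) i ↔ i = t r
  /-- the unique path from the source to the sink inside `S r` -/
  ρ : ∀ r, Quiver.Path (s r) (t r)
  path_iff : ∀ r (q : Quiver.Path (s r) (t r)), (∀ i ∈ q.vertices, i ∈ S r) ↔ q = ρ r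
  /-- the unique arrow from `s r` to `t (r - 1)` -/
  h : ∀ {r r' : CyclicVertex p}, (r ⟶ r') → (s r ⟶ t r')
  arrow_unique : ∀ {r r' : CyclicVertex p} (e : r ⟶ r') (g : s r ⟶ t r'), g = h e

namespace TubeData

variable {p : ℕ} {S : CyclicVertex p → Set I} (D : TubeData p S)

/-- `F` on objects: `F(V)_r = V_{s(r)}`, and the arrow `r → r - 1` acts as
`x_{ρ(r-1)}⁻¹ ∘ x_{h(r)}`. -/
noncomputable def objF (M : QRep k I) (hM : ∀ r, IsIso (M.path (D.ρ r))) :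
    QRep k (CyclicVertex p) :=
  Paths.lift
    { obj := fun r => M.vec (D.s r)
      map := fun {_ r'} e =>
        haveI := hM r'
        M.arrow (D.h e) ≫ inv (M.path (D.ρ r')) }

theorem objF_arrow (M : QRep k I) (hM : ∀ r, IsIso (M.path (D.ρ r))) {r r' : CyclicVertex p}
    (e : r ⟶ r') :
    (D.objF M hM).arrow e =
      haveI := hM r'
      M.arrow (D.h e) ≫ inv (M.path (D.ρ r')) :=
  Category.id_comp _

/-- `F` on morphisms: `F(φ)_r = φ_{s(r)}`. -/
noncomputable def mapF {M M' : QRep k I} (hM : ∀ r, IsIso (M.path (D.ρ r)))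
    (hM' : ∀ r, IsIso (M'.path (D.ρ r))) (φ : M ⟶ M') : D.objF M hM ⟶ D.objF M' hM' :=
  QRep.homOfArrows (fun r => NatTrans.app φ (D.s r)) (by
    intro r r' e
    have h1 : M.arrow (D.h e) ≫ NatTrans.app φ (D.t r') =
        NatTrans.app φ (D.s r) ≫ M'.arrow (D.h e) := φ.naturality (D.h e).toPath
    have h2 : M.path (D.ρ r') ≫ NatTrans.app φ (D.t r') =
        NatTrans.app φ (D.s r') ≫ M'.path (D.ρ r') := φ.naturality (D.ρ r')
    rw [D.objF_arrow, D.objF_arrow]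
    exact square_comp h1 (square_inv (hM r') (hM' r') h2))

/-- The functor `F`, from a full subcategory `P` of representations on which the maps `x_{ρ(r)}` are
invertible and `F` takes nilpotent values, to the nilpotent representations of the cyclic quiver. -/
noncomputable def functorF (P : ObjectProperty (QRep k I))
    (hP : ∀ M, P M → ∀ r, IsIso (M.path (D.ρ r)))
    (hnil : ∀ (M : QRep k I) (hM : P M), nilpotentRep k p (D.objF M (hP M hM))) :
    P.FullSubcategory ⥤ (nilpotentRep k p).FullSubcategory where
  obj M := ⟨D.objF M.obj (hP M.obj M.property), hnil M.obj M.property⟩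
  map φ := ObjectProperty.homMk (D.mapF _ _ φ.hom)

/-- `G` on objects: `G(W)_i = W_r` if `i ∈ S r`; an arrow inside some `S r` acts as the identity of
`W_r`, and an arrow from `S r` to `S (r - 1)` acts as `y_{r → r-1}`.  (The value `0` is
for arrows of neither kind.) -/
noncomputable def objG (W : QRep k (CyclicVertex p)) : QRep k I :=
  haveI := Classical.decEq (CyclicVertex p)
  Paths.lift
    { obj := fun i => W.vec (D.c i)
      map := fun {i j} _ =>
        if e : D.c i = D.c j then eqToHom (congrArg W.vec e)
        else if e' : D.c j = D.c i - 1 then W.arrow (PLift.up e') else 0 }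

open Classical in
theorem objG_arrow (W : QRep k (CyclicVertex p)) {i j : I} (g : i ⟶ j) :
    (D.objG W).arrow g =
      if e : D.c i = D.c j then eqToHom (congrArg W.vec e)
      else if e' : D.c j = D.c i - 1 then W.arrow (PLift.up e') else 0 := by
  refine (Category.id_comp _).trans ?_
  congr 1

/-- `G` on morphisms: `G(ψ)_i = ψ_r` if `i ∈ S r`. -/
noncomputable def mapG {W W' : QRep k (CyclicVertex p)} (ψ : W ⟶ W') : D.objG W ⟶ D.objG W' :=
  QRep.homOfArrows (fun i => NatTrans.app ψ (D.c i)) (by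
    intro i j g
    rw [D.objG_arrow, D.objG_arrow]
    split_ifs with e e'
    · exact QRep.eqToHom_app_comm ψ e
    · exact ψ.naturality (Quiver.Hom.toPath (PLift.up e'))
    · exact zero_comp.trans comp_zero.symm)

/-- The functor `G`, from the nilpotent representations of the cyclic quiver to a full subcategory
`P` of representations that contains its values. -/
noncomputable def functorG (P : ObjectProperty (QRep k I))
    (hG : ∀ W : QRep k (CyclicVertex p), nilpotentRep k p W → P (D.objG W)) :
    (nilpotentRep k p).FullSubcategory ⥤ P.FullSubcategory where
  obj W := ⟨D.objG W.obj, hG W.obj W.property⟩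
  map ψ := ObjectProperty.homMk (D.mapG ψ.hom)

end TubeData
end Functors

end AffineTube

open AffineTube

/-!
Choose a direction around the cycle and colour each arrow by whether it agrees with that direction
(`DirectionColouring`). Fix a colour `d`. As there are no oriented cycles, each vertex lies on a
unique maximal path of colour `d`; these paths, possibly of length zero, are the *segments*. An
arrow of the other colour runs from the first vertex of a segment to the last vertex of a segment,
the `next` one, and `next` permutes the segments cyclically. Each segment carries a thin
representation `segmentRep`, with the line `k` at its vertices and identity maps along it.

*The translate.* The translate of `segmentRep s` is `segmentRep (next s)`
(`arTranslate_segmentRep`). There is an explicit injective morphism from the latter to the former.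
It is invertible because `τ` preserves injectivity of the maps of colour `d`
(`InjectiveOn.arTranslate`) and `(τ M)_j` then embeds into `M_a` for each arrow `a → j` of the
other colour, which bounds the dimensions (`InjectiveOn.arTranslateEval_injective`).

*The regular simples.* Let `R` be regular simple of period other than `1`. If all maps of `R` were
injective, the dimensions could not grow along the `τ`-orbit, so periodicity would make all maps
bijective, and then `τ R ≅ R` (`nonempty_iso_arTranslate_of_injective`). So some arrow `h : s → t`
kills a nonzero vector. With `d` the colour opposite to that of `h`, this vector generates
`segmentRep s` inside `R`; it generates at least the thin representation of an initial part of the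
segment, and a proper part would split off and be killed by `τ⁻` (`exists_injective_segmentRep`).
As `R` is simple, `R ≅ segmentRep s` (`exists_iso_segmentRep`). Hence the supports of the `R_r`
are the segments of colour `d`, and the paths `ρ(r)` and arrows `h(r)` can be read off
(`TubeData.exists_adapted`).

*The tube.* Call a representation tubular if the arrows of colour `d` act bijectively and its
image under `F` is nilpotent. This property holds for zero and the thin representations of the
segments and passes to extensions and summands, so it holds on `Rep(T)`
(`TubeData.Adapted.isTubular_of_repTube`). Conversely, on a nonzero nilpotent representation of
the cyclic quiver some arrow is not injective and some arrow is not surjective, so a nonzero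
tubular representation has some `segmentRep` as a subobject and some `segmentRep` as a quotient.
The quotients give, by induction on the dimension, a filtration by the `R_r`. For an
indecomposable representation, the subobject shows that no power of `τ` kills it, since `τ` is
left exact, and the quotient shows that no power of `τ⁻` does, since `τ⁻` is left adjoint to `τ`.
So `Rep(T)` consists of the finite-dimensional tubular representations
(`TubeData.Adapted.repTube_of_isTubular`).

*The equivalence.* For tubular `M`, the maps of `M` along the paths of colour `d` give a natural
isomorphism `G (F M) ≅ M`, and `F (G W) ≅ W` is clear; see `TubeData.Adapted.exists_equivalence`.
-/

namespace AffineTube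

/-! ### Two-coloured quivers -/

/-- A colouring of the arrows of a quiver by the two directions in which one can run around a cycle.
The axioms say that the underlying graph is connected, and that each vertex has exactly two
half-edges, one for each `c : Bool`: an arrow out of colour `c` or an arrow in of colour `!c`. -/
structure DirectionColouring (I : Type) [Quiver.{0} I] where
  /-- the colour of an arrow -/
  col : ∀ {i j : I}, (i ⟶ j) → Bool
  out_unique : ∀ {i j j' : I} (h : i ⟶ j) (h' : i ⟶ j'), col h = col h' →
    (⟨j, h⟩ : Σ j, (i ⟶ j)) = ⟨j', h'⟩
  in_unique : ∀ {i i' j : I} (h : i ⟶ j) (h' : i' ⟶ j), col h = col h' →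
    (⟨i, h⟩ : Σ i, (i ⟶ j)) = ⟨i', h'⟩
  col_eq : ∀ {a i j : I} (h : a ⟶ i) (h' : i ⟶ j), col h = col h'
  out_or_in : ∀ (c : Bool) (i : I), (∃ (j : I) (h : i ⟶ j), col h = c) ∨
    ∃ (a : I) (h : a ⟶ i), col h = !c
  connected : ∀ U : Set I, U.Nonempty → (∀ {i j : I}, (i ⟶ j) → (i ∈ U ↔ j ∈ U)) → U = Set.univ

/-- The arrows of a quiver of type `Ã_n` are coloured by whether `a e` runs from `v e` to `v (e +
1)` or back. -/
theorem exists_directionColouring {n : ℕ} {I : Type} [Quiver.{0} I] (hA : IsTypeAffineA n I) :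
    Nonempty (DirectionColouring I) := by
  classical
  obtain ⟨hn, v, a, ha⟩ := hA
  have : Fact (1 < n + 1) := ⟨by omega⟩
  have hne : ∀ e, v e ≠ v (e + 1) := fun e h => by
    have := v.injective h
    simp at this
  -- the arrow `h` is coloured `true` if it runs from `v e` to `v (e + 1)`
  have key : ∀ {i j : I} (h : i ⟶ j), ∃ e, a e = ⟨i, j, h⟩ ∧
      ((decide (i = v (a.symm ⟨i, j, h⟩)) = true ∧ i = v e ∧ j = v (e + 1)) ∨
       (decide (i = v (a.symm ⟨i, j, h⟩)) = false ∧ i = v (e + 1) ∧ j = v e)) := by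
    intro i j h
    refine ⟨a.symm ⟨i, j, h⟩, by simp, ?_⟩
    have := ha (a.symm ⟨i, j, h⟩)
    rw [Equiv.apply_symm_apply] at this
    dsimp only at this
    rcases this with ⟨h1, h2⟩ | ⟨h1, h2⟩
    · exact Or.inl ⟨by simpa using h1, h1, h2⟩
    · refine Or.inr ⟨?_, h1, h2⟩
      rw [decide_eq_false_iff_not]
      intro h3
      exact hne _ (h3.symm.trans h1)
  refine ⟨⟨fun {i j} h => decide (i = v (a.symm ⟨i, j, h⟩)), ?_, ?_, ?_, ?_, ?_⟩⟩
  · intro i j j' h h' hc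
    obtain ⟨e, he, h1⟩ := key h
    obtain ⟨e', he', h1'⟩ := key h'
    have : e = e' := by
      rcases h1 with ⟨c1, s1, -⟩ | ⟨c1, s1, -⟩ <;> rcases h1' with ⟨c2, s2, -⟩ | ⟨c2, s2, -⟩
      · exact v.injective (s1.symm.trans s2)
      · simp_all
      · simp_all
      · exact add_right_cancel (v.injective (s1.symm.trans s2))
    subst this
    have := he.symm.trans he'
    simpa using this
  · intro i i' j h h' hc
    obtain ⟨e, he, h1⟩ := key h
    obtain ⟨e', he', h1'⟩ := key h'
    have : e = e' := by
      rcases h1 with ⟨c1, -, s1⟩ | ⟨c1, -, s1⟩ <;> rcases h1' with ⟨c2, -, s2⟩ | ⟨c2, -, s2⟩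
      · exact add_right_cancel (v.injective (s1.symm.trans s2))
      · simp_all
      · simp_all
      · exact v.injective (s1.symm.trans s2)
    subst this
    have := he.symm.trans he'
    rw [Sigma.mk.injEq] at this
    obtain ⟨rfl, this⟩ := this
    simpa using this
  · intro i j l h h'
    obtain ⟨e, he, h1⟩ := key h
    obtain ⟨e', he', h1'⟩ := key h'
    rcases h1 with ⟨c1, s1, t1⟩ | ⟨c1, s1, t1⟩ <;> rcases h1' with ⟨c2, s2, t2⟩ | ⟨c2, s2, t2⟩
    · rw [c1, c2]
    · have := add_right_cancel (v.injective (t1.symm.trans s2))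
      subst this
      have h3 := congrArg Sigma.fst (he.symm.trans he')
      exact absurd (s1.symm.trans (h3.trans s2)) (hne _)
    · have := v.injective (t1.symm.trans s2)
      subst this
      have h3 := congrArg Sigma.fst (he.symm.trans he')
      exact absurd (s2.symm.trans (h3.symm.trans s1)) (hne _)
    · rw [c1, c2]
  · intro c i
    obtain ⟨e, rfl⟩ := v.surjective i
    cases c
    · rcases hx : a (e - 1) with ⟨x, y, h⟩
      obtain ⟨e', he, h1⟩ := key h
      have : e' = e - 1 := a.injective (he.trans hx.symm)
      subst this
      rw [sub_add_cancel] at h1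
      rcases h1 with ⟨c1, s1, t1⟩ | ⟨c1, s1, t1⟩
      · subst t1
        exact Or.inr ⟨x, h, c1⟩
      · subst s1
        exact Or.inl ⟨y, h, c1⟩
    · rcases hx : a e with ⟨x, y, h⟩
      obtain ⟨e', he, h1⟩ := key h
      have : e' = e := a.injective (he.trans hx.symm)
      subst this
      rcases h1 with ⟨c1, s1, t1⟩ | ⟨c1, s1, t1⟩
      · subst s1
        exact Or.inl ⟨y, h, c1⟩
      · subst t1
        exact Or.inr ⟨x, h, c1⟩
  · intro U hU hcl
    have step : ∀ e, v e ∈ U ↔ v (e + 1) ∈ U := by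
      intro e
      rcases hx : a e with ⟨x, y, h⟩
      have h1 := ha e
      rw [hx] at h1
      rcases h1 with ⟨h1, h2⟩ | ⟨h1, h2⟩
      · rw [← h1, ← h2]; exact hcl h
      · rw [← h1, ← h2]; exact (hcl h).symm
    have all : ∀ (m : ℕ) (e : ZMod (n + 1)), v e ∈ U ↔ v (e + m) ∈ U := by
      intro m e
      induction m with
      | zero => simp
      | succ m ih => rw [ih, step, Nat.cast_succ, add_assoc]
    obtain ⟨x, hx⟩ := hU
    obtain ⟨e, rfl⟩ := v.surjective x
    refine Set.eq_univ_of_forall fun y => ?_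
    obtain ⟨e', rfl⟩ := v.surjective y
    have := (all (e' - e).val e).1 hx
    rwa [ZMod.natCast_val, ZMod.cast_id, add_sub_cancel] at this

/-- `i` precedes `j` if there is a nontrivial path from `i` to `j`. -/
def Precedes {I : Type} [Quiver.{0} I] (i j : I) : Prop := ∃ q : Quiver.Path i j, 0 < q.length

theorem Precedes.of_arrow {I : Type} [Quiver.{0} I] {i j : I} (h : i ⟶ j) : Precedes i j :=
  ⟨h.toPath, by simp⟩

theorem NoOrientedCycle.isStrictOrder {I : Type} [Quiver.{0} I] (hQ : NoOrientedCycle I) :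
    IsStrictOrder I Precedes where
  irrefl i := fun ⟨q, hq⟩ => by have := hQ i q; omega
  trans := fun _ _ _ ⟨q, hq⟩ ⟨q', _⟩ => ⟨q.comp q', by rw [Quiver.Path.length_comp]; omega⟩

theorem NoOrientedCycle.wf {I : Type} [Quiver.{0} I] [Finite I] (hQ : NoOrientedCycle I) :
    WellFounded (Precedes (I := I)) :=
  haveI := hQ.isStrictOrder
  Finite.wellFounded_of_trans_of_irrefl _

theorem NoOrientedCycle.wf_swap {I : Type} [Quiver.{0} I] [Finite I] (hQ : NoOrientedCycle I) :
    WellFounded (Function.swap (Precedes (I := I))) :=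
  haveI := hQ.isStrictOrder
  haveI : IsStrictOrder I (Function.swap Precedes) :=
    { irrefl := fun i => irrefl_of Precedes i
      trans := fun _ _ _ h h' => trans_of Precedes h' h }
  Finite.wellFounded_of_trans_of_irrefl _

namespace DirectionColouring

variable {I : Type} [Quiver.{0} I] (B : DirectionColouring I)

/-- All arrows of a path have the colour `d`. -/
def Monochrome (d : Bool) {i : I} : ∀ {j : I}, Quiver.Path i j → Prop
  | _, .nil => True
  | _, .cons q h => Monochrome d q ∧ B.col h = d

variable {B}

theorem Monochrome.comp {d : Bool} {i j l : I} {q : Quiver.Path i j} {q' : Quiver.Path j l}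
    (hq : B.Monochrome d q) (hq' : B.Monochrome d q') : B.Monochrome d (q.comp q') := by
  induction q' with
  | nil => exact hq
  | cons q' h ih => exact ⟨ih hq'.1, hq'.2⟩

theorem mono_toPath {d : Bool} {i j : I} {h : i ⟶ j} (hc : B.col h = d) : B.Monochrome d h.toPath :=
  ⟨trivial, hc⟩

/-- No arrow of colour `d` ends at `i`. -/
def IsStart (B : DirectionColouring I) (d : Bool) (i : I) : Prop :=
  ∀ (a : I) (h : a ⟶ i), B.col h ≠ d

/-- No arrow of colour `d` starts at `i`. -/
def IsEnd (B : DirectionColouring I) (d : Bool) (i : I) : Prop :=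
  ∀ (b : I) (h : i ⟶ b), B.col h ≠ d

theorem isStart_of_out {d : Bool} {i j : I} (h : i ⟶ j) (hc : B.col h = !d) : B.IsStart d i := by
  intro _ h' h''
  have := B.col_eq h' h
  rw [hc, h''] at this
  cases d <;> simp at this

theorem isEnd_of_in {d : Bool} {i j : I} (h : i ⟶ j) (hc : B.col h = !d) : B.IsEnd d j := by
  intro _ h' h''
  have := B.col_eq h h'
  rw [hc, h''] at this
  cases d <;> simp at this

theorem IsStart.exists_out {d : Bool} {i : I} (hi : B.IsStart d i) :
    ∃ (j : I) (h : i ⟶ j), B.col h = !d := by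
  rcases B.out_or_in (!d) i with h | ⟨a, h, hc⟩
  · exact h
  · rw [Bool.not_not] at hc
    exact absurd hc (hi _ h)

theorem IsEnd.exists_in {d : Bool} {i : I} (hi : B.IsEnd d i) :
    ∃ (a : I) (h : a ⟶ i), B.col h = !d := by
  rcases B.out_or_in d i with ⟨j, h, hc⟩ | h
  · exact absurd hc (hi _ h)
  · exact h

/-- A path of one colour into `j` ends with a given arrow of that colour into `j`. -/
theorem Monochrome.eq_cons {d : Bool} {s i j : I} (hs : B.IsStart d s) {q : Quiver.Path s j}
    (hq : B.Monochrome d q) (h : i ⟶ j) (hc : B.col h = d) :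
    ∃ q' : Quiver.Path s i, B.Monochrome d q' ∧ q = q'.cons h := by
  cases q with
  | nil => exact absurd hc (hs _ h)
  | cons q' h' =>
    have := B.in_unique h h' (hc.trans hq.2.symm)
    obtain ⟨rfl, this⟩ := Sigma.mk.inj_iff.1 this
    obtain rfl := eq_of_heq this
    exact ⟨q', hq.1, rfl⟩

theorem Monochrome.start_unique {d : Bool} {s s' i : I} (hs : B.IsStart d s) (hs' : B.IsStart d s')
    {q : Quiver.Path s i} {q' : Quiver.Path s' i} (hq : B.Monochrome d q)
    (hq' : B.Monochrome d q') :
    s = s' := by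
  induction q with
  | nil =>
    cases q' with
    | nil => rfl
    | cons q' h => exact absurd hq'.2 (hs _ h)
  | cons q h ih =>
    obtain ⟨q'', hq'', -⟩ := hq'.eq_cons hs' h hq.2
    exact ih hq.1 hq''

theorem Monochrome.path_unique {d : Bool} {s i : I} (hs : B.IsStart d s)
    {q q' : Quiver.Path s i} (hq : B.Monochrome d q) (hq' : B.Monochrome d q') : q = q' := by
  induction q with
  | nil =>
    cases q' with
    | nil => rfl
    | cons q' h => exact absurd hq'.2 (hs _ h)
  | cons q h ih =>
    obtain ⟨q'', hq'', rfl⟩ := hq'.eq_cons hs h hq.2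
    rw [ih hq.1 hq'']

/-- A path of one colour out of `i` begins with a given arrow of that colour out of `i`. -/
theorem Monochrome.eq_nil_or_tail {d : Bool} {i j x : I} (h : i ⟶ j) (hc : B.col h = d)
    {q : Quiver.Path i x} (hq : B.Monochrome d q) :
    i = x ∨ ∃ q' : Quiver.Path j x, B.Monochrome d q' := by
  induction q with
  | nil => exact Or.inl rfl
  | cons q g ih =>
    right
    rcases ih hq.1 with rfl | ⟨q', hq'⟩
    · have := B.out_unique h g (hc.trans hq.2.symm)
      obtain ⟨rfl, -⟩ := Sigma.mk.inj_iff.1 this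
      exact ⟨.nil, trivial⟩
    · exact ⟨q'.cons g, hq', hq.2⟩

theorem Monochrome.eq_of_isEnd {d : Bool} {t x : I} (ht : B.IsEnd d t) {q : Quiver.Path t x}
    (hq : B.Monochrome d q) : t = x := by
  induction q with
  | nil => rfl
  | cons q g ih =>
    obtain rfl := ih hq.1
    exact absurd hq.2 (ht _ g)

theorem Monochrome.end_unique {d : Bool} {i t t' : I} (ht : B.IsEnd d t) (ht' : B.IsEnd d t')
    {q : Quiver.Path i t} {q' : Quiver.Path i t'} (hq : B.Monochrome d q)
    (hq' : B.Monochrome d q') :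
    t = t' := by
  have key : ∀ {j : I} (q : Quiver.Path i j), B.Monochrome d q →
      ∃ q'' : Quiver.Path j t', B.Monochrome d q'' := by
    intro j q hq
    induction q with
    | nil => exact ⟨q', hq'⟩
    | cons q g ih =>
      obtain ⟨q'', hq''⟩ := ih hq.1
      rcases hq''.eq_nil_or_tail g hq.2 with rfl | h
      · exact absurd hq.2 (ht' _ g)
      · exact h
  obtain ⟨q'', hq''⟩ := key q hq
  exact hq''.eq_of_isEnd ht

theorem exists_start [Finite I] (hQ : NoOrientedCycle I) (B : DirectionColouring I) (d : Bool)
    (i : I) : ∃ s, B.IsStart d s ∧ ∃ q : Quiver.Path s i, B.Monochrome d q := by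
  induction i using hQ.wf.induction with
  | _ i ih =>
    by_cases hi : B.IsStart d i
    · exact ⟨i, hi, .nil, trivial⟩
    · simp only [IsStart, not_forall, not_not] at hi
      obtain ⟨a, h, hc⟩ := hi
      obtain ⟨s, hs, q, hq⟩ := ih a (Precedes.of_arrow h)
      exact ⟨s, hs, q.cons h, hq, hc⟩

theorem exists_end [Finite I] (hQ : NoOrientedCycle I) (B : DirectionColouring I) (d : Bool)
    (i : I) : ∃ t, B.IsEnd d t ∧ ∃ q : Quiver.Path i t, B.Monochrome d q := by
  induction i using hQ.wf_swap.induction with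
  | _ i ih =>
    by_cases hi : B.IsEnd d i
    · exact ⟨i, hi, .nil, trivial⟩
    · simp only [IsEnd, not_forall, not_not] at hi
      obtain ⟨a, h, hc⟩ := hi
      obtain ⟨s, hs, q, hq⟩ := ih a (Precedes.of_arrow h)
      exact ⟨s, hs, h.toPath.comp q, (mono_toPath hc).comp hq⟩

section Segments

variable [Finite I] (hQ : NoOrientedCycle I) (B) (d : Bool)

/-- The first vertex of the maximal path of colour `d` through `i`. -/
noncomputable def start (i : I) : I := (exists_start hQ B d i).choose

/-- The last vertex of the maximal path of colour `d` through `i`. -/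
noncomputable def finish (i : I) : I := (exists_end hQ B d i).choose

/-- The path of colour `d` to `i` from the first vertex of the maximal one. -/
noncomputable def fromStart (i : I) : Quiver.Path (B.start hQ d i) i :=
  (exists_start hQ B d i).choose_spec.2.choose

/-- The path of colour `d` from `i` to the last vertex of the maximal one. -/
noncomputable def toFinish (i : I) : Quiver.Path i (B.finish hQ d i) :=
  (exists_end hQ B d i).choose_spec.2.choose

theorem isStart_start (i : I) : B.IsStart d (B.start hQ d i) :=
  (exists_start hQ B d i).choose_spec.1

theorem isEnd_finish (i : I) : B.IsEnd d (B.finish hQ d i) :=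
  (exists_end hQ B d i).choose_spec.1

theorem mono_fromStart (i : I) : B.Monochrome d (B.fromStart hQ d i) :=
  (exists_start hQ B d i).choose_spec.2.choose_spec

theorem mono_toFinish (i : I) : B.Monochrome d (B.toFinish hQ d i) :=
  (exists_end hQ B d i).choose_spec.2.choose_spec

variable {B d}

theorem start_eq {s i : I} (hs : B.IsStart d s) {q : Quiver.Path s i} (hq : B.Monochrome d q) :
    B.start hQ d i = s :=
  Monochrome.start_unique (B.isStart_start hQ d i) hs (B.mono_fromStart hQ d i) hq

theorem start_self {s : I} (hs : B.IsStart d s) : B.start hQ d s = s :=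
  start_eq hQ hs (q := .nil) trivial

theorem start_eq_of_mono {i j : I} {q : Quiver.Path i j} (hq : B.Monochrome d q) :
    B.start hQ d j = B.start hQ d i :=
  start_eq hQ (B.isStart_start hQ d i) ((B.mono_fromStart hQ d i).comp hq)

theorem start_eq_of_arrow {i j : I} (h : i ⟶ j) (hc : B.col h = d) :
    B.start hQ d j = B.start hQ d i :=
  start_eq_of_mono hQ (mono_toPath hc)

theorem finish_eq {t i : I} (ht : B.IsEnd d t) {q : Quiver.Path i t} (hq : B.Monochrome d q) :
    B.finish hQ d i = t :=
  Monochrome.end_unique (B.isEnd_finish hQ d i) ht (B.mono_toFinish hQ d i) hq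

theorem finish_eq_of_mono {i j : I} {q : Quiver.Path i j} (hq : B.Monochrome d q) :
    B.finish hQ d i = B.finish hQ d j :=
  finish_eq hQ (B.isEnd_finish hQ d j) (hq.comp (B.mono_toFinish hQ d j))

theorem finish_self {t : I} (ht : B.IsEnd d t) : B.finish hQ d t = t :=
  finish_eq hQ ht (q := .nil) trivial

theorem finish_start (i : I) : B.finish hQ d (B.start hQ d i) = B.finish hQ d i :=
  finish_eq_of_mono hQ (B.mono_fromStart hQ d i)

/-- The first vertex of the next segment: the maximal path of colour `d` into which the arrow of the
other colour out of the first vertex `s` of a segment leads.  (If `s` is not the first vertex of a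
segment, the value is `s`.) -/
noncomputable def next (hQ : NoOrientedCycle I) (B : DirectionColouring I) (d : Bool) (s : I) : I :=
  open Classical in
  if hs : B.IsStart d s then B.start hQ d hs.exists_out.choose else s

theorem next_eq {s j : I} (h : s ⟶ j) (hc : B.col h = !d) :
    B.next hQ d s = B.start hQ d j := by
  have hs : B.IsStart d s := isStart_of_out h hc
  rw [next, dif_pos hs]
  have := B.out_unique h hs.exists_out.choose_spec.choose
    (hc.trans hs.exists_out.choose_spec.choose_spec.symm)
  obtain ⟨h1, -⟩ := Sigma.mk.inj_iff.1 this
  exact congrArg _ h1.symm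

theorem isStart_next {s : I} (hs : B.IsStart d s) : B.IsStart d (B.next hQ d s) := by
  rw [next, dif_pos hs]
  exact B.isStart_start hQ d _

/-- The arrow into the last vertex of the next segment determines the segment it comes from. -/
theorem next_injOn {s s' : I} (hs : B.IsStart d s) (hs' : B.IsStart d s')
    (h : B.next hQ d s = B.next hQ d s') : s = s' := by
  obtain ⟨j, g, hg⟩ := hs.exists_out
  obtain ⟨j', g', hg'⟩ := hs'.exists_out
  rw [next_eq hQ g hg, next_eq hQ g' hg'] at h
  have hj : j = j' := by
    rw [← finish_self hQ (isEnd_of_in g hg), ← finish_self hQ (isEnd_of_in g' hg'),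
      ← finish_start, h, finish_start]
  subst hj
  exact (Sigma.mk.inj_iff.1 (B.in_unique g g' (hg.trans hg'.symm))).1

theorem exists_next_eq {s : I} (hs : B.IsStart d s) :
    ∃ s', B.IsStart d s' ∧ B.next hQ d s' = s := by
  obtain ⟨a, g, hg⟩ := (B.isEnd_finish hQ d s).exists_in
  refine ⟨a, isStart_of_out g hg, ?_⟩
  rw [next_eq hQ g hg, start_eq_of_mono hQ (B.mono_toFinish hQ d s), start_self hQ hs]

end Segments
end DirectionColouring

/-! ### Representations at the level of linear maps -/

namespace QRep

variable {k : Type u} [Field k] {I : Type} [Quiver.{0} I]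

/-- The linear map of an arrow. -/
abbrev act (M : QRep k I) {i j : I} (h : i ⟶ j) : M.vec i →ₗ[k] M.vec j := (M.arrow h).hom

/-- The linear map of a path. -/
abbrev actPath (M : QRep k I) {i j : I} (q : Quiver.Path i j) : M.vec i →ₗ[k] M.vec j :=
  (M.path q).hom

/-- The linear map of a morphism at the vertex `i`. -/
abbrev homAt {M N : QRep k I} (φ : M ⟶ N) (i : I) : M.vec i →ₗ[k] N.vec i := (NatTrans.app φ i).hom

variable (M N : QRep k I)

theorem actPath_nil (i : I) (x : M.vec i) : M.actPath (Quiver.Path.nil (a := i)) x = x :=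
  congrArg (fun f => f.hom x) (M.map_id i)

theorem actPath_comp {i j l : I} (q : Quiver.Path i j) (q' : Quiver.Path j l) (x : M.vec i) :
    M.actPath (q.comp q') x = M.actPath q' (M.actPath q x) :=
  congrArg (fun f => f.hom x) (M.map_comp (X := i) (Y := j) (Z := l) q q')

theorem actPath_cons {i j l : I} (q : Quiver.Path i j) (h : j ⟶ l) (x : M.vec i) :
    M.actPath (q.cons h) x = M.act h (M.actPath q x) :=
  M.actPath_comp q h.toPath x

variable {M N}

theorem homAt_act (φ : M ⟶ N) {i j : I} (h : i ⟶ j) (x : M.vec i) :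
    homAt φ j (M.act h x) = N.act h (homAt φ i x) :=
  congrArg (fun f => f.hom x) (φ.naturality (X := i) (Y := j) h.toPath)

theorem homAt_actPath (φ : M ⟶ N) {i j : I} (q : Quiver.Path i j) (x : M.vec i) :
    homAt φ j (M.actPath q x) = N.actPath q (homAt φ i x) :=
  congrArg (fun f => f.hom x) (φ.naturality (X := i) (Y := j) q)

/-- A morphism from linear maps that commute with the arrows. -/
def mkHom (φ : ∀ i : I, M.vec i →ₗ[k] N.vec i)
    (hφ : ∀ {i j : I} (h : i ⟶ j) (x : M.vec i), φ j (M.act h x) = N.act h (φ i x)) : M ⟶ N :=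
  homOfArrows (fun i => ModuleCat.ofHom (φ i)) (fun h => ModuleCat.hom_ext (LinearMap.ext (hφ h)))

theorem hom_ext_at {φ ψ : M ⟶ N} (h : ∀ i x, homAt φ i x = homAt ψ i x) : φ = ψ :=
  NatTrans.ext (funext fun i => ModuleCat.hom_ext (LinearMap.ext (h i)))

@[simp] theorem homAt_comp {L : QRep k I} (φ : M ⟶ N) (ψ : N ⟶ L) (i : I) (x : M.vec i) :
    homAt (φ ≫ ψ) i x = homAt ψ i (homAt φ i x) := rfl

@[simp] theorem homAt_id (i : I) (x : M.vec i) : homAt (𝟙 M) i x = x := rfl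

@[simp] theorem homAt_zero (i : I) (x : M.vec i) : homAt (0 : M ⟶ N) i x = 0 := rfl

theorem isZero_iff : IsZero M ↔ ∀ i, Subsingleton (M.vec i) := by
  rw [Functor.isZero_iff]
  exact forall_congr' fun i => ModuleCat.isZero_iff_subsingleton

theorem not_isZero_iff : ¬ IsZero M ↔ ∃ i, Nontrivial (M.vec i) := by
  rw [isZero_iff]
  push Not
  rfl

theorem mono_iff (φ : M ⟶ N) : Mono φ ↔ ∀ i, Function.Injective (homAt φ i) := by
  rw [NatTrans.mono_iff_mono_app]
  exact forall_congr' fun i => ModuleCat.mono_iff_injective _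

theorem epi_iff (φ : M ⟶ N) : Epi φ ↔ ∀ i, Function.Surjective (homAt φ i) := by
  rw [NatTrans.epi_iff_epi_app]
  exact forall_congr' fun i => ModuleCat.epi_iff_surjective _

theorem isIso_iff (φ : M ⟶ N) : IsIso φ ↔ ∀ i, Function.Bijective (homAt φ i) := by
  rw [NatTrans.isIso_iff_isIso_app]
  exact forall_congr' fun i => ConcreteCategory.isIso_iff_bijective _

theorem isIso_path_iff {i j : I} (q : Quiver.Path i j) :
    IsIso (M.path q) ↔ Function.Bijective (M.actPath q) :=
  ConcreteCategory.isIso_iff_bijective _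

/-- The linear equivalence at a vertex given by an isomorphism. -/
def isoAt (e : M ≅ N) (i : I) : M.vec i ≃ₗ[k] N.vec i :=
  (e.app i).toLinearEquiv

theorem isoAt_act (e : M ≅ N) {i j : I} (h : i ⟶ j) (x : M.vec i) :
    isoAt e j (M.act h x) = N.act h (isoAt e i x) := homAt_act e.hom h x

theorem supp_eq_of_iso (e : M ≅ N) : M.supp = N.supp :=
  Set.ext fun i => (isoAt e i).toEquiv.nontrivial_congr

theorem IsFinDim.of_iso (e : M ≅ N) (hM : M.IsFinDim) : N.IsFinDim := fun i =>
  haveI := hM i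
  Module.Finite.equiv (isoAt e i)

/-- A short exact sequence of representations is exact at each vertex. -/
theorem exists_of_shortExact {E : ShortComplex (QRep k I)} (hE : E.ShortExact) (i : I)
    (x : E.X₂.vec i) (hx : homAt E.g i x = 0) : ∃ y, homAt E.f i y = x := by
  let j : Paths I := i
  let F := (evaluation (Paths I) (ModuleCat.{u} k)).obj j
  have : F.PreservesZeroMorphisms := ⟨fun _ _ => rfl⟩
  have : PreservesFiniteLimits F := inferInstance
  have : PreservesFiniteColimits F := inferInstance
  have := hE.exact.map F
  rw [ShortComplex.moduleCat_exact_iff] at this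
  exact this x hx

theorem injective_of_shortExact {E : ShortComplex (QRep k I)} (hE : E.ShortExact) (i : I) :
    Function.Injective (homAt E.f i) := (mono_iff _).1 hE.mono_f i

theorem surjective_of_shortExact {E : ShortComplex (QRep k I)} (hE : E.ShortExact) (i : I) :
    Function.Surjective (homAt E.g i) := (epi_iff _).1 hE.epi_g i

theorem comp_zero_of_shortComplex (E : ShortComplex (QRep k I)) (i : I) (x : E.X₁.vec i) :
    homAt E.g i (homAt E.f i x) = 0 := by
  rw [← homAt_comp, E.zero, homAt_zero]

/-- The short exact sequence of an epimorphism and its kernel. -/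
theorem shortExact_kernel (φ : M ⟶ N) [Epi φ] :
    (ShortComplex.mk (kernel.ι φ) φ (kernel.condition φ)).ShortExact where
  exact := ShortComplex.exact_of_f_is_kernel _ (kernelIsKernel φ)

theorem isSummand_iff : N.IsSummand M ↔ ∃ (i : N ⟶ M) (r : M ⟶ N), i ≫ r = 𝟙 N := by
  constructor
  · rintro ⟨N', ⟨e⟩⟩
    exact ⟨biprod.inl ≫ e.inv, e.hom ≫ biprod.fst, by simp⟩
  · rintro ⟨i, r, h⟩
    have : Mono i := mono_of_mono_fac h
    refine ⟨cokernel i, ⟨?_⟩⟩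
    have hex : (ShortComplex.mk i (cokernel.π i) (cokernel.condition i)).Exact :=
      ShortComplex.exact_of_g_is_cokernel _ (cokernelIsCokernel i)
    exact (ShortComplex.Splitting.ofExactOfRetraction _ hex r h
      (inferInstanceAs (Epi (cokernel.π i)))).isoBinaryBiproduct

theorem IsSummand.trans {L : QRep k I} (h : L.IsSummand N) (h' : N.IsSummand M) :
    L.IsSummand M := by
  rw [isSummand_iff] at *
  obtain ⟨i, r, h⟩ := h
  obtain ⟨i', r', h'⟩ := h'
  refine ⟨i ≫ i', r' ≫ r, ?_⟩
  rw [Category.assoc, reassoc_of% h', h]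

theorem IsSummand.of_iso (e : N ≅ M) : N.IsSummand M :=
  isSummand_iff.2 ⟨e.hom, e.inv, e.hom_inv_id⟩

/-- A nonzero summand of an indecomposable representation is all of it. -/
theorem iso_of_isSummand_of_indecomposable (hM : Indecomposable M) (h : N.IsSummand M)
    (hN : ¬ IsZero N) : Nonempty (M ≅ N) := by
  obtain ⟨N', ⟨e⟩⟩ := h
  have h0 : IsZero N' := (hM.2 N N' e).resolve_left hN
  exact ⟨e ≪≫ (isoBiprodZero h0).symm⟩

theorem isFinDim_of_injective (hN : N.IsFinDim) (φ : M ⟶ N)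
    (hφ : ∀ i, Function.Injective (homAt φ i)) : M.IsFinDim := fun i =>
  haveI := hN i
  Module.Finite.of_injective _ (hφ i)

theorem IsSummand.isFinDim (h : N.IsSummand M) (hM : M.IsFinDim) : N.IsFinDim := by
  obtain ⟨i, r, h⟩ := isSummand_iff.1 h
  have : Mono i := mono_of_mono_fac h
  exact isFinDim_of_injective hM i ((mono_iff _).1 this)

/-- An injective morphism between representations with equal finite dimensions is invertible. -/
theorem isIso_of_injective (hN : N.IsFinDim) (φ : M ⟶ N)
    (hφ : ∀ i, Function.Injective (homAt φ i))
    (hd : ∀ i, Module.finrank k (N.vec i) ≤ Module.finrank k (M.vec i)) : IsIso φ := by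
  refine (isIso_iff φ).2 fun i => ⟨hφ i, ?_⟩
  have := hN i
  have := isFinDim_of_injective hN φ hφ i
  refine (LinearMap.injective_iff_surjective_of_finrank_eq_finrank ?_).1 (hφ i)
  exact le_antisymm (LinearMap.finrank_le_finrank_of_injective (hφ i)) (hd i)

/-- The short exact sequence of a direct sum. -/
theorem shortExact_of_iso_biprod {L : QRep k I} (e : M ≅ N ⊞ L) :
    (ShortComplex.mk (biprod.inl ≫ e.inv) (e.hom ≫ biprod.snd) (by simp)).ShortExact :=
  ShortComplex.Splitting.shortExact
    { r := e.hom ≫ biprod.fst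
      s := biprod.inr ≫ e.inv
      f_r := by simp
      s_g := by simp
      id := by
        simp only [Category.assoc]
        have := congrArg (fun f => e.hom ≫ f ≫ e.inv) (biprod.total (X := N) (Y := L))
        simpa only [Preadditive.comp_add, Preadditive.add_comp, Category.assoc, Category.id_comp,
          e.hom_inv_id] using this }

section Dim

variable [Fintype I]

/-- The total dimension. -/
noncomputable def dim (M : QRep k I) : ℕ := ∑ i, Module.finrank k (M.vec i)

theorem dim_pos (hM : M.IsFinDim) (h : ¬ IsZero M) : 0 < M.dim := by
  obtain ⟨i, hi⟩ := not_isZero_iff.1 h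
  have := hM i
  exact Finset.sum_pos' (fun _ _ => Nat.zero_le _) ⟨i, Finset.mem_univ _, Module.finrank_pos⟩

theorem dim_shortExact {E : ShortComplex (QRep k I)} (hE : E.ShortExact) (h : E.X₂.IsFinDim) :
    E.X₂.dim = E.X₁.dim + E.X₃.dim := by
  rw [dim, dim, dim, ← Finset.sum_add_distrib]
  refine Finset.sum_congr rfl fun i _ => ?_
  have := h i
  have hr : LinearMap.range (homAt E.f i) = LinearMap.ker (homAt E.g i) := by
    ext x
    constructor
    · rintro ⟨y, rfl⟩
      exact comp_zero_of_shortComplex E i y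
    · exact fun hx => exists_of_shortExact hE i x hx
  rw [← LinearMap.finrank_range_add_finrank_ker (homAt E.g i), ← hr,
    LinearMap.finrank_range_of_inj (injective_of_shortExact hE i),
    LinearMap.range_eq_top.2 (surjective_of_shortExact hE i), finrank_top, add_comm]

end Dim

end QRep

open QRep

/-! ### The Auslander–Reiten translates on morphisms -/

section Translates

variable {k : Type u} [Field k] {I : Type} [Quiver.{0} I] [Fintype I] [∀ i j : I, Fintype (i ⟶ j)]

/-- `τ` on morphisms. -/
def arTranslateHom {M N : QRep k I} (f : M ⟶ N) : arTranslate M ⟶ arTranslate N :=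
  mkHom (fun j =>
    { toFun := fun φ => ⟨fun a b h q => homAt f a (φ.1 a b h q), fun i w => by
        have := congrArg (homAt f i) (φ.2 i w)
        simp only [map_sum] at this
        rw [this]
        exact Finset.sum_congr rfl fun a _ => Finset.sum_congr rfl fun h _ => homAt_act f h _⟩
      map_add' := fun φ ψ => Subtype.ext (by
        funext a b h q
        exact map_add (homAt f a) _ _)
      map_smul' := fun c φ => Subtype.ext (by
        funext a b h q
        exact map_smul (homAt f a) _ _) }) (fun _ _ => rfl)

theorem arTranslate_ext {M : QRep k I} {j : I} {φ ψ : (arTranslate M).vec j}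
    (H : ∀ (a b : I) (h : a ⟶ b) (q : Quiver.Path j b),
      (φ : arTranslateSpace M j).1 a b h q = (ψ : arTranslateSpace M j).1 a b h q) : φ = ψ :=
  Subtype.ext (by funext a b h q; exact H a b h q)

/-- `τ` on isomorphisms. -/
def arTranslateIso {M N : QRep k I} (e : M ≅ N) : arTranslate M ≅ arTranslate N where
  hom := arTranslateHom e.hom
  inv := arTranslateHom e.inv
  hom_inv_id := hom_ext_at fun j φ => arTranslate_ext fun a b h q => by
    have := congrArg (fun f => homAt f a ((φ : arTranslateSpace M j).1 a b h q)) e.hom_inv_id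
    exact this
  inv_hom_id := hom_ext_at fun j φ => arTranslate_ext fun a b h q => by
    have := congrArg (fun f => homAt f a ((φ : arTranslateSpace N j).1 a b h q)) e.inv_hom_id
    exact this

theorem arTranslate_iterate_iso {M N : QRep k I} (e : M ≅ N) (m : ℕ) :
    Nonempty (arTranslate^[m] M ≅ arTranslate^[m] N) := by
  induction m with
  | zero => exact ⟨e⟩
  | succ m ih =>
    rw [Function.iterate_succ_apply', Function.iterate_succ_apply']
    exact ⟨arTranslateIso ih.some⟩

/-- `τ` preserves monomorphisms. -/
theorem arTranslate_iterate_injective {M N : QRep k I} (f : M ⟶ N)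
    (hf : ∀ i, Function.Injective (homAt f i)) (m : ℕ) :
    ∃ g : arTranslate^[m] M ⟶ arTranslate^[m] N, ∀ i, Function.Injective (homAt g i) := by
  induction m with
  | zero => exact ⟨f, hf⟩
  | succ m ih =>
    obtain ⟨g, hg⟩ := ih
    rw [Function.iterate_succ_apply', Function.iterate_succ_apply']
    refine ⟨arTranslateHom g, fun j φ ψ h => arTranslate_ext fun a b l q => hg a ?_⟩
    exact congrFun (congrFun (congrFun (congrFun (congrArg Subtype.val h) a) b) l) q

/-- A morphism to `τ M` from a family of maps `N_b → M_a`, one for each arrow `h : a → b`. -/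
def homToArTranslate {N M : QRep k I} (f : ∀ {a b : I}, (a ⟶ b) → (N.vec b →ₗ[k] M.vec a))
    (hf : ∀ (i : I) (x : N.vec i), ∑ b : I, ∑ h : i ⟶ b, f h (N.act h x) =
      ∑ a : I, ∑ h : a ⟶ i, M.act h (f h x)) : N ⟶ arTranslate M :=
  mkHom (fun j =>
    { toFun := fun x => ⟨fun a b h q => f h (N.actPath q x), fun i w => by
        simp only [actPath_cons]
        exact hf i _⟩
      map_add' := fun x y => Subtype.ext (by
        funext a b h q
        exact map_add (f h ∘ₗ N.actPath q) x y)
      map_smul' := fun c x => Subtype.ext (by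
        funext a b h q
        exact map_smul (f h ∘ₗ N.actPath q) c x) }) (fun g x => arTranslate_ext fun a b h q =>
          congrArg (f h) (N.actPath_comp g.toPath q x).symm)

/-- The component of a vector of `(τ M)_j` at an arrow into `j` and the trivial path. -/
def arTranslateEval (M : QRep k I) {a j : I} (h : a ⟶ j) : (arTranslate M).vec j →ₗ[k] M.vec a where
  toFun φ := (φ : arTranslateSpace M j).1 a j h .nil
  map_add' _ _ := rfl
  map_smul' _ _ := rfl

theorem arTranslateInv_mk_act {M : QRep k I} {i j : I} (h : i ⟶ j) (z : ArSum M i) :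
    (arTranslateInv M).act h (Submodule.Quotient.mk z : ArSum M i ⧸ arRelSpace M i) =
      (Submodule.Quotient.mk (arSumMap M h.toPath z) : ArSum M j ⧸ arRelSpace M j) := rfl

/-- One half of the adjunction between `τ⁻` and `τ`. It shows that a power of `τ⁻` does not kill a
representation with a nonzero morphism to the same power of `τ` of another one. -/
theorem exists_hom_of_hom_arTranslate {X Y : QRep k I} (f : X ⟶ arTranslate Y) (hf : f ≠ 0) :
    ∃ g : arTranslateInv X ⟶ Y, g ≠ 0 := by
  classical
  let G : ∀ j : I, ArSum X j →ₗ[k] Y.vec j := fun j =>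
    DirectSum.toModule k (ArIndex I j) (Y.vec j)
      (fun t => Y.actPath t.2.2.2 ∘ₗ arTranslateEval Y t.2.2.1 ∘ₗ homAt f t.2.1)
  have hG : ∀ {a b j : I} (h : a ⟶ b) (q : Quiver.Path a j) (v : X.vec b),
      G j (arIncl X h q v) = Y.actPath q (arTranslateEval Y h (homAt f b v)) := by
    intro a b j h q v
    rw [arIncl]
    convert DirectSum.toModule_lof (R := k) (ι := ArIndex I j) (M := fun t => X.vec t.2.1)
      (φ := fun t => Y.actPath t.2.2.2 ∘ₗ arTranslateEval Y t.2.2.1 ∘ₗ homAt f t.2.1) ⟨a, b, h, q⟩ v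
    rfl
  have hker : ∀ j, arRelSpace X j ≤ LinearMap.ker (G j) := by
    intro j
    refine Submodule.span_le.2 ?_
    rintro _ ⟨i, q, v, rfl⟩
    rw [SetLike.mem_coe, LinearMap.mem_ker, arRel, map_sub, sub_eq_zero]
    simp only [map_sum, hG]
    have h1 := congrArg (Y.actPath q) ((homAt f i v : arTranslateSpace Y i).2 i .nil)
    simp only [map_sum] at h1
    refine Eq.trans ?_ (h1.trans ?_)
    · refine Finset.sum_congr rfl fun b _ => Finset.sum_congr rfl fun h _ => congrArg _ ?_
      have := homAt_act f h v
      rw [this]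
      rfl
    · refine Finset.sum_congr rfl fun b _ => Finset.sum_congr rfl fun h _ => ?_
      exact (Y.actPath_comp h.toPath q _).symm
  let g : arTranslateInv X ⟶ Y := mkHom (M := arTranslateInv X)
      (fun j => (arRelSpace X j).liftQ (G j) (hker j)) (by
    intro i j h x
    obtain ⟨z, rfl⟩ := Submodule.Quotient.mk_surjective _ x
    rw [arTranslateInv_mk_act]
    have : (G j) ∘ₗ arSumMap X h.toPath = Y.act h ∘ₗ G i := by
      refine arSum_ext X fun a b l q v => ?_
      rw [LinearMap.comp_apply, arSumMap_incl, LinearMap.comp_apply, hG, hG, actPath_comp]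
    exact LinearMap.congr_fun this z)
  refine ⟨g, fun h0 => hf (hom_ext_at fun j x => arTranslate_ext fun a b h q => ?_)⟩
  have h1 : homAt g a (Submodule.Quotient.mk (arIncl X h .nil (X.actPath q x)) :
      ArSum X a ⧸ arRelSpace X a) = 0 := by rw [h0]; rfl
  have h2 : G a (arIncl X h .nil (X.actPath q x)) = 0 := h1
  rw [hG, actPath_nil, homAt_actPath] at h2
  exact h2

theorem arTranslateInv_iterate_not_isZero {X Y : QRep k I} (m : ℕ)
    (f : X ⟶ arTranslate^[m] Y) (hf : f ≠ 0) : ¬ IsZero (arTranslateInv^[m] X) := by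
  induction m generalizing X with
  | zero => exact fun h => hf (h.eq_of_src _ _)
  | succ m ih =>
    revert f
    rw [Function.iterate_succ_apply', Function.iterate_succ_apply]
    intro f hf
    obtain ⟨g, hg⟩ := exists_hom_of_hom_arTranslate f hf
    exact ih g hg

/-- `τ⁻ M = 0` if each arrow `a → b` either has `M_b = 0`, or is onto and the only arrow out
of `a` that does not lead to a zero space. -/
theorem isZero_arTranslateInv (hQ : NoOrientedCycle I) {M : QRep k I}
    (H : ∀ {a b : I} (h : a ⟶ b), Subsingleton (M.vec b) ∨ (Function.Surjective (M.act h) ∧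
      ∀ {b' : I} (h' : a ⟶ b'), (⟨b', h'⟩ : Σ b, (a ⟶ b)) ≠ ⟨b, h⟩ → Subsingleton (M.vec b'))) :
    IsZero (arTranslateInv M) := by
  have key : ∀ (b a : I) (h : a ⟶ b) (j : I) (q : Quiver.Path a j) (v : M.vec b),
      arIncl M h q v ∈ arRelSpace M j := by
    intro b
    induction b using hQ.wf.induction with
    | _ b ih =>
    intro a h j q v
    rcases H h with h0 | ⟨hs, hother⟩
    · rw [Subsingleton.elim v 0, map_zero]
      exact zero_mem _
    · obtain ⟨u, rfl⟩ := hs v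
      have h1 : arRel M q u ∈ arRelSpace M j := Submodule.subset_span ⟨a, q, u, rfl⟩
      have h2 : ∑ b : I, ∑ h : a ⟶ b, arIncl M h q ((M.arrow h).hom u) =
          arIncl M h q (M.act h u) := by
        rw [← Fintype.sum_sigma' (fun b (h : a ⟶ b) => arIncl M h q ((M.arrow h).hom u))]
        refine Fintype.sum_eq_single (⟨b, h⟩ : Σ b, (a ⟶ b)) fun x hx => ?_
        have := hother x.2 hx
        rw [Subsingleton.elim ((M.arrow x.2).hom u) 0, map_zero]
      rw [arRel, h2] at h1
      have h3 : ∑ a' : I, ∑ h' : a' ⟶ a, arIncl M h' (h'.toPath.comp q) u ∈ arRelSpace M j :=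
        Submodule.sum_mem _ fun a' _ => Submodule.sum_mem _ fun h' _ =>
          ih a (Precedes.of_arrow h) a' h' j _ u
      exact (Submodule.sub_mem_iff_left _ h3).1 h1
  refine isZero_iff.2 fun j => ?_
  have : (arRelSpace M j).mkQ = 0 := arSum_ext M fun a b h q v =>
    (Submodule.Quotient.mk_eq_zero _).2 (key b a h j q v)
  have h0 : ∀ x : (ArSum M j ⧸ arRelSpace M j), x = 0 := by
    intro x
    obtain ⟨z, rfl⟩ := Submodule.Quotient.mk_surjective _ x
    exact LinearMap.congr_fun this z
  exact ⟨fun x y => (h0 x).trans (h0 y).symm⟩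

end Translates

/-! ### The translate of a representation with injective maps in one direction -/

section Sums

variable {k : Type u} [Field k] {I : Type} [Quiver.{0} I] [Fintype I] [∀ i j : I, Fintype (i ⟶ j)]
  {W : Type u} [AddCommGroup W]

theorem sum_out_eq_single {i j : I} (h : i ⟶ j) (f : ∀ b : I, (i ⟶ b) → W)
    (hf : ∀ (b : I) (g : i ⟶ b), (⟨b, g⟩ : Σ b, (i ⟶ b)) ≠ ⟨j, h⟩ → f b g = 0) :
    ∑ b : I, ∑ g : i ⟶ b, f b g = f j h := by
  rw [← Fintype.sum_sigma' f]
  exact Fintype.sum_eq_single (⟨j, h⟩ : Σ b, (i ⟶ b)) fun x hx => hf x.1 x.2 hx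

theorem sum_in_eq_single {a i : I} (h : a ⟶ i) (f : ∀ b : I, (b ⟶ i) → W)
    (hf : ∀ (b : I) (g : b ⟶ i), (⟨b, g⟩ : Σ b, (b ⟶ i)) ≠ ⟨a, h⟩ → f b g = 0) :
    ∑ b : I, ∑ g : b ⟶ i, f b g = f a h := by
  rw [← Fintype.sum_sigma' f]
  exact Fintype.sum_eq_single (⟨a, h⟩ : Σ b, (b ⟶ i)) fun x hx => hf x.1 x.2 hx

end Sums

/-- Case distinction on the first arrow of a path. -/
theorem path_head_cases {I : Type} [Quiver.{0} I] {j : I} {P : ∀ b : I, Quiver.Path j b → Prop}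
    (h0 : P j .nil)
    (h1 : ∀ (l : I) (g : j ⟶ l) (b : I) (q : Quiver.Path l b), P b (g.toPath.comp q))
    (b : I) (q : Quiver.Path j b) : P b q := by
  suffices H : (∃ e : j = b, q = e ▸ Quiver.Path.nil) ∨
      ∃ (l : I) (g : j ⟶ l) (q' : Quiver.Path l b), q = g.toPath.comp q' by
    rcases H with ⟨rfl, rfl⟩ | ⟨l, g, q', rfl⟩
    · exact h0
    · exact h1 l g b q'
  induction q with
  | nil => exact Or.inl ⟨rfl, rfl⟩
  | cons q g ih =>
    rcases ih with ⟨rfl, rfl⟩ | ⟨l, g', q', rfl⟩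
    · exact Or.inr ⟨_, g, .nil, rfl⟩
    · exact Or.inr ⟨l, g', q'.cons g, rfl⟩

section TauInjective

variable {k : Type u} [Field k] {I : Type} [Quiver.{0} I] [Fintype I] [∀ i j : I, Fintype (i ⟶ j)]
  {B : DirectionColouring I} {d : Bool}

theorem bool_eq_not_of_ne {c d : Bool} (h : c ≠ d) : c = !d := by
  cases c <;> cases d <;> simp_all

/-- All arrows of colour `d` act injectively. -/
def InjectiveOn (B : DirectionColouring I) (d : Bool) (M : QRep k I) : Prop :=
  ∀ ⦃i j : I⦄ (h : i ⟶ j), B.col h = d → Function.Injective (M.act h)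

omit [Fintype I] [∀ i j : I, Fintype (i ⟶ j)] in
theorem InjectiveOn.of_forall {M : QRep k I}
    (hM : ∀ {i j : I} (h : i ⟶ j), Function.Injective (M.act h)) (d : Bool) : InjectiveOn B d M :=
  fun _ _ h _ => hM h

/-- If the maps of colour `d` are injective, a vector `φ` of `(τ M)_j` that vanishes at a path
`w β` and its last arrow `β`, of the other colour, vanishes at that path and any arrow. -/
theorem arTranslate_last_eq_zero {M : QRep k I} (hM : InjectiveOn B d M) {j : I}
    (φ : arTranslateSpace M j) {i b : I} (w : Quiver.Path j i) (β : i ⟶ b) (hβ : B.col β = !d)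
    (h0 : φ.1 i b β (w.cons β) = 0) {a : I} (h : a ⟶ b) : φ.1 a b h (w.cons β) = 0 := by
  by_cases hc : B.col h = !d
  · obtain ⟨rfl, hh⟩ := Sigma.mk.inj_iff.1 (B.in_unique h β (hc.trans hβ.symm))
    rw [eq_of_heq hh, h0]
  · have hc' : B.col h = d := by
      rw [bool_eq_not_of_ne hc, Bool.not_not]
    have rel := φ.2 b (w.cons β)
    -- the vertex `b` is a sink: an arrow out would have the colour of both `h` and `β`
    rw [Finset.sum_eq_zero fun l _ => Finset.sum_eq_zero fun g _ => absurd
      (((B.col_eq h g).trans (B.col_eq β g).symm).trans hβ) hc,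
      sum_in_eq_single h] at rel
    · exact hM h hc' (rel.symm.trans (map_zero _).symm)
    · intro a' g hg
      by_cases hgc : B.col g = d
      · exact absurd (B.in_unique g h (hgc.trans hc'.symm)) hg
      · have hgc' : B.col g = B.col β := (bool_eq_not_of_ne hgc).trans hβ.symm
        obtain ⟨rfl, hh⟩ := Sigma.mk.inj_iff.1 (B.in_unique g β hgc')
        rw [eq_of_heq hh, h0, map_zero]

/-- If the maps of colour `d` are injective, a vector `φ` of `(τ M)_j` that vanishes at the first
step along an arrow `α` of the other colour vanishes along all paths that begin with `α`. -/
theorem arTranslate_eq_zero_of_first {M : QRep k I} (hM : InjectiveOn B d M) {j l : I}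
    (φ : arTranslateSpace M j) (α : j ⟶ l) (hα : B.col α = !d) (h0 : φ.1 j l α α.toPath = 0)
    {b : I} (q : Quiver.Path l b) {a : I} (h : a ⟶ b) : φ.1 a b h (α.toPath.comp q) = 0 := by
  suffices H : (∃ (m : I) (γ : m ⟶ b), B.col γ = !d) ∧
      ∀ (a : I) (h : a ⟶ b), φ.1 a b h (α.toPath.comp q) = 0 from H.2 a h
  clear h a
  induction q with
  | nil => exact ⟨⟨j, α, hα⟩, fun _ => arTranslate_last_eq_zero hM φ .nil α hα h0⟩
  | @cons m b q β ih =>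
    obtain ⟨⟨m', γ, hγ⟩, ih⟩ := ih
    have hβ : B.col β = !d := (B.col_eq γ β).symm.trans hγ
    refine ⟨⟨m, β, hβ⟩, fun _ => arTranslate_last_eq_zero hM φ _ β hβ ?_⟩
    have rel := φ.2 m (α.toPath.comp q)
    rw [sum_out_eq_single β] at rel
    · rw [rel]
      refine Finset.sum_eq_zero fun a _ => Finset.sum_eq_zero fun h _ => ?_
      rw [ih, map_zero]
    · intro b' g hg
      exact absurd (B.out_unique g β ((B.col_eq γ g).symm.trans (B.col_eq γ β))) hg

theorem eq_zero_of_components {M : QRep k I} {j : I} (φ : (arTranslate M).vec j)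
    (h0 : ∀ (a : I) (h : a ⟶ j), (φ : arTranslateSpace M j).1 a j h .nil = 0)
    (h1 : ∀ (l : I) (g : j ⟶ l) (b : I) (q : Quiver.Path l b) (a : I) (h : a ⟶ b),
      (φ : arTranslateSpace M j).1 a b h (g.toPath.comp q) = 0) : φ = 0 :=
  arTranslate_ext fun a b h q => path_head_cases
    (P := fun b q => ∀ (a : I) (h : a ⟶ b), (φ : arTranslateSpace M j).1 a b h q = 0) h0
    (fun l g b q => h1 l g b q) b q a h

/-- If the maps of colour `d` of `M` are injective, so are those of `τ M`. -/
theorem InjectiveOn.arTranslate {M : QRep k I} (hM : InjectiveOn B d M) :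
    InjectiveOn B d (arTranslate M) := by
  intro j j' α hα
  refine (injective_iff_map_eq_zero _).2 fun φ hφ => ?_
  have hα0 : ∀ (b : I) (q : Quiver.Path j' b) (a : I) (h : a ⟶ b),
      (φ : arTranslateSpace M j).1 a b h (α.toPath.comp q) = 0 := fun b q a h =>
    congrFun (congrFun (congrFun (congrFun (congrArg Subtype.val hφ) a) b) h) q
  have rel := (φ : arTranslateSpace M j).2 j .nil
  rcases B.out_or_in (!d) j with ⟨l, c, hc⟩ | ⟨a, β, hβ⟩
  · have hin : ∀ (a : I) (h : a ⟶ j), False := fun a h => by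
      have := (B.col_eq h c).symm.trans (B.col_eq h α)
      rw [hc, hα] at this
      cases d <;> simp at this
    have hout : ∀ (b : I) (g : j ⟶ b), (⟨b, g⟩ : Σ b, (j ⟶ b)) = ⟨l, c⟩ ∨
        (⟨b, g⟩ : Σ b, (j ⟶ b)) = ⟨j', α⟩ := fun b g => by
      by_cases hg : B.col g = d
      · exact Or.inr (B.out_unique g α (hg.trans hα.symm))
      · exact Or.inl (B.out_unique g c ((bool_eq_not_of_ne hg).trans hc.symm))
    rw [Finset.sum_eq_zero (f := fun a => ∑ h : a ⟶ j, _) (fun a _ => Finset.sum_eq_zero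
      fun h _ => (hin a h).elim), sum_out_eq_single c] at rel
    · refine eq_zero_of_components φ (fun a h => (hin a h).elim) fun b g e q a h => ?_
      rcases hout b g with hg | hg
      · obtain ⟨rfl, hg⟩ := Sigma.mk.inj_iff.1 hg
        obtain rfl := eq_of_heq hg
        exact arTranslate_eq_zero_of_first hM φ g hc rel q h
      · obtain ⟨rfl, hg⟩ := Sigma.mk.inj_iff.1 hg
        obtain rfl := eq_of_heq hg
        exact hα0 e q a h
    · intro b g hne
      obtain ⟨rfl, hg⟩ := Sigma.mk.inj_iff.1 ((hout b g).resolve_left hne)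
      obtain rfl := eq_of_heq hg
      exact hα0 b .nil j g
  · rw [Bool.not_not] at hβ
    have hout : ∀ (b : I) (g : j ⟶ b), (⟨b, g⟩ : Σ b, (j ⟶ b)) = ⟨j', α⟩ := fun b g =>
      B.out_unique g α ((B.col_eq β g).symm.trans (B.col_eq β α))
    have hin : ∀ (b : I) (g : b ⟶ j), (⟨b, g⟩ : Σ b, (b ⟶ j)) = ⟨a, β⟩ := fun b g =>
      B.in_unique g β ((B.col_eq g α).trans (B.col_eq β α).symm)
    rw [sum_out_eq_single α _ fun b g hg => absurd (hout b g) hg,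
      sum_in_eq_single β _ fun b g hg => absurd (hin b g) hg] at rel
    have h0 : (φ : arTranslateSpace M j).1 a j β .nil = 0 :=
      hM β hβ ((rel.symm.trans (hα0 j' .nil j α)).trans (map_zero _).symm)
    refine eq_zero_of_components φ (fun b g => ?_) fun b g e q a' h => ?_
    · obtain ⟨rfl, hg⟩ := Sigma.mk.inj_iff.1 (hin b g)
      obtain rfl := eq_of_heq hg
      exact h0
    · obtain ⟨rfl, hg⟩ := Sigma.mk.inj_iff.1 (hout b g)
      obtain rfl := eq_of_heq hg
      exact hα0 e q a' h

/-- If the maps of colour `d` of `M` are injective and `h : a → j` has the other colour, `(τ M)_j`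
embeds into `M_a`. -/
theorem InjectiveOn.arTranslateEval_injective {M : QRep k I} (hM : InjectiveOn B d M) {a j : I}
    (h : a ⟶ j) (hh : B.col h = !d) : Function.Injective (arTranslateEval M h) := by
  refine (injective_iff_map_eq_zero _).2 fun φ hφ => ?_
  replace hφ : (φ : arTranslateSpace M j).1 a j h .nil = 0 := hφ
  have hd : (!d) ≠ d := by cases d <;> simp
  have hout' : ∀ (b : I) (g : j ⟶ b), B.col g = !d := fun b g => (B.col_eq h g).symm.trans hh
  have rel := (φ : arTranslateSpace M j).2 j .nil
  rcases B.out_or_in (!d) j with ⟨l, c, hc⟩ | ⟨x, β, hβ⟩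
  · have hout : ∀ (b : I) (g : j ⟶ b), (⟨b, g⟩ : Σ b, (j ⟶ b)) = ⟨l, c⟩ := fun b g =>
      B.out_unique g c ((hout' b g).trans hc.symm)
    have hin : ∀ (b : I) (g : b ⟶ j), (⟨b, g⟩ : Σ b, (b ⟶ j)) = ⟨a, h⟩ := fun b g =>
      B.in_unique g h ((B.col_eq g c).trans (B.col_eq h c).symm)
    rw [sum_out_eq_single c _ fun b g hg => absurd (hout b g) hg,
      sum_in_eq_single h _ fun b g hg => absurd (hin b g) hg, hφ, map_zero] at rel
    refine eq_zero_of_components φ (fun b g => ?_) fun b g e q a' h => ?_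
    · obtain ⟨rfl, hg⟩ := Sigma.mk.inj_iff.1 (hin b g)
      obtain rfl := eq_of_heq hg
      exact hφ
    · obtain ⟨rfl, hg⟩ := Sigma.mk.inj_iff.1 (hout b g)
      obtain rfl := eq_of_heq hg
      exact arTranslate_eq_zero_of_first hM φ g hc rel q h
  · rw [Bool.not_not] at hβ
    have hout : ∀ (b : I) (g : j ⟶ b), False := fun b g =>
      hd ((hout' b g).symm.trans ((B.col_eq β g).symm.trans hβ))
    have hin : ∀ (b : I) (g : b ⟶ j), (⟨b, g⟩ : Σ b, (b ⟶ j)) = ⟨a, h⟩ ∨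
        (⟨b, g⟩ : Σ b, (b ⟶ j)) = ⟨x, β⟩ := fun b g => by
      by_cases hg : B.col g = d
      · exact Or.inr (B.in_unique g β (hg.trans hβ.symm))
      · exact Or.inl (B.in_unique g h ((bool_eq_not_of_ne hg).trans hh.symm))
    rw [Finset.sum_eq_zero (f := fun a => ∑ h : j ⟶ a, _) (fun b _ => Finset.sum_eq_zero
      fun g _ => (hout b g).elim), sum_in_eq_single β] at rel
    · have h0 : (φ : arTranslateSpace M j).1 x j β .nil = 0 :=
        hM β hβ (rel.symm.trans (map_zero _).symm)
      refine eq_zero_of_components φ (fun b g => ?_) fun b g e q a' h => (hout b g).elim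
      rcases hin b g with hg | hg <;>
      · obtain ⟨rfl, hg⟩ := Sigma.mk.inj_iff.1 hg
        obtain rfl := eq_of_heq hg
        assumption
    · intro b g hg
      obtain ⟨rfl, hg⟩ := Sigma.mk.inj_iff.1 ((hin b g).resolve_right hg)
      obtain rfl := eq_of_heq hg
      rw [hφ, map_zero]

end TauInjective

/-! ### Periodic representations with injective maps -/

section Periodic

variable {k : Type u} [Field k] {I : Type} [Quiver.{0} I] [Fintype I] [∀ i j : I, Fintype (i ⟶ j)]
  (B : DirectionColouring I)

include B in
theorem arTranslate_injective_of_forall {M : QRep k I}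
    (hM : ∀ {i j : I} (h : i ⟶ j), Function.Injective (M.act h)) {i j : I} (h : i ⟶ j) :
    Function.Injective ((arTranslate M).act h) :=
  (InjectiveOn.of_forall hM (B.col h)).arTranslate h rfl

include B in
theorem arTranslateEval_injective_of_forall {M : QRep k I}
    (hM : ∀ {i j : I} (h : i ⟶ j), Function.Injective (M.act h)) {i j : I} (h : i ⟶ j) :
    Function.Injective (arTranslateEval M h) :=
  (InjectiveOn.of_forall hM (!B.col h)).arTranslateEval_injective h (Bool.not_not _).symm

include B in
/-- `τ` preserves finite dimension here because `(τ M)_j` embeds into a space of `M`. -/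
theorem isFinDim_arTranslate {M : QRep k I} (hfin : M.IsFinDim)
    (hM : ∀ {i j : I} (h : i ⟶ j), Function.Injective (M.act h)) : (arTranslate M).IsFinDim := by
  intro j
  rcases B.out_or_in true j with ⟨l, c, -⟩ | ⟨a, β, -⟩
  · have := hfin j
    exact Module.Finite.of_injective (arTranslateEval M c ∘ₗ (arTranslate M).act c)
      ((arTranslateEval_injective_of_forall B hM c).comp
        (arTranslate_injective_of_forall B hM c))
  · have := hfin a
    exact Module.Finite.of_injective _ (arTranslateEval_injective_of_forall B hM β)

include B in
/-- If all maps of `M` are injective, the dimensions of `τ M` are at most those of `M`. -/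
theorem finrank_arTranslate_le {M : QRep k I} (hfin : M.IsFinDim)
    (hM : ∀ {i j : I} (h : i ⟶ j), Function.Injective (M.act h)) (j : I) :
    Module.finrank k ((arTranslate M).vec j) ≤ Module.finrank k (M.vec j) := by
  have := hfin j
  rcases B.out_or_in true j with ⟨l, c, -⟩ | ⟨a, β, -⟩
  · exact LinearMap.finrank_le_finrank_of_injective
      (f := arTranslateEval M c ∘ₗ (arTranslate M).act c)
      ((arTranslateEval_injective_of_forall B hM c).comp
        (arTranslate_injective_of_forall B hM c))
  · exact LinearMap.finrank_le_finrank_of_injective (f := M.act β ∘ₗ arTranslateEval M β)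
      ((hM β).comp (arTranslateEval_injective_of_forall B hM β))

/-- The sign of an arrow: `1` for the colour `true`, `-1` for the colour `false`. -/
def DirectionColouring.sign (k : Type u) [Field k] {i j : I} (h : i ⟶ j) : k :=
  if B.col h then 1 else -1

/-- The relation in `τ M` needs this sign rule: at a source or a sink the two arrows have opposite
colours, and at any other vertex the arrow in and the arrow out have the same one. -/
theorem sum_sign_eq (i : I) :
    ∑ b : I, ∑ h : i ⟶ b, B.sign k h = ∑ a : I, ∑ h : a ⟶ i, B.sign k h := by
  have hout : ∀ {b b' : I} (g : i ⟶ b) (h : i ⟶ b'), (⟨b, g⟩ : Σ b, (i ⟶ b)) ≠ ⟨b', h⟩ →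
      B.col g = !B.col h := fun g h hne => bool_eq_not_of_ne fun hc => hne (B.out_unique g h hc)
  have hin : ∀ {b b' : I} (g : b ⟶ i) (h : b' ⟶ i), (⟨b, g⟩ : Σ b, (b ⟶ i)) ≠ ⟨b', h⟩ →
      B.col g = !B.col h := fun g h hne => bool_eq_not_of_ne fun hc => hne (B.in_unique g h hc)
  rcases B.out_or_in true i with ⟨b, h, hc⟩ | ⟨b, h, hc⟩ <;>
    rcases B.out_or_in false i with ⟨b', h', hc'⟩ | ⟨b', h', hc'⟩
  · -- a source of the quiver
    rw [Finset.sum_eq_zero (f := fun a => ∑ h : a ⟶ i, _) fun a _ => Finset.sum_eq_zero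
      fun g _ => by have := (B.col_eq g h).symm.trans (B.col_eq g h'); simp_all,
      ← Fintype.sum_sigma' fun b (h : i ⟶ b) => B.sign k h,
      Fintype.sum_eq_add (⟨b, h⟩ : Σ b, (i ⟶ b)) ⟨b', h'⟩]
    · simp [DirectionColouring.sign, hc, hc']
    · intro H
      obtain ⟨rfl, H⟩ := Sigma.mk.inj_iff.1 H
      rw [eq_of_heq H, hc'] at hc
      simp at hc
    · intro x hx
      have h1 := hout x.2 h hx.1
      have h2 := hout x.2 h' hx.2
      simp_all
  · rw [sum_out_eq_single h, sum_in_eq_single h']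
    · simp [DirectionColouring.sign, hc, hc']
    · intro a g hg
      have h1 := hin g h' hg
      have h2 := B.col_eq g h
      simp_all
    · intro a g hg
      have h1 := hout g h hg
      have h2 := B.col_eq h' g
      simp_all
  · rw [sum_out_eq_single h', sum_in_eq_single h]
    · simp [DirectionColouring.sign, hc, hc']
    · intro a g hg
      have h1 := hin g h hg
      have h2 := B.col_eq g h'
      simp_all
    · intro a g hg
      have h1 := hout g h' hg
      have h2 := B.col_eq h g
      simp_all
  · -- a sink of the quiver
    rw [Finset.sum_eq_zero (f := fun a => ∑ h : i ⟶ a, _) fun a _ => Finset.sum_eq_zero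
      fun g _ => by have := (B.col_eq h g).trans (B.col_eq h' g).symm; simp_all,
      ← Fintype.sum_sigma' fun b (h : b ⟶ i) => B.sign k h,
      Fintype.sum_eq_add (⟨b, h⟩ : Σ b, (b ⟶ i)) ⟨b', h'⟩]
    · simp [DirectionColouring.sign, hc, hc']
    · intro H
      obtain ⟨rfl, H⟩ := Sigma.mk.inj_iff.1 H
      rw [eq_of_heq H, hc'] at hc
      simp at hc
    · intro x hx
      have h1 := hin x.2 h hx.1
      have h2 := hin x.2 h' hx.2
      simp_all

include B in
/-- A representation all of whose maps are invertible is isomorphic to its translate. -/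
theorem nonempty_iso_arTranslate_of_bijective {M : QRep k I} (hfin : M.IsFinDim)
    (hM : ∀ {i j : I} (h : i ⟶ j), Function.Bijective (M.act h)) :
    Nonempty (arTranslate M ≅ M) := by
  -- the inverse maps with signs define a morphism from `M` to `τ M`
  let f : ∀ {a b : I}, (a ⟶ b) → (M.vec b →ₗ[k] M.vec a) := fun h =>
    B.sign k h • (LinearEquiv.ofBijective (M.act h) (hM h)).symm.toLinearMap
  have hf1 : ∀ {a b : I} (h : a ⟶ b) (x : M.vec a), f h (M.act h x) = B.sign k h • x :=
    fun h x => congrArg (B.sign k h • ·)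
      ((LinearEquiv.ofBijective (M.act h) (hM h)).symm_apply_apply x)
  have hf2 : ∀ {a b : I} (h : a ⟶ b) (x : M.vec b), M.act h (f h x) = B.sign k h • x :=
    fun h x => (map_smul (M.act h) _ _).trans (congrArg (B.sign k h • ·)
      ((LinearEquiv.ofBijective (M.act h) (hM h)).apply_symm_apply x))
  have hf : ∀ (i : I) (x : M.vec i), ∑ b : I, ∑ h : i ⟶ b, f h (M.act h x) =
      ∑ a : I, ∑ h : a ⟶ i, M.act h (f h x) := fun i x => by
    simp only [hf1, hf2, ← Finset.sum_smul, sum_sign_eq]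
  have hsign : ∀ {a b : I} (h : a ⟶ b), B.sign k h ≠ 0 := fun h => by
    unfold DirectionColouring.sign
    split_ifs <;> simp
  have hinj : ∀ {a b : I} (h : a ⟶ b) (x : M.vec b), f h x = 0 → x = 0 := fun h x hx => by
    have := (hf2 h x).symm
    rw [hx, map_zero] at this
    exact (smul_eq_zero.1 this).resolve_left (hsign h)
  let φ := homToArTranslate f hf
  have hφ : ∀ i, Function.Injective (homAt φ i) := by
    intro j
    refine (injective_iff_map_eq_zero _).2 fun x hx => ?_
    have hx' : ∀ (a b : I) (h : a ⟶ b) (q : Quiver.Path j b), f h (M.actPath q x) = 0 :=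
      fun a b h q => congrFun (congrFun (congrFun (congrFun (congrArg Subtype.val hx) a) b) h) q
    rcases B.out_or_in true j with ⟨l, c, -⟩ | ⟨a, β, -⟩
    · exact (hM c).1 ((hinj c _ (hx' _ _ c c.toPath)).trans (map_zero _).symm)
    · have := hx' _ _ β .nil
      rw [actPath_nil] at this
      exact hinj β _ this
  have := isIso_of_injective (isFinDim_arTranslate B hfin fun h => (hM h).1) φ hφ
    (finrank_arTranslate_le B hfin fun h => (hM h).1)
  exact ⟨(asIso φ).symm⟩

include B in
/-- If all maps of `M` are injective and `M` is periodic under `τ`, the maps are bijective and the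
period is `1`: the dimensions cannot grow along the orbit, so they are constant. -/
theorem nonempty_iso_arTranslate_of_injective {M : QRep k I} (hfin : M.IsFinDim)
    (hM : ∀ {i j : I} (h : i ⟶ j), Function.Injective (M.act h)) {m : ℕ} (hm : 0 < m)
    (e : arTranslate^[m] M ≅ M) : Nonempty (arTranslate M ≅ M) := by
  have key : ∀ m : ℕ, (arTranslate^[m] M).IsFinDim ∧
      (∀ {i j : I} (h : i ⟶ j), Function.Injective ((arTranslate^[m] M).act h)) ∧
      (0 < m → ∀ j, Module.finrank k ((arTranslate^[m] M).vec j) ≤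
        Module.finrank k ((arTranslate M).vec j)) := by
    intro m
    induction m with
    | zero => exact ⟨hfin, hM, fun h => absurd h (lt_irrefl _)⟩
    | succ m ih =>
      rw [Function.iterate_succ_apply']
      refine ⟨isFinDim_arTranslate B ih.1 ih.2.1, arTranslate_injective_of_forall B ih.2.1,
        fun _ j => ?_⟩
      rcases Nat.eq_zero_or_pos m with rfl | hm
      · exact le_rfl
      · exact (finrank_arTranslate_le B ih.1 ih.2.1 j).trans (ih.2.2 hm j)
  have hdim : ∀ j, Module.finrank k (M.vec j) ≤ Module.finrank k ((arTranslate M).vec j) := fun j =>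
    ((isoAt e j).finrank_eq.symm.le).trans ((key m).2.2 hm j)
  refine nonempty_iso_arTranslate_of_bijective B hfin fun {i j} h => ⟨hM h, ?_⟩
  have := hfin i
  have := hfin j
  refine (LinearMap.injective_iff_surjective_of_finrank_eq_finrank ?_).1 (hM h)
  refine le_antisymm (LinearMap.finrank_le_finrank_of_injective (hM h)) ((hdim j).trans ?_)
  exact LinearMap.finrank_le_finrank_of_injective (arTranslateEval_injective_of_forall B hM h)

end Periodic

/-! ### Thin representations -/

section Thin

variable (k : Type u) [Field k] {I : Type} [Quiver.{0} I] (B : DirectionColouring I) (d : Bool)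

/-- The line `k` if `i ∈ U`, and zero otherwise. -/
def thinSpace (U : Set I) (i : I) : Submodule k k where
  carrier := {x | i ∉ U → x = 0}
  add_mem' hx hy h := by rw [hx h, hy h, add_zero]
  zero_mem' _ := rfl
  smul_mem' c x hx h := by rw [hx h, smul_zero]

open Classical in
/-- The map of an arrow in `thin`. -/
noncomputable def thinMap (U : Set I) {i j : I} (h : i ⟶ j) :
    thinSpace k U i →ₗ[k] thinSpace k U j where
  toFun x := ⟨if B.col h = d ∧ j ∈ U then x.1 else 0, fun hj => if_neg fun H => hj H.2⟩
  map_add' x y := Subtype.ext (by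
    change (if _ then x.1 + y.1 else 0) = (if _ then x.1 else 0) + (if _ then y.1 else 0)
    split_ifs <;> simp)
  map_smul' c x := Subtype.ext (by
    change (if _ then c • x.1 else 0) = c • (if _ then x.1 else 0)
    split_ifs <;> simp)

/-- The representation with the line `k` at the vertices of `U`, on which the arrows of colour `d`
between vertices of `U` act as the identity and the other arrows as zero. -/
noncomputable def thin (U : Set I) : QRep k I :=
  Paths.lift
    { obj := fun i => ModuleCat.of k (thinSpace k U i)
      map := fun h => ModuleCat.ofHom (thinMap k B d U h) }

variable {k B d} {U : Set I}

theorem thin_act (U : Set I) {i j : I} (h : i ⟶ j) : (thin k B d U).act h = thinMap k B d U h :=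
  congrArg ModuleCat.Hom.hom (Category.id_comp (ModuleCat.ofHom (thinMap k B d U h)))

/-- A vector of `thin` as a scalar. -/
def thinVal (U : Set I) (i : I) : (thin k B d U).vec i →ₗ[k] k := (thinSpace k U i).subtype

theorem thinVal_injective (i : I) : Function.Injective (thinVal (k := k) (B := B) (d := d) U i) :=
  Subtype.val_injective

theorem thinVal_eq_zero {i : I} (hi : i ∉ U) (x : (thin k B d U).vec i) : thinVal U i x = 0 :=
  x.2 hi

/-- The basis vector at a vertex of `U`. -/
def thinOne {i : I} (hi : i ∈ U) : (thin k B d U).vec i := ⟨(1 : k), fun h => absurd hi h⟩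

theorem thinVal_one {i : I} (hi : i ∈ U) :
    thinVal U i (thinOne (k := k) (B := B) (d := d) hi) = 1 := rfl

theorem thinVal_act {i j : I} (h : i ⟶ j) (hc : B.col h = d) (hj : j ∈ U)
    (x : (thin k B d U).vec i) : thinVal U j ((thin k B d U).act h x) = thinVal U i x := by
  rw [thin_act]
  exact if_pos ⟨hc, hj⟩

theorem thin_act_eq_zero {i j : I} (h : i ⟶ j) (hc : B.col h ≠ d)
    (x : (thin k B d U).vec i) : (thin k B d U).act h x = 0 := by
  rw [thin_act]
  exact Subtype.ext (if_neg fun H => hc H.1)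

theorem thin_isFinDim (U : Set I) : (thin k B d U).IsFinDim := fun i =>
  Module.Finite.of_injective (thinVal U i) (thinVal_injective i)

theorem thin_supp (U : Set I) : (thin k B d U).supp = U := by
  ext i
  constructor
  · rintro ⟨x, y, hxy⟩
    by_contra hi
    exact hxy (thinVal_injective i ((thinVal_eq_zero hi x).trans (thinVal_eq_zero hi y).symm))
  · intro hi
    refine ⟨thinOne hi, 0, fun h => ?_⟩
    have := congrArg (thinVal U i) h
    rw [thinVal_one, map_zero] at this
    exact one_ne_zero this

theorem finrank_thin_le (U : Set I) (i : I) : Module.finrank k ((thin k B d U).vec i) ≤ 1 :=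
  (LinearMap.finrank_le_finrank_of_injective (thinVal_injective i)).trans
    (Module.finrank_self k).le

/-- A morphism from `thin` given by the images of the basis vectors. -/
noncomputable def homFromThin {M : QRep k I} (w : ∀ i, M.vec i) (h0 : ∀ i, i ∉ U → w i = 0)
    (h1 : ∀ {i j : I} (h : i ⟶ j), B.col h = d → M.act h (w i) = w j)
    (h2 : ∀ {i j : I} (h : i ⟶ j), B.col h ≠ d → M.act h (w i) = 0) : thin k B d U ⟶ M :=
  mkHom (fun i => (LinearMap.toSpanSingleton k _ (w i)).comp (thinVal U i)) (by
    intro i j h x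
    change thinVal U j ((thin k B d U).act h x) • w j = M.act h (thinVal U i x • w i)
    rw [map_smul]
    by_cases hc : B.col h = d
    · rw [h1 h hc]
      by_cases hj : j ∈ U
      · rw [thinVal_act h hc hj]
      · rw [h0 j hj, smul_zero, smul_zero]
    · rw [thin_act_eq_zero h hc, map_zero, zero_smul, h2 h hc, smul_zero])

theorem homFromThin_apply {M : QRep k I} (w : ∀ i, M.vec i) (h0 : ∀ i, i ∉ U → w i = 0) (h1 h2)
    (i : I) (x : (thin k B d U).vec i) :
    homAt (homFromThin (B := B) (d := d) w h0 h1 h2) i x = thinVal U i x • w i := rfl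

theorem homFromThin_injective {M : QRep k I} (w : ∀ i, M.vec i) (h0 : ∀ i, i ∉ U → w i = 0) (h1 h2)
    (hw : ∀ i ∈ U, w i ≠ 0) (i : I) :
    Function.Injective (homAt (homFromThin (B := B) (d := d) w h0 h1 h2) i) := by
  refine (injective_iff_map_eq_zero _).2 fun x hx => ?_
  rw [homFromThin_apply] at hx
  refine thinVal_injective i ?_
  rw [map_zero]
  by_cases hi : i ∈ U
  · exact (smul_eq_zero.1 hx).resolve_right (hw i hi)
  · exact thinVal_eq_zero hi x

/-- A morphism to `thin` given by linear functionals. -/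
noncomputable def homToThin {M : QRep k I} (l : ∀ i, M.vec i →ₗ[k] k) (h0 : ∀ i, i ∉ U → l i = 0)
    (h1 : ∀ {i j : I} (h : i ⟶ j), B.col h = d → j ∈ U → ∀ x, l j (M.act h x) = l i x)
    (h2 : ∀ {i j : I} (h : i ⟶ j), B.col h ≠ d → ∀ x, l j (M.act h x) = 0) : M ⟶ thin k B d U :=
  mkHom (N := thin k B d U)
    (fun i => (l i).codRestrict (thinSpace k U i) fun x hi => by rw [h0 i hi]; rfl) (by
    intro i j h x
    refine thinVal_injective j ?_
    by_cases hc : B.col h = d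
    · by_cases hj : j ∈ U
      · rw [thinVal_act h hc hj]
        exact h1 h hc hj x
      · rw [thinVal_eq_zero hj, thinVal_eq_zero hj]
    · rw [thin_act_eq_zero h hc, map_zero]
      exact h2 h hc x)

theorem thinVal_homToThin {M : QRep k I} (l : ∀ i, M.vec i →ₗ[k] k) (h0 : ∀ i, i ∉ U → l i = 0)
    (h1 h2) (i : I) (x : M.vec i) :
    thinVal U i (homAt (homToThin (B := B) (d := d) l h0 h1 h2) i x) = l i x := rfl

end Thin

/-! ### The thin representations of the segments -/

section SegmentReps

variable {k : Type u} [Field k] {I : Type} [Quiver.{0} I] [Finite I]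
  (hQ : NoOrientedCycle I) (B : DirectionColouring I) (d : Bool)

/-- The vertices of the maximal path of colour `d` that begins at `s`. -/
def segment (s : I) : Set I := {j | B.start hQ d j = s}

/-- The thin representation on a segment. -/
noncomputable abbrev segmentRep (k : Type u) [Field k] (s : I) : QRep k I :=
  thin k B d (segment hQ B d s)

variable {B d} {hQ}

theorem self_mem_segment {s : I} (hs : B.IsStart d s) : s ∈ segment hQ B d s :=
  DirectionColouring.start_self hQ hs

theorem mem_segment_of_mono {s i j : I} {q : Quiver.Path i j} (hq : B.Monochrome d q) :
    j ∈ segment hQ B d s ↔ i ∈ segment hQ B d s := by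
  change _ = _ ↔ _ = _
  rw [DirectionColouring.start_eq_of_mono hQ hq]

theorem mem_segment_of_arrow {s i j : I} (h : i ⟶ j) (hc : B.col h = d) :
    j ∈ segment hQ B d s ↔ i ∈ segment hQ B d s :=
  mem_segment_of_mono (DirectionColouring.mono_toPath hc)

theorem exists_mono_of_mem_segment {s j : I} (hj : j ∈ segment hQ B d s) :
    ∃ q : Quiver.Path s j, B.Monochrome d q := by
  obtain rfl : B.start hQ d j = s := hj
  exact ⟨_, B.mono_fromStart hQ d j⟩

/-- A vertex on the segment of a last vertex `t` is joined to `t`. -/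
theorem exists_mono_to_end {j t : I} (ht : B.IsEnd d t)
    (h : B.start hQ d j = B.start hQ d t) : ∃ q : Quiver.Path j t, B.Monochrome d q := by
  obtain rfl : B.finish hQ d j = t := by
    rw [← DirectionColouring.finish_start, h, DirectionColouring.finish_start,
      DirectionColouring.finish_self hQ ht]
  exact ⟨_, B.mono_toFinish hQ d j⟩

omit [Finite I] in
theorem InjectiveOn.actPath {M : QRep k I} (hM : InjectiveOn B d M) {i j : I}
    {q : Quiver.Path i j} (hq : B.Monochrome d q) : Function.Injective (M.actPath q) := by
  induction q with
  | nil =>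
    intro x y h
    rwa [actPath_nil, actPath_nil] at h
  | cons q h ih =>
    intro x y hxy
    rw [actPath_cons, actPath_cons] at hxy
    exact ih hq.1 (hM h hq.2 hxy)

theorem thinVal_segment_act (s : I) {i j : I} (h : i ⟶ j) (hc : B.col h = d)
    (x : (segmentRep hQ B d k s).vec i) :
    thinVal _ j ((segmentRep hQ B d k s).act h x) = thinVal _ i x := by
  by_cases hj : j ∈ segment hQ B d s
  · exact thinVal_act h hc hj x
  · rw [thinVal_eq_zero hj, thinVal_eq_zero fun hi => hj ((mem_segment_of_arrow h hc).2 hi)]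

theorem thinVal_segment_actPath (s : I) {i j : I} (q : Quiver.Path i j) (hq : B.Monochrome d q)
    (x : (segmentRep hQ B d k s).vec i) :
    thinVal _ j ((segmentRep hQ B d k s).actPath q x) = thinVal _ i x := by
  induction q with
  | nil => rw [actPath_nil]
  | cons q h ih => rw [actPath_cons, thinVal_segment_act s h hq.2, ih hq.1]

theorem injectiveOn_segmentRep (s : I) : InjectiveOn B d (segmentRep hQ B d k s) := by
  intro i j h hc x y hxy
  refine thinVal_injective i ?_
  rw [← thinVal_segment_act s h hc x, hxy, thinVal_segment_act s h hc y]

theorem segmentRep_not_isZero {s : I} (hs : B.IsStart d s) :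
    ¬ IsZero (segmentRep hQ B d k s) :=
  not_isZero_iff.2 ⟨s, by
    change s ∈ (segmentRep hQ B d k s).supp
    rw [thin_supp]
    exact self_mem_segment hs⟩

theorem segmentRep_indecomposable {s : I} (hs : B.IsStart d s) :
    Indecomposable (segmentRep hQ B d k s) := by
  refine ⟨segmentRep_not_isZero hs, fun Y Z e => ?_⟩
  by_contra hcon
  push Not at hcon
  obtain ⟨hY, hZ⟩ := hcon
  -- nonzero vectors of both summands move to the end of the segment, where there is only a line
  have key : ∀ (X : QRep k I) (f : X ⟶ segmentRep hQ B d k s), Mono f → ¬ IsZero X →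
      ∃ x : X.vec (B.finish hQ d s), thinVal _ _ (homAt f _ x) ≠ 0 := by
    intro X f hf hX
    obtain ⟨i, hi⟩ := not_isZero_iff.1 hX
    obtain ⟨x, hx⟩ := exists_ne (0 : X.vec i)
    have hne : thinVal (segment hQ B d s) i (homAt f i x) ≠ 0 := fun h =>
      hx ((mono_iff f).1 hf i (thinVal_injective i (by rw [h, map_zero, map_zero])))
    have hi' : i ∈ segment hQ B d s := by
      by_contra hi'
      exact hne (thinVal_eq_zero hi' _)
    obtain ⟨q, hq⟩ := exists_mono_to_end (j := i) (B.isEnd_finish hQ d s) (by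
      rw [DirectionColouring.start_eq_of_mono hQ (B.mono_toFinish hQ d s),
        DirectionColouring.start_self hQ hs]
      exact hi')
    refine ⟨X.actPath q x, ?_⟩
    rw [homAt_actPath, thinVal_segment_actPath s q hq]
    exact hne
  generalize B.finish hQ d s = t at key
  obtain ⟨y, hy⟩ := key Y (biprod.inl ≫ e.inv) inferInstance hY
  obtain ⟨z, hz⟩ := key Z (biprod.inr ≫ e.inv) inferInstance hZ
  have h1 : (thinVal _ t (homAt (biprod.inr ≫ e.inv) t z)) • homAt (biprod.inl ≫ e.inv) t y =
      (thinVal _ t (homAt (biprod.inl ≫ e.inv) t y)) • homAt (biprod.inr ≫ e.inv) t z :=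
    thinVal_injective t (by rw [map_smul, map_smul, smul_eq_mul, smul_eq_mul, mul_comm])
  have h2 := congrArg (homAt (e.hom ≫ biprod.fst) t) h1
  rw [map_smul, map_smul, ← homAt_comp, ← homAt_comp] at h2
  simp only [Category.assoc, e.inv_hom_id_assoc, biprod.inl_fst, biprod.inr_fst] at h2
  rw [homAt_id, homAt_zero, smul_zero] at h2
  have h3 := (smul_eq_zero.1 h2).resolve_left hz
  rw [h3, map_zero, map_zero] at hy
  exact hy rfl

theorem isStart_iterate_next {s : I} (hs : B.IsStart d s) (m : ℕ) :
    B.IsStart d ((B.next hQ d)^[m] s) := by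
  induction m with
  | zero => exact hs
  | succ m ih =>
    rw [Function.iterate_succ_apply']
    exact DirectionColouring.isStart_next hQ ih

theorem exists_iterate_next_eq {s : I} (hs : B.IsStart d s) (m : ℕ) :
    ∃ s', B.IsStart d s' ∧ (B.next hQ d)^[m] s' = s := by
  induction m with
  | zero => exact ⟨s, hs, rfl⟩
  | succ m ih =>
    obtain ⟨s', hs', rfl⟩ := ih
    obtain ⟨s'', hs'', rfl⟩ := DirectionColouring.exists_next_eq hQ hs'
    exact ⟨s'', hs'', rfl⟩

end SegmentReps

section SegmentTranslates

variable {k : Type u} [Field k] {I : Type} [Quiver.{0} I] [Fintype I] [∀ i j : I, Fintype (i ⟶ j)]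
  {hQ : NoOrientedCycle I} {B : DirectionColouring I} {d : Bool}

/-- `τ` takes the thin representation of a segment to that of the next segment. -/
theorem arTranslate_segmentRep {s : I} (hs : B.IsStart d s) :
    Nonempty (arTranslate (segmentRep hQ B d k s) ≅ segmentRep hQ B d k (B.next hQ d s)) := by
  classical
  obtain ⟨t, g, hg⟩ := hs.exists_out
  have ht : B.IsEnd d t := DirectionColouring.isEnd_of_in g hg
  have hd : d ≠ !d := by cases d <;> simp
  rw [DirectionColouring.next_eq hQ g hg]
  set s' := B.start hQ d t with hs'
  have hstart : ∀ {a b : I} (h : a ⟶ b), B.col h = !d → a ∈ segment hQ B d s → a = s :=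
    fun h hc ha => (DirectionColouring.start_self hQ
      (DirectionColouring.isStart_of_out h hc)).symm.trans ha
  -- the arrow from `s` to the next segment contributes the identity of `k`
  let f : ∀ {a b : I}, (a ⟶ b) →
      ((segmentRep hQ B d k s').vec b →ₗ[k] (segmentRep hQ B d k s).vec a) := fun {a b} h =>
    if H : B.col h = !d ∧ a ∈ segment hQ B d s then
      (LinearMap.toSpanSingleton k _ (thinOne H.2)).comp (thinVal _ b) else 0
  have hf0 : ∀ {a b : I} (h : a ⟶ b), B.col h = d → f h = 0 := fun h hc =>
    dif_neg fun H => hd (hc.symm.trans H.1)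
  have hfin : ∀ (i : I) (x : (segmentRep hQ B d k s').vec i),
      ∑ b : I, ∑ h : i ⟶ b, f h ((segmentRep hQ B d k s').act h x) =
        ∑ a : I, ∑ h : a ⟶ i, (segmentRep hQ B d k s).act h (f h x) := by
    intro i x
    rw [Finset.sum_eq_zero fun b _ => Finset.sum_eq_zero fun h _ => ?_,
      Finset.sum_eq_zero fun b _ => Finset.sum_eq_zero fun h _ => ?_]
    · by_cases hc : B.col h = d
      · rw [hf0 h hc, LinearMap.zero_apply, map_zero]
      · exact thin_act_eq_zero h hc _
    · by_cases hc : B.col h = d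
      · rw [hf0 h hc, LinearMap.zero_apply]
      · rw [thin_act_eq_zero h hc, map_zero]
  -- an arrow of the other colour leads into the last vertex of each segment
  have hend : ∀ j, ∃ (a t' : I) (h : a ⟶ t') (q : Quiver.Path j t'), B.col h = !d ∧
      B.Monochrome d q ∧ B.start hQ d j = B.start hQ d t' := fun j => by
    obtain ⟨a, h, hc⟩ := (B.isEnd_finish hQ d j).exists_in
    exact ⟨a, _, h, _, hc, B.mono_toFinish hQ d j,
      (DirectionColouring.start_eq_of_mono hQ (B.mono_toFinish hQ d j)).symm⟩
  have hM := injectiveOn_segmentRep (k := k) (hQ := hQ) (B := B) (d := d) s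
  -- upper bound for the dimensions
  have hemb : ∀ {j a t' : I} (h : a ⟶ t') (q : Quiver.Path j t'), B.col h = !d → B.Monochrome d q →
      Function.Injective (arTranslateEval (segmentRep hQ B d k s) h ∘ₗ
        (arTranslate (segmentRep hQ B d k s)).actPath q) := fun h q hc hq =>
    (hM.arTranslateEval_injective h hc).comp (hM.arTranslate.actPath hq)
  have hfd : (arTranslate (segmentRep hQ B d k s)).IsFinDim := fun j => by
    obtain ⟨a, t', h, q, hc, hq, -⟩ := hend j
    have := thin_isFinDim (k := k) (B := B) (d := d) (segment hQ B d s) a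
    exact Module.Finite.of_injective _ (hemb h q hc hq)
  have hle : ∀ j, Module.finrank k ((arTranslate (segmentRep hQ B d k s)).vec j) ≤
      Module.finrank k ((segmentRep hQ B d k s').vec j) := fun j => by
    obtain ⟨a, t', h, q, hc, hq, hjt⟩ := hend j
    have := thin_isFinDim (k := k) (B := B) (d := d) (segment hQ B d s) a
    refine (LinearMap.finrank_le_finrank_of_injective (hemb h q hc hq)).trans ?_
    by_cases ha : a ∈ segment hQ B d s
    · obtain rfl := hstart h hc ha
      obtain ⟨rfl, -⟩ := Sigma.mk.inj_iff.1 (B.out_unique h g (hc.trans hg.symm))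
      refine (finrank_thin_le _ a).trans ?_
      have : Nontrivial ((segmentRep hQ B d k s').vec j) := by
        change j ∈ (segmentRep hQ B d k s').supp
        rw [thin_supp]
        exact hjt
      have := thin_isFinDim (k := k) (B := B) (d := d) (segment hQ B d s') j
      exact Module.finrank_pos
    · have : Subsingleton ((segmentRep hQ B d k s).vec a) := by
        rw [← not_nontrivial_iff_subsingleton]
        change a ∉ (segmentRep hQ B d k s).supp
        rwa [thin_supp]
      rw [Module.finrank_zero_of_subsingleton]
      exact Nat.zero_le _
  let φ := homToArTranslate f hfin
  have hφ : ∀ j, Function.Injective (homAt φ j) := by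
    intro j
    refine (injective_iff_map_eq_zero _).2 fun x hx => ?_
    by_cases hj : j ∈ segment hQ B d s'
    · obtain ⟨q, hq⟩ := exists_mono_to_end (j := j) ht hj
      have h1 : f g ((segmentRep hQ B d k s').actPath q x) = 0 :=
        congrFun (congrFun (congrFun (congrFun (congrArg Subtype.val hx) s) t) g) q
      have h2 := congrArg (thinVal _ s) h1
      simp only [f] at h2
      rw [dif_pos ⟨hg, self_mem_segment hs⟩, LinearMap.comp_apply,
        LinearMap.toSpanSingleton_apply, map_smul, thinVal_one, smul_eq_mul, mul_one, map_zero,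
        thinVal_segment_actPath s' q hq] at h2
      exact thinVal_injective j (h2.trans (map_zero _).symm)
    · exact thinVal_injective j ((thinVal_eq_zero hj x).trans (map_zero _).symm)
  have := isIso_of_injective hfd φ hφ hle
  exact ⟨(asIso φ).symm⟩

theorem arTranslate_iterate_segmentRep {s : I} (hs : B.IsStart d s) (m : ℕ) :
    Nonempty (arTranslate^[m] (segmentRep hQ B d k s) ≅
      segmentRep hQ B d k ((B.next hQ d)^[m] s)) := by
  induction m with
  | zero => exact ⟨Iso.refl _⟩
  | succ m ih =>
    rw [Function.iterate_succ_apply', Function.iterate_succ_apply']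
    obtain ⟨e⟩ := ih
    obtain ⟨e'⟩ := arTranslate_segmentRep (k := k) (isStart_iterate_next (hQ := hQ) hs m)
    exact ⟨arTranslateIso e ≪≫ e'⟩

/-- An indecomposable representation is regular if some `segmentRep` embeds into it and it has a
nonzero morphism to another one. -/
theorem isRegularIndecomposable_of_segmentRep {M : QRep k I} (hfin : M.IsFinDim)
    (hM : Indecomposable M) {s s' : I} (hs : B.IsStart d s) (hs' : B.IsStart d s')
    (f : segmentRep hQ B d k s ⟶ M) (hf : ∀ i, Function.Injective (homAt f i))
    (g : M ⟶ segmentRep hQ B d k s') (hg : g ≠ 0) : IsRegularIndecomposable M := by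
  refine ⟨hfin, hM, fun m => ⟨fun h0 => ?_, ?_⟩⟩
  · obtain ⟨φ, hφ⟩ := arTranslate_iterate_injective f hf m
    obtain ⟨e⟩ := arTranslate_iterate_segmentRep (k := k) (hQ := hQ) hs m
    have : Mono φ := (mono_iff φ).2 hφ
    exact segmentRep_not_isZero (isStart_iterate_next hs m)
      ((IsZero.of_mono φ h0).of_iso e.symm)
  · obtain ⟨r, hr, rfl⟩ := exists_iterate_next_eq (hQ := hQ) hs' m
    obtain ⟨e⟩ := arTranslate_iterate_segmentRep (k := k) (hQ := hQ) hr m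
    refine arTranslateInv_iterate_not_isZero m (g ≫ e.inv) fun h => hg ?_
    rw [← cancel_mono e.inv, h, zero_comp]

theorem isRegularRep_segmentRep {s : I} (hs : B.IsStart d s) :
    IsRegularRep (segmentRep hQ B d k s) := by
  refine ⟨thin_isFinDim _, fun N hN hsum => ?_⟩
  obtain ⟨e⟩ := iso_of_isSummand_of_indecomposable (segmentRep_indecomposable hs) hsum hN.1
  refine isRegularIndecomposable_of_segmentRep (hsum.isFinDim (thin_isFinDim _)) hN hs hs e.hom
    ((mono_iff _).1 inferInstance) e.inv fun h => hN.1 ?_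
  rw [IsZero.iff_id_eq_zero, ← e.inv_hom_id, h, zero_comp]

end SegmentTranslates

/-! ### Vectors and functionals that spread along a segment -/

namespace DirectionColouring

variable {I : Type} [Quiver.{0} I] {B : DirectionColouring I} {d : Bool}

theorem Monochrome.eq_or_exists_first {i x : I} {q : Quiver.Path i x} (hq : B.Monochrome d q) :
    i = x ∨ ∃ (j : I) (h : i ⟶ j) (q' : Quiver.Path j x), B.col h = d ∧ B.Monochrome d q' := by
  induction q with
  | nil => exact Or.inl rfl
  | cons q g ih =>
    rcases ih hq.1 with rfl | ⟨j, h, q', hc, hq'⟩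
    · exact Or.inr ⟨_, g, .nil, hq.2, trivial⟩
    · exact Or.inr ⟨j, h, q'.cons g, hc, hq', hq.2⟩

theorem Monochrome.path_unique_of_acyclic [Finite I] (hQ : NoOrientedCycle I) {i x : I}
    {q q' : Quiver.Path i x} (hq : B.Monochrome d q) (hq' : B.Monochrome d q') : q = q' :=
  Quiver.Path.comp_injective_right (B.fromStart hQ d i)
    (Monochrome.path_unique (B.isStart_start hQ d i) ((B.mono_fromStart hQ d i).comp hq)
      ((B.mono_fromStart hQ d i).comp hq'))

end DirectionColouring

open DirectionColouring

section Spread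

variable {k : Type u} [Field k] {I : Type} [Quiver.{0} I] [Finite I]
  (hQ : NoOrientedCycle I) {B : DirectionColouring I} {d : Bool}

omit [Finite I] in
/-- A vector killed by the arrow out of the segment that begins at `s` spreads along the segment. -/
theorem exists_spread_vector (M : QRep k I) {s t : I} (h : s ⟶ t) (hc : B.col h = !d)
    (v : M.vec s) (hv : M.act h v = 0) :
    ∃ w : ∀ i, M.vec i, (∀ {i : I} (q : Quiver.Path s i), B.Monochrome d q → w i = M.actPath q v) ∧
      (∀ i : I, (¬ ∃ q : Quiver.Path s i, B.Monochrome d q) → w i = 0) ∧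
      (∀ {i j : I} (g : i ⟶ j), B.col g = d → M.act g (w i) = w j) ∧
      ∀ {i j : I} (g : i ⟶ j), B.col g ≠ d → M.act g (w i) = 0 := by
  classical
  have hs : B.IsStart d s := isStart_of_out h hc
  let w : ∀ i, M.vec i := fun i =>
    if H : ∃ q : Quiver.Path s i, B.Monochrome d q then M.actPath H.choose v else 0
  have hw : ∀ {i : I} (q : Quiver.Path s i), B.Monochrome d q → w i = M.actPath q v := by
    intro i q hq
    have H : ∃ q, B.Monochrome d q := ⟨q, hq⟩
    have : H.choose = q := H.choose_spec.path_unique hs hq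
    simp only [w, dif_pos H, this]
  have hw0 : ∀ i : I, (¬ ∃ q : Quiver.Path s i, B.Monochrome d q) → w i = 0 := fun i H => dif_neg H
  refine ⟨w, hw, hw0, fun {i j} g hg => ?_, fun {i j} g hg => ?_⟩
  · by_cases H : ∃ q : Quiver.Path s i, B.Monochrome d q
    · obtain ⟨q, hq⟩ := H
      rw [hw q hq, hw (q.cons g) ⟨hq, hg⟩, actPath_cons]
    · rw [hw0 i H, map_zero, hw0 j]
      rintro ⟨q, hq⟩
      obtain ⟨q', hq', -⟩ := hq.eq_cons hs g hg
      exact H ⟨q', hq'⟩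
  · by_cases H : ∃ q : Quiver.Path s i, B.Monochrome d q
    · obtain ⟨q, hq⟩ := H
      have hi := isStart_of_out g (bool_eq_not_of_ne hg)
      obtain rfl := Monochrome.start_unique (q := q) (q' := .nil) hs hi hq trivial
      have := B.out_unique g h ((bool_eq_not_of_ne hg).trans hc.symm)
      obtain ⟨rfl, hgh⟩ := Sigma.mk.inj_iff.1 this
      rw [hw .nil trivial, actPath_nil, eq_of_heq hgh, hv]
    · rw [hw0 i H, map_zero]

include hQ in
/-- A functional at `e` that vanishes on the image of the arrow of the other colour into `e` spreads
along the vertices before `e` on the segment of `e`. -/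
theorem exists_spread_functional (M : QRep k I) {e : I} (lam : M.vec e →ₗ[k] k)
    (hlam : ∀ {a : I} (h : a ⟶ e), B.col h ≠ d → ∀ x, lam (M.act h x) = 0) :
    ∃ l : ∀ i, M.vec i →ₗ[k] k,
      (∀ {i : I} (q : Quiver.Path i e), B.Monochrome d q → ∀ x, l i x = lam (M.actPath q x)) ∧
      (∀ i : I, (¬ ∃ q : Quiver.Path i e, B.Monochrome d q) → l i = 0) ∧
      (∀ {i j : I} (g : i ⟶ j), B.col g = d → (∃ q : Quiver.Path j e, B.Monochrome d q) →
        ∀ x, l j (M.act g x) = l i x) ∧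
      ∀ {i j : I} (g : i ⟶ j), B.col g ≠ d → ∀ x, l j (M.act g x) = 0 := by
  classical
  let l : ∀ i, M.vec i →ₗ[k] k := fun i =>
    if H : ∃ q : Quiver.Path i e, B.Monochrome d q then lam ∘ₗ M.actPath H.choose else 0
  have hl : ∀ {i : I} (q : Quiver.Path i e), B.Monochrome d q → ∀ x, l i x = lam (M.actPath q x) :=
    fun q hq x => by
      have H : ∃ q, B.Monochrome d q := ⟨q, hq⟩
      have : H.choose = q := H.choose_spec.path_unique_of_acyclic hQ hq
      simp only [l, dif_pos H, this, LinearMap.comp_apply]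
  have hl0 : ∀ i : I, (¬ ∃ q : Quiver.Path i e, B.Monochrome d q) → l i = 0 := fun i H => dif_neg H
  refine ⟨l, hl, hl0, fun {i j} g hg ⟨q, hq⟩ x => ?_, fun {i j} g hg x => ?_⟩
  · rw [hl q hq, hl (g.toPath.comp q) ((mono_toPath hg).comp hq), actPath_comp]
  · by_cases H : ∃ q : Quiver.Path j e, B.Monochrome d q
    · obtain ⟨q, hq⟩ := H
      rcases hq.eq_or_exists_first with rfl | ⟨l', h, q', hc, -⟩
      · rw [hl .nil trivial, actPath_nil]
        exact hlam g hg x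
      · exact absurd ((B.col_eq g h).trans hc) hg
    · rw [hl0 j H, LinearMap.zero_apply]

end Spread

/-! ### The regular simple representations of period greater than one -/

section Classification

variable {k : Type u} [Field k] {I : Type} [Quiver.{0} I]

theorem exists_biprod_of_not_indecomposable {M : QRep k I} (h0 : ¬ IsZero M)
    (hi : ¬ Indecomposable M) :
    ∃ (Y Z : QRep k I) (_ : M ≅ Y ⊞ Z), ¬ IsZero Y ∧ ¬ IsZero Z := by
  by_contra hcon
  push Not at hcon
  refine hi ⟨h0, fun Y Z e => ?_⟩
  by_cases hY : IsZero Y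
  · exact Or.inl hY
  · exact Or.inr (hcon Y Z e hY)

variable [Fintype I]

theorem exists_indecomposable_summand {M : QRep k I} (hM : M.IsFinDim) (h0 : ¬ IsZero M) :
    ∃ N : QRep k I, Indecomposable N ∧ N.IsSummand M := by
  induction hn : M.dim using Nat.strong_induction_on generalizing M with
  | _ n ih =>
  by_cases hi : Indecomposable M
  · exact ⟨M, hi, IsSummand.of_iso (Iso.refl M)⟩
  · obtain ⟨Y, Z, e, hY, hZ⟩ := exists_biprod_of_not_indecomposable h0 hi
    have hYs : Y.IsSummand M := ⟨Z, ⟨e⟩⟩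
    have hZs : Z.IsSummand M := isSummand_iff.2 ⟨biprod.inr ≫ e.inv, e.hom ≫ biprod.snd, by simp⟩
    have hd := dim_shortExact (shortExact_of_iso_biprod e) hM
    have hZp := dim_pos (hZs.isFinDim hM) hZ
    simp only at hd
    obtain ⟨N, hN, hNs⟩ := ih Y.dim (by omega) (hYs.isFinDim hM) hY rfl
    exact ⟨N, hN, hNs.trans hYs⟩

variable [∀ i j : I, Fintype (i ⟶ j)]

/-- A regular simple representation is indecomposable, because an indecomposable summand is a
nonzero regular subrepresentation. -/
theorem IsRegularSimple.isRegularIndecomposable {R : QRep k I} (hR : IsRegularSimple R) :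
    IsRegularIndecomposable R := by
  obtain ⟨⟨hfin, hreg⟩, h0, hsub⟩ := hR
  obtain ⟨N, hN, hNs⟩ := exists_indecomposable_summand hfin h0
  obtain ⟨i, r, hir⟩ := isSummand_iff.1 hNs
  have hmono : Mono i := mono_of_mono_fac hir
  have hi : IsIso i := (hsub N i hmono
    ⟨hNs.isFinDim hfin, fun N' hN' hN's => hreg N' hN' (hN's.trans hNs)⟩).resolve_left hN.1
  exact hreg R ⟨h0, fun Y Z e => hN.2 Y Z (asIso i ≪≫ e)⟩ (IsSummand.of_iso (Iso.refl R))

/-- A nonzero vector in the kernel of the arrow out of a segment generates the thin representation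
of the segment. Otherwise it would generate the thin representation of an initial part `P` of the
segment. That one is a direct summand, hence all of `R`, and `τ⁻` kills it. -/
theorem exists_injective_segmentRep (hQ : NoOrientedCycle I) {B : DirectionColouring I} {d : Bool}
    {R : QRep k I} (hR : Indecomposable R) (hinv : ¬ IsZero (arTranslateInv R)) {s t : I}
    (h : s ⟶ t) (hc : B.col h = !d) (v : R.vec s) (hv : R.act h v = 0) (hv0 : v ≠ 0) :
    ∃ f : segmentRep hQ B d k s ⟶ R, ∀ i, Function.Injective (homAt f i) := by
  have hs : B.IsStart d s := isStart_of_out h hc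
  obtain ⟨w, hw, hw0, hw1, hw2⟩ := exists_spread_vector R h hc v hv
  by_cases hall : ∀ i ∈ segment hQ B d s, w i ≠ 0
  · refine ⟨homFromThin w (fun i hi => hw0 i fun ⟨q, hq⟩ => hi ?_) hw1 hw2,
      homFromThin_injective w _ _ _ hall⟩
    exact (mem_segment_of_mono hq).2 (self_mem_segment hs)
  exfalso
  -- the last vertex `e` of the segment at which `w` does not vanish
  obtain ⟨e, e', g, hg, he, he'⟩ : ∃ (e e' : I) (g : e ⟶ e'), B.col g = d ∧ w e ≠ 0 ∧ w e' = 0 := by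
    by_contra hcon
    push Not at hcon
    refine hall fun i hi => ?_
    obtain ⟨q, hq⟩ := exists_mono_of_mem_segment hi
    clear hi
    induction q with
    | nil => rwa [hw .nil trivial, actPath_nil]
    | cons q g ih => exact hcon _ _ g hq.2 (ih hq.1)
  -- `thin k B d P` is injective, so the subrepresentation that `w` gives splits off
  let P : Set I := {j | ∃ q : Quiver.Path j e, B.Monochrome d q}
  have hPout : ∀ j ∈ P, ∃ (l : I) (g' : j ⟶ l), B.col g' = d := by
    rintro j ⟨q, hq⟩
    rcases hq.eq_or_exists_first with rfl | ⟨l, g', -, hg', -⟩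
    · exact ⟨e', g, hg⟩
    · exact ⟨l, g', hg'⟩
  have hPin : ∀ {a b : I} (g' : a ⟶ b), B.col g' ≠ d → b ∉ P := fun g' hg' hb => by
    obtain ⟨l, g'', hc''⟩ := hPout _ hb
    exact hg' ((B.col_eq g' g'').trans hc'')
  have hPstep : ∀ {a b : I} (g' : a ⟶ b), B.col g' = d → b ∈ P → a ∈ P := fun g' hg' ⟨q, hq⟩ =>
    ⟨g'.toPath.comp q, (mono_toPath hg').comp hq⟩
  have hPw : ∀ {j : I} (q : Quiver.Path j e), B.Monochrome d q → R.actPath q (w j) = w e := by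
    intro j q hq
    obtain ⟨qe, hqe⟩ : ∃ q : Quiver.Path s e, B.Monochrome d q := by
      by_contra H
      exact he (hw0 e H)
    have hsj : B.start hQ d j = s := by
      rw [← start_eq_of_mono hQ hq, start_eq hQ hs hqe]
    obtain ⟨qj, hqj⟩ := exists_mono_of_mem_segment (hQ := hQ) hsj
    rw [hw qj hqj, hw (qj.comp q) (hqj.comp hq), actPath_comp]
  obtain ⟨lam, hlam⟩ := Module.Projective.exists_dual_eq_one k he
  obtain ⟨l, hl, hl0, hl1, hl2⟩ := exists_spread_functional (d := d) (B := B) hQ R lam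
    fun g' hg' => absurd ⟨.nil, trivial⟩ (hPin g' hg')
  classical
  let w' : ∀ i, R.vec i := fun i => if i ∈ P then w i else 0
  have hw' : ∀ i ∈ P, w' i = w i := fun i hi => if_pos hi
  have hw'0 : ∀ i, i ∉ P → w' i = 0 := fun i hi => if_neg hi
  let f : thin k B d P ⟶ R := homFromThin w' hw'0 (by
    intro i j g' hg'
    by_cases hi : i ∈ P
    · rw [hw' i hi, hw1 g' hg']
      by_cases hj : j ∈ P
      · exact (hw' j hj).symm
      · obtain ⟨q, hq⟩ := hi
        rw [hw'0 j hj]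
        rcases hq.eq_nil_or_tail g' hg' with rfl | hj'
        · obtain ⟨rfl, -⟩ := Sigma.mk.inj_iff.1 (B.out_unique g' g (hg'.trans hg.symm))
          exact he'
        · exact absurd hj' hj
    · rw [hw'0 i hi, map_zero, hw'0 j fun hj => hi (hPstep g' hg' hj)]) (by
    intro i j g' hg'
    by_cases hi : i ∈ P
    · rw [hw' i hi, hw2 g' hg']
    · rw [hw'0 i hi, map_zero])
  let r : R ⟶ thin k B d P := homToThin l hl0 hl1 hl2
  have hfr : f ≫ r = 𝟙 _ := hom_ext_at fun i x => by
    refine thinVal_injective i ?_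
    rw [homAt_comp, homAt_id, thinVal_homToThin, homFromThin_apply, map_smul, smul_eq_mul]
    by_cases hi : i ∈ P
    · obtain ⟨q, hq⟩ := hi
      rw [hw' i ⟨q, hq⟩, hl q hq, hPw q hq, hlam, mul_one]
    · rw [thinVal_eq_zero hi, zero_mul]
  have hne : ¬ IsZero (thin k B d P) := not_isZero_iff.2 ⟨e, by
    change e ∈ (thin k B d P).supp
    rw [thin_supp]
    exact ⟨.nil, trivial⟩⟩
  obtain ⟨ψ⟩ := iso_of_isSummand_of_indecomposable hR (isSummand_iff.2 ⟨f, r, hfr⟩) hne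
  have hsub : ∀ b, b ∉ P → Subsingleton (R.vec b) := fun b hb => by
    rw [← not_nontrivial_iff_subsingleton]
    change b ∉ R.supp
    rwa [supp_eq_of_iso ψ, thin_supp]
  refine hinv (isZero_arTranslateInv hQ fun {a b} g' => ?_)
  by_cases hb : b ∈ P
  · have hg' : B.col g' = d := by
      by_contra H
      exact hPin g' H hb
    refine Or.inr ⟨fun y => ?_, fun {b'} g'' hne => hsub b' (hPin g'' fun H =>
      hne (B.out_unique g'' g' (H.trans hg'.symm)))⟩
    refine ⟨(isoAt ψ a).symm (thinVal P b (isoAt ψ b y) • thinOne (hPstep g' hg' hb)), ?_⟩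
    refine (isoAt ψ b).injective (thinVal_injective b ?_)
    rw [isoAt_act, LinearEquiv.apply_symm_apply, thinVal_act g' hg' hb, map_smul, thinVal_one,
      smul_eq_mul, mul_one]
  · exact Or.inl (hsub b hb)

/-- A regular simple representation of period other than `1` is the thin representation of a
segment, for one of the two directions. -/
theorem exists_iso_segmentRep (hQ : NoOrientedCycle I) (B : DirectionColouring I) {R : QRep k I}
    (hR : IsRegularSimple R) {p : ℕ} (hp : HasPeriod R p) (hp1 : p ≠ 1) :
    ∃ (d : Bool) (s : I), B.IsStart d s ∧ Nonempty (R ≅ segmentRep hQ B d k s) := by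
  have hind := hR.isRegularIndecomposable
  have hinv : ¬ IsZero (arTranslateInv R) := (hind.2.2 1).2
  by_cases hinj : ∀ {i j : I} (h : i ⟶ j), Function.Injective (R.act h)
  · exfalso
    obtain ⟨⟨hp0, ⟨e⟩⟩, hmin⟩ := hp
    have h1 := hmin ⟨one_pos, nonempty_iso_arTranslate_of_injective B hind.1 hinj hp0 e⟩
    omega
  · simp only [not_forall] at hinj
    obtain ⟨s, t, h, hinj⟩ := hinj
    rw [injective_iff_map_eq_zero] at hinj
    push Not at hinj
    obtain ⟨v, hv, hv0⟩ := hinj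
    have hc : B.col h = !!B.col h := (Bool.not_not _).symm
    have hs : B.IsStart (!B.col h) s := isStart_of_out h hc
    obtain ⟨f, hf⟩ := exists_injective_segmentRep hQ hind.2.1 hinv h hc v hv hv0
    have hmono := (mono_iff f).2 hf
    have := (hR.2.2 _ f hmono (isRegularRep_segmentRep hs)).resolve_left
      (segmentRep_not_isZero hs)
    exact ⟨_, s, hs, ⟨(asIso f).symm⟩⟩

end Classification

/-! ### The segments of a tube -/

section Indexing

variable {k : Type u} [Field k] {I : Type} [Quiver.{0} I] [Fintype I] [∀ i j : I, Fintype (i ⟶ j)]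
  {hQ : NoOrientedCycle I} {B : DirectionColouring I} {d : Bool}

/-- The period of `R` under `τ` is that of its segment under `next`, since non-isomorphic thin
representations of segments have different supports. -/
theorem minimalPeriod_next {R : QRep k I} {s : I} (hs : B.IsStart d s)
    (e : R ≅ segmentRep hQ B d k s) {p : ℕ} (hp : HasPeriod R p) :
    0 < p ∧ Function.minimalPeriod (B.next hQ d) s = p := by
  obtain ⟨⟨hp0, ⟨e'⟩⟩, hmin⟩ := hp
  have hper : Function.IsPeriodicPt (B.next hQ d) p s := by
    obtain ⟨e₁⟩ := arTranslate_iterate_iso e p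
    obtain ⟨e₂⟩ := arTranslate_iterate_segmentRep (k := k) (hQ := hQ) hs p
    have h := supp_eq_of_iso (e.symm ≪≫ e'.symm ≪≫ e₁ ≪≫ e₂)
    rw [thin_supp, thin_supp] at h
    have h' : B.start hQ d s = (B.next hQ d)^[p] s := by
      have := self_mem_segment (hQ := hQ) hs
      rw [h] at this
      exact this
    exact (h'.symm.trans (start_self hQ hs))
  refine ⟨hp0, le_antisymm (hper.minimalPeriod_le hp0) (hmin ⟨hper.minimalPeriod_pos hp0, ?_⟩)⟩
  obtain ⟨e₁⟩ := arTranslate_iterate_iso e (Function.minimalPeriod (B.next hQ d) s)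
  obtain ⟨e₂⟩ := arTranslate_iterate_segmentRep (k := k) (hQ := hQ) hs
    (Function.minimalPeriod (B.next hQ d) s)
  rw [Function.iterate_minimalPeriod] at e₂
  exact ⟨e₁ ≪≫ e₂ ≪≫ e.symm⟩

/-- The first vertices of the segments, indexed by `ℤ/p` along the `τ`-orbit of `R`. -/
theorem exists_segment_indexing {R : QRep k I} {s : I} (hs : B.IsStart d s)
    (e : R ≅ segmentRep hQ B d k s) {p : ℕ} (hp : HasPeriod R p) :
    ∃ σ : CyclicVertex p → I, (∀ r, B.IsStart d (σ r)) ∧ Function.Injective σ ∧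
      (∀ r, B.next hQ d (σ r) = σ (r - 1)) ∧ (∀ i, ∃ r, B.start hQ d i = σ r) ∧
      ∀ r, Nonempty (orbitSimple R p r ≅ segmentRep hQ B d k (σ r)) := by
  obtain ⟨hp0, hmin⟩ := minimalPeriod_next hs e hp
  have : NeZero p := ⟨hp0.ne'⟩
  let σ : CyclicVertex p → I := fun r => (B.next hQ d)^[ZMod.val (n := p) (-r)] s
  have hσ : ∀ r, B.IsStart d (σ r) := fun r => isStart_iterate_next hs _
  have hnext : ∀ r, B.next hQ d (σ r) = σ (r - 1) := by
    intro r
    have h1 : ZMod.val (n := p) (-(r - 1) : CyclicVertex p) = (ZMod.val (n := p) (-r) + 1) % p := by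
      have h2 : (-(r - 1) : CyclicVertex p) = (-r) + 1 := by ring
      rw [h2]
      refine (ZMod.val_add (n := p) (-r : CyclicVertex p) (1 : CyclicVertex p)).trans ?_
      have h3 : ZMod.val (n := p) (1 : CyclicVertex p) = 1 % p := ZMod.val_one_eq_one_mod p
      rw [h3, Nat.add_mod_mod]
    have h4 : ∀ m, (B.next hQ d)^[m % p] s = (B.next hQ d)^[m] s := fun m => by
      rw [← hmin, Function.iterate_mod_minimalPeriod_eq]
    simp only [σ]
    rw [h1, h4, Function.iterate_succ_apply']
  refine ⟨σ, hσ, ?_, hnext, ?_, ?_⟩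
  · intro r r' h
    have h1 := (Function.iterate_eq_iterate_iff_of_lt_minimalPeriod
      (by rw [hmin]; exact ZMod.val_lt _) (by rw [hmin]; exact ZMod.val_lt _)).1 h
    exact neg_injective (ZMod.val_injective p h1)
  · -- the union of the segments of the orbit is closed under neighbours
    have hU := B.connected {i | ∃ r, B.start hQ d i = σ r}
      ⟨σ 0, 0, start_self hQ (hσ 0)⟩ (by
        intro i j g
        by_cases hg : B.col g = d
        · change (∃ r, _ = σ r) ↔ ∃ r, _ = σ r
          rw [start_eq_of_arrow hQ g hg]
        · replace hg := bool_eq_not_of_ne hg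
          have hi := isStart_of_out g hg
          change (∃ r, B.start hQ d i = σ r) ↔ ∃ r, B.start hQ d j = σ r
          rw [start_self hQ hi, ← next_eq hQ g hg]
          constructor
          · rintro ⟨r, rfl⟩
            exact ⟨r - 1, hnext r⟩
          · rintro ⟨r, hr⟩
            refine ⟨r + 1, next_injOn hQ hi (hσ _) ?_⟩
            rw [hr, hnext, add_sub_cancel_right])
    exact fun i => Set.eq_univ_iff_forall.1 hU i
  · intro r
    obtain ⟨e₁⟩ := arTranslate_iterate_iso e (ZMod.val (n := p) (-r))
    obtain ⟨e₂⟩ := arTranslate_iterate_segmentRep (k := k) (hQ := hQ) hs (ZMod.val (n := p) (-r))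
    exact ⟨e₁ ≪≫ e₂⟩

end Indexing

namespace TubeData

variable {I : Type} [Quiver.{0} I] [Finite I]

/-- The data of a tube come from the maximal paths of colour `d`. -/
structure Adapted {p : ℕ} {S : CyclicVertex p → Set I} (D : TubeData p S) (hQ : NoOrientedCycle I)
    (B : DirectionColouring I) (d : Bool) : Prop where
  start_eq : ∀ i, B.start hQ d i = D.s (D.c i)
  isStart_s : ∀ r, B.IsStart d (D.s r)
  c_s : ∀ r, D.c (D.s r) = r
  c_t : ∀ r, D.c (D.t r) = r
  mono_ρ : ∀ r, B.Monochrome d (D.ρ r)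
  col_h : ∀ {r r' : CyclicVertex p} (e : r ⟶ r'), B.col (D.h e) = !d
  sub_one_ne : ∀ r : CyclicVertex p, r - 1 ≠ r

omit [Finite I] in
theorem mono_of_vertices {B : DirectionColouring I} {d : Bool} {S : Set I}
    (hS : ∀ {a b : I} (h : a ⟶ b), a ∈ S → b ∈ S → B.col h = d) {i j : I} (q : Quiver.Path i j)
    (hq : ∀ x ∈ q.vertices, x ∈ S) : B.Monochrome d q := by
  induction q with
  | nil => trivial
  | cons q h ih =>
    simp only [Quiver.Path.vertices_cons, List.concat_eq_append, List.mem_append,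
      List.mem_singleton] at hq
    exact ⟨ih fun x hx => hq x (Or.inl hx),
      hS h (hq _ (Or.inl (Quiver.Path.end_mem_vertices q))) (hq _ (Or.inr rfl))⟩

theorem mem_segment_of_mem_vertices {hQ : NoOrientedCycle I} {B : DirectionColouring I} {d : Bool}
    {s i j : I} (q : Quiver.Path i j) (hq : B.Monochrome d q) (hi : i ∈ segment hQ B d s) :
    ∀ x ∈ q.vertices, x ∈ segment hQ B d s := by
  induction q with
  | nil => simpa using hi
  | cons q h ih =>
    simp only [Quiver.Path.vertices_cons, List.concat_eq_append, List.mem_append,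
      List.mem_singleton]
    rintro x (hx | rfl)
    · exact ih hq.1 x hx
    · exact (mem_segment_of_mono hq).2 hi

/-- Segments indexed as in `exists_segment_indexing` carry the data of a tube. For `p ≠ 1`, hence
`r - 1 ≠ r`, the arrow from one segment to the next has its ends in different segments, so the
arrows inside a segment are those of its path. -/
theorem exists_adapted {hQ : NoOrientedCycle I} {B : DirectionColouring I} {d : Bool} {p : ℕ}
    (hp : (1 : CyclicVertex p) ≠ 0) (σ : CyclicVertex p → I) (hσ : ∀ r, B.IsStart d (σ r))
    (hinj : Function.Injective σ) (hnext : ∀ r, B.next hQ d (σ r) = σ (r - 1))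
    (hcov : ∀ i, ∃ r, B.start hQ d i = σ r) (S : CyclicVertex p → Set I)
    (hS : ∀ r, S r = segment hQ B d (σ r)) :
    ∃ D : TubeData p S, D.Adapted hQ B d ∧ D.s = σ := by
  obtain rfl : S = fun r => segment hQ B d (σ r) := funext hS
  clear hS
  choose c hc using hcov
  have hmem : ∀ i r, i ∈ segment hQ B d (σ r) ↔ c i = r := fun i r =>
    ⟨fun h => hinj ((hc i).symm.trans h), fun h => by rw [← h]; exact hc i⟩
  have hne : ∀ r : CyclicVertex p, r - 1 ≠ r := fun r h => hp (sub_eq_self.1 h)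
  -- an arrow inside a segment has the colour `d`
  have hin : ∀ (r : CyclicVertex p) {a b : I} (h : a ⟶ b), a ∈ segment hQ B d (σ r) →
      b ∈ segment hQ B d (σ r) → B.col h = d := by
    intro r a b h ha hb
    by_contra hcol
    replace hcol := bool_eq_not_of_ne hcol
    have h1 : a = σ r := (start_self hQ (isStart_of_out h hcol)).symm.trans ha
    have h2 := next_eq hQ h hcol
    rw [h1, hnext, hb] at h2
    exact hne r (hinj h2)
  have hmemσ : ∀ r, σ r ∈ segment hQ B d (σ r) := fun r => self_mem_segment (hσ r)
  have hmemt : ∀ r, B.finish hQ d (σ r) ∈ segment hQ B d (σ r) := fun r =>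
    (mem_segment_of_mono (B.mono_toFinish hQ d (σ r))).2 (hmemσ r)
  have harrow : ∀ {r r' : CyclicVertex p} (_ : r ⟶ r'),
      ∃ g : σ r ⟶ B.finish hQ d (σ r'), B.col g = !d := by
    rintro r _ ⟨rfl⟩
    obtain ⟨j, g, hg⟩ := (hσ r).exists_out
    obtain rfl : j = B.finish hQ d (σ (r - 1)) := by
      rw [← hnext, next_eq hQ g hg, finish_start, finish_self hQ (isEnd_of_in g hg)]
    exact ⟨g, hg⟩
  choose hh hhc using @harrow
  let D : TubeData p fun r => segment hQ B d (σ r) :=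
    { c := c
      mem_iff := hmem
      s := σ
      source_iff := fun r i => by
        constructor
        · rintro ⟨hi, hno⟩
          have hi' : B.IsStart d i := fun a h hcol =>
            (hno a ((mem_segment_of_arrow h hcol).1 hi)).false h
          exact (start_self hQ hi').symm.trans hi
        · rintro rfl
          exact ⟨hmemσ r, fun j hj => ⟨fun h => hσ r j h (hin r h hj (hmemσ r))⟩⟩
      t := fun r => B.finish hQ d (σ r)
      sink_iff := fun r i => by
        constructor
        · rintro ⟨hi, hno⟩
          have hi' : B.IsEnd d i := fun a h hcol =>
            (hno a ((mem_segment_of_arrow h hcol).2 hi)).false h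
          rw [← finish_self hQ hi', ← finish_start, show B.start hQ d i = σ r from hi]
        · rintro rfl
          exact ⟨hmemt r, fun j hj =>
            ⟨fun h => B.isEnd_finish hQ d (σ r) j h (hin r h (hmemt r) hj)⟩⟩
      ρ := fun r => B.toFinish hQ d (σ r)
      path_iff := fun r q => by
        constructor
        · intro hq
          exact (mono_of_vertices (hin r) q hq).path_unique (hσ r) (B.mono_toFinish hQ d (σ r))
        · rintro rfl
          exact mem_segment_of_mem_vertices _ (B.mono_toFinish hQ d (σ r)) (hmemσ r)
      h := fun e => hh e
      arrow_unique := fun {r r'} e g => by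
        have hg : B.col g = !d := by
          refine bool_eq_not_of_ne fun hcol => ?_
          have h1 := (hmem _ _).1 ((mem_segment_of_arrow g hcol).2 (hmemσ r))
          rw [(hmem _ _).1 (hmemt r')] at h1
          exact hne r (e.down.symm.trans h1)
        exact eq_of_heq (Sigma.mk.inj_iff.1 (B.out_unique g (hh e) (hg.trans (hhc e).symm))).2 }
  exact ⟨D, ⟨hc, hσ, fun r => (hmem _ _).1 (hmemσ r), fun r => (hmem _ _).1 (hmemt r),
    fun r => B.mono_toFinish hQ d (σ r), fun e => hhc e, hne⟩, rfl⟩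

end TubeData

/-! ### Representations with bijective maps in one direction -/

section Bijective

variable {k : Type u} [Field k] {I : Type} [Quiver.{0} I] {B : DirectionColouring I} {d : Bool}

/-- All arrows of colour `d` act bijectively. -/
def BijectiveOn (B : DirectionColouring I) (d : Bool) (M : QRep k I) : Prop :=
  ∀ ⦃i j : I⦄ (h : i ⟶ j), B.col h = d → Function.Bijective (M.act h)

theorem BijectiveOn.actPath {M : QRep k I} (hM : BijectiveOn B d M) {i j : I}
    {q : Quiver.Path i j} (hq : B.Monochrome d q) : Function.Bijective (M.actPath q) := by
  induction q with
  | nil =>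
    have : ⇑(M.actPath (Quiver.Path.nil (a := i))) = id := funext (M.actPath_nil i)
    rw [this]
    exact Function.bijective_id
  | cons q h ih =>
    have : ⇑(M.actPath (q.cons h)) = M.act h ∘ M.actPath q := funext (M.actPath_cons q h)
    rw [this]
    exact (hM h hq.2).comp (ih hq.1)

theorem BijectiveOn.of_isZero {M : QRep k I} (hM : IsZero M) : BijectiveOn B d M := by
  intro i j _ _
  have := isZero_iff.1 hM i
  have := isZero_iff.1 hM j
  exact ⟨Function.injective_of_subsingleton _, fun y => ⟨0, Subsingleton.elim _ _⟩⟩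

theorem BijectiveOn.of_isSummand {M N : QRep k I} (hM : BijectiveOn B d M) (h : N.IsSummand M) :
    BijectiveOn B d N := by
  obtain ⟨i, r, hir⟩ := isSummand_iff.1 h
  have hir' : ∀ a (x : N.vec a), homAt r a (homAt i a x) = x := fun a x => by
    rw [← homAt_comp, hir, homAt_id]
  intro a b g hg
  constructor
  · intro x y hxy
    have h1 := congrArg (homAt i b) hxy
    rw [homAt_act, homAt_act] at h1
    rw [← hir' a x, (hM g hg).1 h1, hir']
  · intro y
    obtain ⟨x, hx⟩ := (hM g hg).2 (homAt i b y)
    refine ⟨homAt r a x, ?_⟩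
    rw [← homAt_act, hx, hir']

theorem BijectiveOn.of_shortExact {E : ShortComplex (QRep k I)} (hE : E.ShortExact)
    (h₁ : BijectiveOn B d E.X₁) (h₃ : BijectiveOn B d E.X₃) : BijectiveOn B d E.X₂ := by
  intro a b g hg
  constructor
  · refine (injective_iff_map_eq_zero _).2 fun x hx => ?_
    have h1 : homAt E.g a x = 0 := (h₃ g hg).1 (by rw [← homAt_act, hx, map_zero, map_zero])
    obtain ⟨y, rfl⟩ := exists_of_shortExact hE a x h1
    rw [← homAt_act] at hx
    have h2 : E.X₁.act g y = 0 := injective_of_shortExact hE b (hx.trans (map_zero _).symm)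
    rw [(h₁ g hg).1 (h2.trans (map_zero _).symm), map_zero]
  · intro y
    obtain ⟨z, hz⟩ := (h₃ g hg).2 (homAt E.g b y)
    obtain ⟨x, rfl⟩ := surjective_of_shortExact hE a z
    obtain ⟨u, hu⟩ := exists_of_shortExact hE b (y - E.X₂.act g x) (by
      rw [map_sub, homAt_act, hz, sub_self])
    obtain ⟨v, rfl⟩ := (h₁ g hg).2 u
    refine ⟨x + homAt E.f a v, ?_⟩
    rw [map_add, ← homAt_act, hu, add_sub_cancel]

theorem BijectiveOn.of_shortExact_left {E : ShortComplex (QRep k I)} (hE : E.ShortExact)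
    (h₂ : BijectiveOn B d E.X₂) (h₃ : BijectiveOn B d E.X₃) : BijectiveOn B d E.X₁ := by
  intro a b g hg
  constructor
  · intro x y hxy
    have h1 := congrArg (homAt E.f b) hxy
    rw [homAt_act, homAt_act] at h1
    exact injective_of_shortExact hE a ((h₂ g hg).1 h1)
  · intro y
    obtain ⟨x, hx⟩ := (h₂ g hg).2 (homAt E.f b y)
    have h1 : homAt E.g a x = 0 := (h₃ g hg).1 (by
      rw [← homAt_act, hx, comp_zero_of_shortComplex, map_zero])
    obtain ⟨z, rfl⟩ := exists_of_shortExact hE a x h1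
    exact ⟨z, injective_of_shortExact hE b (by rw [homAt_act, hx])⟩

theorem bijectiveOn_segmentRep [Finite I] (hQ : NoOrientedCycle I) (s : I) :
    BijectiveOn B d (segmentRep hQ B d k s) := by
  intro i j h hc
  refine ⟨injectiveOn_segmentRep s h hc, fun y => ?_⟩
  by_cases hj : j ∈ segment hQ B d s
  · refine ⟨thinVal _ j y • thinOne ((mem_segment_of_arrow h hc).1 hj), thinVal_injective j ?_⟩
    rw [thinVal_act h hc hj, map_smul, thinVal_one, smul_eq_mul, mul_one]
  · exact ⟨0, thinVal_injective j (by rw [thinVal_eq_zero hj, thinVal_eq_zero hj])⟩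

end Bijective

/-! ### Nilpotency -/

section Nilpotent

/-- Paths of length `N` act as zero. -/
def KillsLength {k : Type u} [Field k] {J : Type} [Quiver.{0} J] (W : QRep k J) (N : ℕ) : Prop :=
  ∀ (r r' : J) (q : Quiver.Path r r'), q.length = N → ∀ x, W.actPath q x = 0

theorem path_split {J : Type} [Quiver.{0} J] {r r' : J} (q : Quiver.Path r r') :
    ∀ {a b : ℕ}, q.length = a + b → ∃ (x : J) (q₁ : Quiver.Path r x) (q₂ : Quiver.Path x r'),
      q = q₁.comp q₂ ∧ q₁.length = a ∧ q₂.length = b := by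
  intro a b h
  obtain ⟨x, q₁, q₂, rfl, h₁⟩ := q.exists_eq_comp_of_le_length (n := a) (by omega)
  rw [Quiver.Path.length_comp] at h
  exact ⟨x, q₁, q₂, rfl, h₁, by omega⟩

variable {k : Type u} [Field k] {J : Type} [Quiver.{0} J]

theorem KillsLength.add {W : QRep k J} {a : ℕ} (h : KillsLength W a) (b : ℕ) :
    KillsLength W (a + b) := by
  intro r r' q hq x
  obtain ⟨y, q₁, q₂, rfl, h1, -⟩ := path_split q hq
  rw [actPath_comp, h _ _ q₁ h1, map_zero]

theorem KillsLength.of_injective {W W' : QRep k J} {a : ℕ} (h : KillsLength W' a) (f : W ⟶ W')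
    (hf : ∀ r, Function.Injective (homAt f r)) : KillsLength W a := fun r r' q hq x =>
  hf r' (by rw [homAt_actPath, h r r' q hq, map_zero])

/-- An extension of representations killed by paths of lengths `b` and `a` is killed by paths of
length `a + b`. -/
theorem KillsLength.extension {W₁ W₂ W₃ : QRep k J} {a b : ℕ} (h₁ : KillsLength W₁ b)
    (h₃ : KillsLength W₃ a) (f : W₁ ⟶ W₂) (g : W₂ ⟶ W₃) (hg : ∀ r x, homAt g r x = 0 →
      ∃ y, homAt f r y = x) : KillsLength W₂ (a + b) := by
  intro r r' q hq x
  obtain ⟨y, q₁, q₂, rfl, h1, h2⟩ := path_split q hq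
  obtain ⟨z, hz⟩ := hg y (W₂.actPath q₁ x) (by rw [homAt_actPath, h₃ _ _ q₁ h1])
  rw [actPath_comp, ← hz, ← homAt_actPath, h₁ _ _ q₂ h2, map_zero]

theorem nilpotentRep_iff {p : ℕ} {W : QRep k (CyclicVertex p)} :
    nilpotentRep k p W ↔ W.IsFinDim ∧ ∃ N, KillsLength W N := by
  constructor
  · rintro ⟨h, N, -, hN⟩
    exact ⟨h, N, fun r r' q hq x => by rw [actPath, hN r r' q hq]; rfl⟩
  · rintro ⟨h, N, hN⟩
    exact ⟨h, N + 2, by omega, fun r r' q hq =>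
      ModuleCat.hom_ext (LinearMap.ext (hN.add 2 r r' q hq))⟩

theorem exists_cyclic_path_from {p : ℕ} (r : CyclicVertex p) (N : ℕ) :
    ∃ (r' : CyclicVertex p) (q : Quiver.Path r r'), q.length = N := by
  induction N with
  | zero => exact ⟨r, .nil, rfl⟩
  | succ N ih =>
    obtain ⟨r', q, rfl⟩ := ih
    exact ⟨r' - 1, q.cons (PLift.up rfl), rfl⟩

theorem exists_cyclic_path_to {p : ℕ} (r : CyclicVertex p) (N : ℕ) :
    ∃ (r' : CyclicVertex p) (q : Quiver.Path r' r), q.length = N := by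
  induction N with
  | zero => exact ⟨r, .nil, rfl⟩
  | succ N ih =>
    obtain ⟨r', q, hq⟩ := ih
    let e : (r' + 1 : CyclicVertex p) ⟶ r' := PLift.up (add_sub_cancel_right r' 1).symm
    exact ⟨r' + 1, e.toPath.comp q, by rw [Quiver.Path.length_comp, hq]; simp [add_comm]⟩

/-- A nonzero nilpotent representation of the cyclic quiver has an arrow that is not injective. -/
theorem KillsLength.exists_not_injective {p : ℕ} {W : QRep k (CyclicVertex p)} {N : ℕ}
    (h : KillsLength W N) (hW : ¬ IsZero W) :
    ∃ (r r' : CyclicVertex p) (e : r ⟶ r'), ¬ Function.Injective (W.act e) := by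
  by_contra hcon
  push Not at hcon
  refine hW (isZero_iff.2 fun r => ?_)
  obtain ⟨r', q, hq⟩ := exists_cyclic_path_from r N
  have hinj : ∀ {r' : CyclicVertex p} (q : Quiver.Path r r'), Function.Injective (W.actPath q) := by
    intro r' q
    induction q with
    | nil => intro x y hxy; rwa [actPath_nil, actPath_nil] at hxy
    | cons q e ih =>
      intro x y hxy
      rw [actPath_cons, actPath_cons] at hxy
      exact ih (hcon _ _ e hxy)
  exact ⟨fun x y => hinj q ((h _ _ q hq x).trans (h _ _ q hq y).symm)⟩

/-- A nonzero nilpotent representation of the cyclic quiver has an arrow that is not surjective. -/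
theorem KillsLength.exists_not_surjective {p : ℕ} {W : QRep k (CyclicVertex p)} {N : ℕ}
    (h : KillsLength W N) (hW : ¬ IsZero W) :
    ∃ (r r' : CyclicVertex p) (e : r ⟶ r'), ¬ Function.Surjective (W.act e) := by
  by_contra hcon
  push Not at hcon
  refine hW (isZero_iff.2 fun r => ?_)
  obtain ⟨r₀, q, hq⟩ := exists_cyclic_path_to r N
  have hsurj : ∀ {r' : CyclicVertex p} (q : Quiver.Path r₀ r'),
      Function.Surjective (W.actPath q) := by
    intro r' q
    induction q with
    | nil => exact fun x => ⟨x, actPath_nil _ _ x⟩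
    | cons q e ih =>
      intro x
      obtain ⟨y, rfl⟩ := hcon _ _ e x
      obtain ⟨z, rfl⟩ := ih y
      exact ⟨z, actPath_cons _ q e z⟩
  refine ⟨fun x y => ?_⟩
  obtain ⟨x, rfl⟩ := hsurj q x
  obtain ⟨y, rfl⟩ := hsurj q y
  rw [h _ _ q hq, h _ _ q hq]

end Nilpotent

namespace TubeData

variable {k : Type u} [Field k] {I : Type} [Quiver.{0} I] [Finite I] {hQ : NoOrientedCycle I}
  {B : DirectionColouring I} {d : Bool} {p : ℕ} {S : CyclicVertex p → Set I} {D : TubeData p S}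

theorem Adapted.isIso_path (hD : D.Adapted hQ B d) {M : QRep k I} (hM : BijectiveOn B d M)
    (r : CyclicVertex p) : IsIso (M.path (D.ρ r)) :=
  (isIso_path_iff _).2 (hM.actPath (hD.mono_ρ r))

omit [Finite I] in
theorem objF_act (M : QRep k I) (hM : ∀ r, IsIso (M.path (D.ρ r))) {r r' : CyclicVertex p}
    (e : r ⟶ r') (x : M.vec (D.s r)) :
    M.actPath (D.ρ r') ((D.objF M hM).act e x) = M.act (D.h e) x := by
  have h : (D.objF M hM).arrow e ≫ M.path (D.ρ r') = M.arrow (D.h e) := by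
    have aux : ∀ {A C C' : ModuleCat.{u} k} (f : A ⟶ C) (g : C' ⟶ C) [IsIso g],
        (f ≫ inv g) ≫ g = f := by simp
    rw [D.objF_arrow]
    exact @aux _ _ _ _ _ (hM r')
  exact congrArg (fun f => f.hom x) h

/-- The arrows of colour `d` act bijectively, and `F` takes a nilpotent value. For
finite-dimensional representations this describes the category of the tube: see
`Adapted.isTubular_of_repTube` and `Adapted.repTube_of_isTubular`. -/
def IsTubular (D : TubeData p S) (B : DirectionColouring I) (d : Bool) (M : QRep k I) : Prop :=
  BijectiveOn B d M ∧ ∃ (h : ∀ r, IsIso (M.path (D.ρ r))) (N : ℕ), KillsLength (D.objF M h) N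

theorem Adapted.isTubular_of_isZero (hD : D.Adapted hQ B d) {M : QRep k I} (hM : IsZero M) :
    D.IsTubular B d M := by
  have hb : BijectiveOn B d M := BijectiveOn.of_isZero hM
  refine ⟨hb, hD.isIso_path hb, 0, fun r r' q _ x => ?_⟩
  have := isZero_iff.1 hM (D.s r')
  exact Subsingleton.elim (α := M.vec (D.s r')) _ _

theorem Adapted.isTubular_of_injective (hD : D.Adapted hQ B d) {K M : QRep k I}
    (hM : D.IsTubular B d M) (hK : BijectiveOn B d K) (f : K ⟶ M)
    (hf : ∀ i, Function.Injective (homAt f i)) : D.IsTubular B d K := by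
  obtain ⟨hb, hiso, N, hN⟩ := hM
  exact ⟨hK, hD.isIso_path hK, N,
    hN.of_injective (D.mapF (hD.isIso_path hK) hiso f) fun r => hf (D.s r)⟩

theorem Adapted.isTubular_of_isSummand (hD : D.Adapted hQ B d) {K M : QRep k I}
    (hM : D.IsTubular B d M) (h : K.IsSummand M) : D.IsTubular B d K := by
  obtain ⟨i, r, hir⟩ := isSummand_iff.1 h
  have : Mono i := mono_of_mono_fac hir
  exact hD.isTubular_of_injective hM (hM.1.of_isSummand h) i ((mono_iff i).1 this)

theorem Adapted.isTubular_of_shortExact (hD : D.Adapted hQ B d) {E : ShortComplex (QRep k I)}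
    (hE : E.ShortExact) (h₁ : D.IsTubular B d E.X₁) (h₃ : D.IsTubular B d E.X₃) :
    D.IsTubular B d E.X₂ := by
  obtain ⟨hb₁, hi₁, N₁, hN₁⟩ := h₁
  obtain ⟨hb₃, hi₃, N₃, hN₃⟩ := h₃
  have hb := BijectiveOn.of_shortExact hE hb₁ hb₃
  exact ⟨hb, hD.isIso_path hb, N₃ + N₁, hN₁.extension hN₃
    (D.mapF hi₁ (hD.isIso_path hb) E.f) (D.mapF (hD.isIso_path hb) hi₃ E.g)
    fun r x hx => exists_of_shortExact hE (D.s r) x hx⟩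

theorem Adapted.isTubular_segmentRep (hD : D.Adapted hQ B d) (s : I) :
    D.IsTubular B d (segmentRep hQ B d k s) := by
  have hb : BijectiveOn B d (segmentRep hQ B d k s) := bijectiveOn_segmentRep hQ s
  refine ⟨hb, hD.isIso_path hb, 1, fun r r' q hq x => ?_⟩
  have hd : (!d) ≠ d := by cases d <;> simp
  have key : ∀ {r r' : CyclicVertex p} (e : r ⟶ r') (x),
      (D.objF (segmentRep hQ B d k s) (hD.isIso_path hb)).act e x = 0 := fun {r r'} e x => by
    refine (hb.actPath (hD.mono_ρ r')).1 ?_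
    exact ((D.objF_act _ (hD.isIso_path hb) e x).trans (thin_act_eq_zero (D.h e)
      (by rw [hD.col_h]; exact hd) x)).trans (map_zero _).symm
  cases q with
  | nil => simp at hq
  | cons q e => rw [actPath_cons, key]

/-- `F` does not kill a nonzero representation on which the arrows of colour `d` act bijectively. -/
theorem Adapted.not_isZero_objF (hD : D.Adapted hQ B d) {M : QRep k I} (hb : BijectiveOn B d M)
    (hi : ∀ r, IsIso (M.path (D.ρ r))) (hM : ¬ IsZero M) : ¬ IsZero (D.objF M hi) := by
  intro h0
  refine hM (isZero_iff.2 fun i => ?_)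
  have : Subsingleton (M.vec (D.s (D.c i))) := isZero_iff.1 h0 (D.c i)
  rw [← hD.start_eq i] at this
  exact (hb.actPath (B.mono_fromStart hQ d i)).2.subsingleton

/-- A nonzero tubular representation contains the thin representation of some segment. -/
theorem Adapted.exists_injective (hD : D.Adapted hQ B d) {M : QRep k I} (hM : D.IsTubular B d M)
    (h0 : ¬ IsZero M) : ∃ (r : CyclicVertex p) (f : segmentRep hQ B d k (D.s r) ⟶ M),
      ∀ i, Function.Injective (homAt f i) := by
  obtain ⟨hb, hi, N, hN⟩ := hM
  obtain ⟨r, r', e, he⟩ := hN.exists_not_injective (hD.not_isZero_objF hb hi h0)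
  rw [injective_iff_map_eq_zero] at he
  push Not at he
  obtain ⟨v, hv, hv0⟩ := he
  have hv' : M.act (D.h e) v = 0 := by
    rw [← D.objF_act M hi e v, hv]
    exact map_zero _
  obtain ⟨w, hw, hw0, hw1, hw2⟩ := exists_spread_vector M (D.h e) (hD.col_h e) v hv'
  refine ⟨r, homFromThin w (fun i hi => hw0 i fun ⟨q, hq⟩ => hi ?_) hw1 hw2,
    homFromThin_injective w _ _ _ fun i hi => ?_⟩
  · exact (mem_segment_of_mono hq).2 (self_mem_segment (hD.isStart_s r))
  · obtain ⟨q, hq⟩ := exists_mono_of_mem_segment hi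
    rw [hw q hq]
    exact fun h => hv0 ((hb.actPath hq).1 (h.trans (map_zero _).symm))

/-- A nonzero tubular representation has the thin representation of some segment as a quotient. -/
theorem Adapted.exists_surjective (hD : D.Adapted hQ B d) {M : QRep k I} (hM : D.IsTubular B d M)
    (h0 : ¬ IsZero M) : ∃ (r : CyclicVertex p) (f : M ⟶ segmentRep hQ B d k (D.s r)),
      ∀ i, Function.Surjective (homAt f i) := by
  obtain ⟨hb, hi, N, hN⟩ := hM
  obtain ⟨r, r', e, he⟩ := hN.exists_not_surjective (hD.not_isZero_objF hb hi h0)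
  have hlt : LinearMap.range (M.act (D.h e)) < ⊤ := by
    rw [lt_top_iff_ne_top]
    intro htop
    refine he fun x => ?_
    obtain ⟨y, hy⟩ := LinearMap.range_eq_top.1 htop (M.actPath (D.ρ r') x)
    exact ⟨y, (hb.actPath (hD.mono_ρ r')).1 ((D.objF_act M hi e y).trans hy)⟩
  obtain ⟨lam, hlam0, hlam⟩ := Submodule.exists_le_ker_of_lt_top _ hlt
  obtain ⟨l, hl, hl0, hl1, hl2⟩ := exists_spread_functional (d := d) (B := B) hQ M lam (by
    intro a h hc x
    have h1 := B.in_unique h (D.h e) ((bool_eq_not_of_ne hc).trans (hD.col_h e).symm)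
    obtain ⟨rfl, h1⟩ := Sigma.mk.inj_iff.1 h1
    rw [eq_of_heq h1]
    exact hlam ⟨x, rfl⟩)
  have hstart : B.start hQ d (D.t r') = D.s r' := by rw [hD.start_eq, hD.c_t]
  have hend : B.IsEnd d (D.t r') := isEnd_of_in _ (hD.col_h e)
  have hpath : ∀ j ∈ segment hQ B d (D.s r'), ∃ q : Quiver.Path j (D.t r'), B.Monochrome d q :=
    fun j hj => exists_mono_to_end hend (Eq.trans hj hstart.symm)
  refine ⟨r', homToThin l (fun i hi => hl0 i fun ⟨q, hq⟩ => hi ?_)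
    (fun g hg hj => hl1 g hg (hpath _ hj)) hl2, fun i z => ?_⟩
  · exact (mem_segment_of_mono hq).1 hstart
  · by_cases hi : i ∈ segment hQ B d (D.s r')
    · obtain ⟨q, hq⟩ := hpath i hi
      obtain ⟨y, hy⟩ := LinearMap.surjective hlam0 (thinVal _ i z)
      obtain ⟨x, rfl⟩ := (hb.actPath hq).2 y
      exact ⟨x, thinVal_injective i (by rw [thinVal_homToThin, hl q hq, hy])⟩
    · exact ⟨0, thinVal_injective i (by rw [thinVal_eq_zero hi, thinVal_eq_zero hi])⟩

end TubeData

/-! ### The category of the tube -/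

section Tube

variable {k : Type u} [Field k] {I : Type} [Quiver.{0} I] [Fintype I] [∀ i j : I, Fintype (i ⟶ j)]
  {hQ : NoOrientedCycle I} {B : DirectionColouring I} {d : Bool} {p : ℕ}
  {S : CyclicVertex p → Set I} {D : TubeData p S} {R : QRep k I}

theorem repTube_of_isSummand {M N : QRep k I} (hM : repTube R M) (h : N.IsSummand M) :
    repTube R N :=
  ⟨h.isFinDim hM.1, fun L hL hLN => hM.2 L hL (hLN.trans h)⟩

/-- Representations filtered by the `τ`-orbit of `R` are tubular. -/
theorem TubeData.Adapted.isTubular_of_hasFactorsInOrbit (hD : D.Adapted hQ B d) {s : I}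
    (hs : B.IsStart d s) (e : R ≅ segmentRep hQ B d k s) {M : QRep k I}
    (hM : HasFactorsInOrbit R M) : D.IsTubular B d M := by
  induction hM with
  | zero M hM => exact hD.isTubular_of_isZero hM
  | extension E hE _ r h₃ ih =>
    obtain ⟨e₁⟩ := arTranslate_iterate_iso e r
    obtain ⟨e₂⟩ := arTranslate_iterate_segmentRep (k := k) (hQ := hQ) hs r
    exact hD.isTubular_of_shortExact hE ih (hD.isTubular_of_isSummand (hD.isTubular_segmentRep _)
      (IsSummand.of_iso (h₃.some ≪≫ e₁ ≪≫ e₂)))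

/-- Each representation in the category of the tube is tubular: decompose it into indecomposables.
-/
theorem TubeData.Adapted.isTubular_of_repTube (hD : D.Adapted hQ B d) {s : I}
    (hs : B.IsStart d s) (e : R ≅ segmentRep hQ B d k s) {M : QRep k I} (hM : repTube R M) :
    D.IsTubular B d M := by
  induction hn : M.dim using Nat.strong_induction_on generalizing M with
  | _ n ih =>
  by_cases h0 : IsZero M
  · exact hD.isTubular_of_isZero h0
  by_cases hi : Indecomposable M
  · exact hD.isTubular_of_hasFactorsInOrbit hs e (hM.2 M hi (IsSummand.of_iso (Iso.refl M))).2
  · obtain ⟨Y, Z, e', hY, hZ⟩ := exists_biprod_of_not_indecomposable h0 hi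
    have hYs : Y.IsSummand M := ⟨Z, ⟨e'⟩⟩
    have hZs : Z.IsSummand M := isSummand_iff.2 ⟨biprod.inr ≫ e'.inv, e'.hom ≫ biprod.snd, by simp⟩
    have hE := shortExact_of_iso_biprod e'
    have hd := dim_shortExact hE hM.1
    have hYp := dim_pos (hYs.isFinDim hM.1) hY
    have hZp := dim_pos (hZs.isFinDim hM.1) hZ
    simp only at hd
    exact hD.isTubular_of_shortExact hE (ih Y.dim (by omega) (repTube_of_isSummand hM hYs) rfl)
      (ih Z.dim (by omega) (repTube_of_isSummand hM hZs) rfl)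

/-- A tubular representation is filtered by the `τ`-orbit of `R`. -/
theorem TubeData.Adapted.hasFactorsInOrbit (hD : D.Adapted hQ B d)
    (hor : ∀ r, Nonempty (orbitSimple R p r ≅ segmentRep hQ B d k (D.s r))) {M : QRep k I}
    (hfin : M.IsFinDim) (hM : D.IsTubular B d M) : HasFactorsInOrbit R M := by
  induction hn : M.dim using Nat.strong_induction_on generalizing M with
  | _ n ih =>
  by_cases h0 : IsZero M
  · exact .zero M h0
  obtain ⟨r, f, hf⟩ := hD.exists_surjective hM h0
  have : Epi f := (epi_iff f).2 hf
  have hE := shortExact_kernel f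
  have hd := dim_shortExact hE hfin
  have hpos : 0 < (segmentRep hQ B d k (D.s r)).dim :=
    dim_pos (thin_isFinDim _) (segmentRep_not_isZero (hD.isStart_s r))
  simp only at hd
  have hinj := injective_of_shortExact hE
  refine .extension _ hE (ih (kernel f).dim (by omega) (isFinDim_of_injective hfin _ hinj)
    (hD.isTubular_of_injective hM (BijectiveOn.of_shortExact_left hE hM.1
      (bijectiveOn_segmentRep hQ _)) _ hinj) rfl) _ ⟨(hor r).some.symm⟩

/-- Tubular representations lie in the category of the tube. Their indecomposable summands are
again tubular, so thin representations of segments occur in them both as subobjects and as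
quotients, which makes them regular. -/
theorem TubeData.Adapted.repTube_of_isTubular (hD : D.Adapted hQ B d)
    (hor : ∀ r, Nonempty (orbitSimple R p r ≅ segmentRep hQ B d k (D.s r))) {M : QRep k I}
    (hfin : M.IsFinDim) (hM : D.IsTubular B d M) : repTube R M := by
  refine ⟨hfin, fun N hN hNM => ?_⟩
  have hNfin := hNM.isFinDim hfin
  have hNt := hD.isTubular_of_isSummand hM hNM
  obtain ⟨r, f, hf⟩ := hD.exists_injective hNt hN.1
  obtain ⟨r', g, hg⟩ := hD.exists_surjective hNt hN.1
  refine ⟨isRegularIndecomposable_of_segmentRep hNfin hN (hD.isStart_s r) (hD.isStart_s r') f hf g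
    fun h0 => ?_, hD.hasFactorsInOrbit hor hNfin hNt⟩
  refine segmentRep_not_isZero (k := k) (hQ := hQ) (hD.isStart_s r') (isZero_iff.2 fun i => ?_)
  have h0' : ∀ z : (segmentRep hQ B d k (D.s r')).vec i, z = 0 := fun z => by
    obtain ⟨x, rfl⟩ := hg i z
    rw [h0, homAt_zero]
  exact ⟨fun x y => (h0' x).trans (h0' y).symm⟩

end Tube

/-! ### The functors are quasi-inverse -/

namespace TubeData

variable {k : Type u} [Field k] {I : Type} [Quiver.{0} I] [Finite I] {hQ : NoOrientedCycle I}
  {B : DirectionColouring I} {d : Bool} {p : ℕ} {S : CyclicVertex p → Set I} {D : TubeData p S}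

theorem Adapted.c_eq_of_arrow (hD : D.Adapted hQ B d) {i j : I} (g : i ⟶ j) (hg : B.col g = d) :
    D.c i = D.c j := by
  have h := start_eq_of_arrow hQ g hg
  rw [hD.start_eq, hD.start_eq] at h
  rw [← hD.c_s (D.c i), ← h, hD.c_s]

/-- The arrows of the other colour are the arrows `h(r)`. -/
theorem Adapted.eq_h (hD : D.Adapted hQ B d) {i j : I} (g : i ⟶ j) (hg : B.col g ≠ d) :
    ∃ (r r' : CyclicVertex p) (e : r ⟶ r'),
      (⟨i, j, g⟩ : Σ i j : I, (i ⟶ j)) = ⟨D.s r, D.t r', D.h e⟩ := by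
  have hi : i = D.s (D.c i) := by
    rw [← hD.start_eq, start_self hQ (isStart_of_out g (bool_eq_not_of_ne hg))]
  generalize D.c i = r at hi
  subst hi
  let e : r ⟶ r - 1 := PLift.up rfl
  refine ⟨r, r - 1, e, ?_⟩
  rw [B.out_unique g (D.h e) ((bool_eq_not_of_ne hg).trans (hD.col_h e).symm)]

theorem Adapted.exists_path (hD : D.Adapted hQ B d) (i : I) :
    ∃ q : Quiver.Path (D.s (D.c i)) i, B.Monochrome d q :=
  exists_mono_of_mem_segment (hQ := hQ) (hD.start_eq i)

theorem Adapted.objG_bijectiveOn (hD : D.Adapted hQ B d) (W : QRep k (CyclicVertex p)) :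
    BijectiveOn B d (D.objG W) := by
  intro i j g hg
  refine (ConcreteCategory.isIso_iff_bijective ((D.objG W).arrow g)).1 ?_
  rw [D.objG_arrow, dif_pos (hD.c_eq_of_arrow g hg)]
  exact (eqToIso (congrArg W.vec (hD.c_eq_of_arrow g hg))).isIso_hom

theorem Adapted.objG_path (hD : D.Adapted hQ B d) (W : QRep k (CyclicVertex p)) {i j : I}
    {q : Quiver.Path i j} (hq : B.Monochrome d q) :
    ∃ e : D.c i = D.c j, (D.objG W).path q = eqToHom (congrArg W.vec e) := by
  induction q with
  | nil => exact ⟨rfl, (D.objG W).map_id i⟩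
  | cons q g ih =>
    obtain ⟨e, he⟩ := ih hq.1
    have e' := hD.c_eq_of_arrow g hq.2
    refine ⟨e.trans e', ?_⟩
    have h1 : (D.objG W).path (q.cons g) = (D.objG W).path q ≫ (D.objG W).arrow g :=
      (D.objG W).map_comp q g.toPath
    rw [h1, he, D.objG_arrow, dif_pos e']
    exact eqToHom_trans _ _

theorem arrow_eqToHom {W : QRep k (CyclicVertex p)} {r r' a b : CyclicVertex p} (ha : a = r)
    (hb : b = r') (e : r ⟶ r') (e' : a ⟶ b) :
    W.arrow e' ≫ eqToHom (congrArg W.vec hb) = eqToHom (congrArg W.vec ha) ≫ W.arrow e := by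
  subst ha hb
  have : e' = e := Subsingleton.elim (α := PLift _) _ _
  subst this
  exact (Category.comp_id _).trans (Category.id_comp _).symm

theorem Adapted.objG_arrow_h (hD : D.Adapted hQ B d) (W : QRep k (CyclicVertex p))
    {r r' : CyclicVertex p} (e : r ⟶ r') :
    ∃ e' : D.c (D.s r) ⟶ D.c (D.t r'), (D.objG W).arrow (D.h e) = W.arrow e' := by
  have h1 : D.c (D.t r') = D.c (D.s r) - 1 := by rw [hD.c_t, hD.c_s]; exact e.down
  have h2 : ¬ D.c (D.s r) = D.c (D.t r') := fun h => hD.sub_one_ne _ (h1.symm.trans h.symm)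
  exact ⟨PLift.up h1, by rw [D.objG_arrow, dif_neg h2, dif_pos h1]⟩

/-- The morphism `F (G W) ⟶ W`, which is the identity of `W_r` at each `r`. -/
noncomputable def homFG (hD : D.Adapted hQ B d) (W : QRep k (CyclicVertex p))
    (hM : ∀ r, IsIso ((D.objG W).path (D.ρ r))) : D.objF (D.objG W) hM ⟶ W :=
  homOfArrows (fun r => eqToHom (congrArg W.vec (hD.c_s r))) (by
    intro r r' e
    have aux : ∀ {A C A' E : ModuleCat.{u} k} (a : A ⟶ C) (b : A' ⟶ C) [IsIso b] (h : A' = C)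
        (_ : b = eqToHom h) (h' : A' = E) (h'' : C = E),
        (a ≫ inv b) ≫ eqToHom h' = a ≫ eqToHom h'' := by
      rintro A C _ _ a _ _ rfl rfl rfl _
      simp
    obtain ⟨e', he'⟩ := hD.objG_arrow_h W e
    obtain ⟨h, hρ⟩ := hD.objG_path W (hD.mono_ρ r')
    rw [D.objF_arrow, he']
    exact (@aux _ _ _ _ _ _ (hM r') (congrArg W.vec h) hρ _ (congrArg W.vec (hD.c_t r'))).trans
      (arrow_eqToHom (hD.c_s r) (hD.c_t r') e e'))

instance isIso_homFG (hD : D.Adapted hQ B d) (W : QRep k (CyclicVertex p))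
    (hM : ∀ r, IsIso ((D.objG W).path (D.ρ r))) : IsIso (homFG hD W hM) := by
  have : ∀ r, IsIso (NatTrans.app (homFG hD W hM) r) := fun r =>
    (eqToIso (congrArg W.vec (hD.c_s r))).isIso_hom
  exact NatIso.isIso_of_isIso_app _

/-- The path of colour `d` to `i` from the source of the segment that contains `i`. -/
noncomputable def pathTo (hD : D.Adapted hQ B d) (i : I) : Quiver.Path (D.s (D.c i)) i :=
  (hD.exists_path i).choose

theorem mono_pathTo (hD : D.Adapted hQ B d) (i : I) : B.Monochrome d (pathTo hD i) :=
  (hD.exists_path i).choose_spec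

/-- The morphism `G (F M) ⟶ M`: at `i` it is the map of `M` along the path from `s(r)` to `i`. -/
noncomputable def homGF (hD : D.Adapted hQ B d) (M : QRep k I)
    (hM : ∀ r, IsIso (M.path (D.ρ r))) : D.objG (D.objF M hM) ⟶ M :=
  homOfArrows (fun i => M.path (pathTo hD i)) (by
    intro i j g
    by_cases hg : B.col g = d
    · have key : ∀ {r r' : CyclicVertex p} (e : r = r') {q : Quiver.Path (D.s r) j}
          {q' : Quiver.Path (D.s r') j} (_ : B.Monochrome d q) (_ : B.Monochrome d q'),
          eqToHom (congrArg (D.objF M hM).vec e) ≫ M.path q' = M.path q := by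
        rintro r _ rfl q q' hq hq'
        rw [hq.path_unique_of_acyclic hQ hq']
        exact Category.id_comp _
      rw [D.objG_arrow, dif_pos (hD.c_eq_of_arrow g hg)]
      exact (key (hD.c_eq_of_arrow g hg) (q := (pathTo hD i).cons g) ⟨mono_pathTo hD i, hg⟩
        (mono_pathTo hD j)).trans (M.map_comp (pathTo hD i) g.toPath)
    · obtain ⟨r, r', e, h⟩ := hD.eq_h g hg
      obtain ⟨rfl, h⟩ := Sigma.mk.inj_iff.1 h
      obtain ⟨rfl, h⟩ := Sigma.mk.inj_iff.1 (eq_of_heq h)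
      obtain rfl := eq_of_heq h
      have aux : ∀ {A C C' : ModuleCat.{u} k} (f : A ⟶ C) (g : C' ⟶ C) [IsIso g],
          (f ≫ inv g) ≫ g = f := by simp
      have key : ∀ {a a' : CyclicVertex p} (_ : a = r) (_ : a' = r') (e' : a ⟶ a')
          {q : Quiver.Path (D.s a) (D.s r)} {q' : Quiver.Path (D.s a') (D.t r')}
          (_ : B.Monochrome d q) (_ : B.Monochrome d q'),
          (D.objF M hM).arrow e' ≫ M.path q' = M.path q ≫ M.arrow (D.h e) := by
        rintro _ _ rfl rfl e' q q' hq hq'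
        have : e' = e := Subsingleton.elim (α := PLift _) _ _
        subst this
        rw [hq.path_unique_of_acyclic hQ (q' := .nil) trivial,
          hq'.path_unique_of_acyclic hQ (hD.mono_ρ _), D.objF_arrow]
        refine (@aux _ _ _ _ _ (hM _)).trans ?_
        exact ((congrArg (· ≫ M.arrow (D.h e')) (M.map_id (D.s _))).trans
          (Category.id_comp _)).symm
      obtain ⟨e', he'⟩ := hD.objG_arrow_h (D.objF M hM) e
      rw [he']
      exact key (hD.c_s r) (hD.c_t r') e' (mono_pathTo hD _) (mono_pathTo hD _))

theorem isIso_homGF (hD : D.Adapted hQ B d) (M : QRep k I) (hb : BijectiveOn B d M)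
    (hM : ∀ r, IsIso (M.path (D.ρ r))) : IsIso (homGF hD M hM) :=
  (isIso_iff _).2 fun i => hb.actPath (mono_pathTo hD i)

/-- `G` takes nilpotent representations to tubular ones. -/
theorem Adapted.isTubular_objG (hD : D.Adapted hQ B d) {W : QRep k (CyclicVertex p)}
    (hW : nilpotentRep k p W) : D.IsTubular B d (D.objG W) := by
  obtain ⟨-, N, hN⟩ := nilpotentRep_iff.1 hW
  have hb := hD.objG_bijectiveOn W
  exact ⟨hb, hD.isIso_path hb, N, hN.of_injective (homFG hD W _) ((mono_iff _).1 inferInstance)⟩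

omit [Finite I] in
theorem Adapted.nilpotentRep_objF {M : QRep k I} (hfin : M.IsFinDim) (hM : D.IsTubular B d M)
    (hi : ∀ r, IsIso (M.path (D.ρ r))) : nilpotentRep k p (D.objF M hi) := by
  obtain ⟨-, _, N, hN⟩ := hM
  exact nilpotentRep_iff.2 ⟨fun r => hfin (D.s r), N, hN⟩

/-- `F` and `G` are quasi-inverse equivalences, for any description `P` of the category of
finite-dimensional tubular representations. -/
theorem Adapted.exists_equivalence (hD : D.Adapted hQ B d) (P : ObjectProperty (QRep k I))
    (hP : ∀ M, P M ↔ M.IsFinDim ∧ D.IsTubular B d M) :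
    ∃ (hiso : ∀ M, P M → ∀ r, IsIso (M.path (D.ρ r)))
      (hF : ∀ (M : QRep k I) (hM : P M), nilpotentRep k p (D.objF M (hiso M hM)))
      (hG : ∀ W : QRep k (CyclicVertex p), nilpotentRep k p W → P (D.objG W))
      (e : P.FullSubcategory ≌ (nilpotentRep k p).FullSubcategory),
      e.functor = D.functorF P hiso hF ∧ e.inverse = D.functorG P hG := by
  have hiso : ∀ M, P M → ∀ r, IsIso (M.path (D.ρ r)) := fun M hM =>
    hD.isIso_path ((hP M).1 hM).2.1
  have hF : ∀ (M : QRep k I) (hM : P M), nilpotentRep k p (D.objF M (hiso M hM)) := fun M hM =>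
    nilpotentRep_objF ((hP M).1 hM).1 ((hP M).1 hM).2 _
  have hG : ∀ W : QRep k (CyclicVertex p), nilpotentRep k p W → P (D.objG W) := fun W hW =>
    (hP _).2 ⟨fun i => hW.1 (D.c i), hD.isTubular_objG hW⟩
  let η : D.functorF P hiso hF ⋙ D.functorG P hG ≅ 𝟭 _ :=
    NatIso.ofComponents (fun M =>
      P.isoMk (@asIso _ _ _ _ (homGF hD M.obj (hiso _ M.property))
        (isIso_homGF hD M.obj ((hP _).1 M.property).2.1 (hiso _ M.property)))) (by
      intro M M' φ
      refine ObjectProperty.hom_ext _ (NatTrans.ext (funext fun i => ?_))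
      exact (φ.hom.naturality (pathTo hD i)).symm)
  let ε : D.functorG P hG ⋙ D.functorF P hiso hF ≅ 𝟭 _ :=
    NatIso.ofComponents (fun W =>
      (nilpotentRep k p).isoMk (@asIso _ _ _ _ (homFG hD W.obj (hiso _ (hG _ W.property)))
        (isIso_homFG hD W.obj (hiso _ (hG _ W.property))))) (by
      intro W W' ψ
      refine ObjectProperty.hom_ext _ (NatTrans.ext (funext fun r => ?_))
      exact (eqToHom_app_comm ψ.hom (hD.c_s r)).symm)
  exact ⟨hiso, hF, hG, CategoryTheory.Equivalence.mk _ _ η.symm ε, rfl, rfl⟩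

end TubeData
end AffineTube

open AffineTube
theorem proposition3p4 {k : Type u} [Field k] [IsAlgClosed k] (n : ℕ) {I : Type} [Quiver.{0} I]
    [Fintype I] [∀ i j : I, Fintype (i ⟶ j)] (hA : IsTypeAffineA n I) (hQ : NoOrientedCycle I)
    (R : QRep k I) (hR : IsRegularSimple R) (p : ℕ) (hp : HasPeriod R p) (hp1 : p ≠ 1) :
    ∃ (D : TubeData p (fun r => (orbitSimple R p r).supp))
      (hiso : ∀ M, repTube R M → ∀ r, IsIso (M.path (D.ρ r)))
      (hF : ∀ (M : QRep k I) (hM : repTube R M), nilpotentRep k p (D.objF M (hiso M hM)))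
      (hG : ∀ W : QRep k (CyclicVertex p), nilpotentRep k p W → repTube R (D.objG W))
      (e : (repTube R).FullSubcategory ≌ (nilpotentRep k p).FullSubcategory),
      e.functor = D.functorF (repTube R) hiso hF ∧ e.inverse = D.functorG (repTube R) hG := by
  obtain ⟨B⟩ := exists_directionColouring hA
  obtain ⟨d, s, hs, ⟨e⟩⟩ := exists_iso_segmentRep hQ B hR hp hp1
  obtain ⟨σ, hσ, hinj, hnext, hcov, hor⟩ := exists_segment_indexing hs e hp
  have hone : (1 : CyclicVertex p) ≠ 0 := fun h => hp1 (ZMod.one_eq_zero_iff.1 h)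
  obtain ⟨D, hD, hDs⟩ := TubeData.exists_adapted hone σ hσ hinj hnext hcov
    (fun r => (orbitSimple R p r).supp) fun r => by
      rw [QRep.supp_eq_of_iso (hor r).some, thin_supp]
  exact ⟨D, hD.exists_equivalence (repTube R) fun M =>
    ⟨fun hM => ⟨hM.1, hD.isTubular_of_repTube hs e hM⟩,
      fun hM => hD.repTube_of_isTubular (by rw [hDs]; exact hor) hM.1 hM.2⟩⟩
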